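/- \textbf{Planes.} Consider two-sorted structures $\Pi$ (points and lines) with incidence $P\in\ell$, a binary relation $\ell\perp m$ on lines, and a ternary relation $Be(A,B,C)$ on points (``$B$ lies between $A$ and $C$''). Lines are parallel if they have no common point; a line $\ell$ is isotropic if $\ell\perp\ell$. $\Pi$ is a \emph{Desarguesian plane} if: two distinct points lie on exactly one line; every line has at least two points; there are three distinct non-collinear points; through a point not on $\ell$ there is exactly one parallel to $\ell$; (infinity) if $A_0\in\ell$, $B\neq C$ lie on a parallel to $\ell$, and inductively $A_{n+1}$ is the intersection of $\ell$ with the parallel to $A_nB$ through $C$, then all $A_n$ are distinct; (Desargues 1) if $AB\parallel A'B'$, $AC\parallel A'C'$, $BC\parallel B'C'$ for triangles $ABC$, $A'B'C'$, then $AA',BB',CC'$ are pairwise parallel or concurrent; (Desargues 2) if $AB\parallel A'B'$, $AC\parallel A'C'$ and $AA',BB',CC'$ are distinct and pairwise parallel or concurrent, then $BC\parallel B'C'$. It is an \emph{orthogonal Wu plane} if moreover: $\perp$ is symmetric; for every point $O$ and line $\ell$ there is exactly one line through $O$ orthogonal to $\ell$; $\ell\perp m$ and $\ell\perp n$ imply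 $m\parallel n$ or $m=n$; through every point there is a non-isotropic line; the three heights of a triangle meet in exactly one point. For $A\ne B$, the symmetric point $C$ of $A$ with respect to $B$ is the point of $AB$ obtained by choosing $E\notin AB$ and $D$ with $AB\parallel ED$, $AE\parallel BD$, $EB\parallel DC$; the symmetric point of $A$ with respect to $A$ is $A$. The midpoint of $A\neq B$ is the point $N\in AB$ obtained by choosing $N'\notin AB$, letting $B'$ be the symmetric point of $A$ with respect to $N'$, and drawing $N'N\parallel B'B$; the midpoint of $A$ and $A$ is $A$. $Sym(A,\ell,B)$ means that either $A\ne B$ and $\ell$ is the line through the midpoint of $A,B$ orthogonal to $AB$, or $A=B\in\ell$. A symmetric axis of lines $\ell,m$ is a non-isotropic line $k$ such that every $A\in\ell$ has some $B\in m$ with $Sym(A,k,B)$. An orthogonal Wu plane is a \emph{metric Wu plane} if any two intersecting non-isotropic lines have a symmetric axis. An \emph{ordered metric Wu plane} is a metric Wu plane in which: $Be(A,B,C)$ implies that $A,B,C$ are distinct and collinear; $Be(A,B,C)$ implies $Be(C,B,A)$; for $A\neq C$ there are $B,D$ with $Be(A,B,C)$ and $Be(A,C,D)$; of three distinct collinear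 points exactly one lies between the other two; and (Pasch) if $A,B,C$ are not collinear, none of them is on $\ell$, and some $D\in\ell$ satisfies $Be(A,D,B)$, then some $D'\in\ell$ satisfies $Be(A,D',C)$ or $Be(B,D',C)$. $Closer(A,\ell,B)$ means that there are $H\in\ell$, a point $B'$ and a line $m\ni A$ with $Sym(H,m,B')$ and ($Be(A,B',B)$ or $B=B'$). A \emph{Euclidean ordered metric Wu plane} is an ordered metric Wu plane that satisfies (H*5): for all points $P_1,P_2$ and every line $\ell$ with $Closer(P_2,\ell,P_1)$ there are a line $k\ni P_2$ and a point $P_3\in\ell$ with $Sym(P_1,k,P_3)$. \textbf{Fields.} A \emph{Euclidean field} is a field in which $-1$ is not a sum of squares, every sum of two squares is a square, and every element is a square or the opposite of a square; it is ordered by $x\le y\iff\exists z\,(x+z^2=y)$. As a structure it has the graphs of $+$ and $\cdot$ and the elements $0,1$ as relations. \textbf{Constructions.} For a Euclidean field $F$, $PP^*_{wu}(F)$ has as points the pairs $(x,y)\in F^2$ and as lines the triples $(a,b,c)\in F^3$ with $(a,b)\ne(0,0)$ up to proportionality; $(x,y)$ is on $(a,b,c)$ iff $ax+by+c=0$; $(a,b,c)\perp(a',b',c')$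 iff $aa'+bb'=0$; $Be(A,B,C)$ iff $A\ne C$ and $B=A+t(C-A)$ for some $0<t<1$. For a plane $\Pi$, admissible parameters are lines $\ell_0,m_0$ meeting in exactly one point $O$ and a point $Z_0\notin\ell_0\cup m_0$. Identify $\ell_0$ with $m_0$ by letting $X\in\ell_0$ correspond to $Y\in m_0$ if they are the projections, along $m_0$ and $\ell_0$ respectively, of one point of the line $OZ_0$. A point $P$ has coordinates $(X,Y)$, $X,Y\in\ell_0$, where $X$ is its projection to $\ell_0$ along $m_0$, and $Y$ corresponds to its projection to $m_0$ along $\ell_0$. Put $0=O$, and let $1$ be the projection of $Z_0$ to $\ell_0$. A line not parallel or equal to $m_0$ has slope $a$ if the line through $O$ parallel or equal to it contains the point $(1,a)$. Let $T(a,x,b)=y$ iff the line of slope $a$ through $(0,b)$ contains $(x,y)$. $RF^*_{field}(\Pi)$ is the set of points of $\ell_0$ with $a+b=T(a,1,b)$, $a\cdot x=T(a,x,0)$, $0$, $1$. Call $A\in\ell_0$ positive if $A\ne0$ and $0$ does not lie between $A$ and $1$. \textbf{Theorem.} \begin{itemize} \item[(i)] If $F$ is a Euclidean field, then $PP^*_{wu}(F)$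 is a Euclidean ordered metric Wu plane. \item[(ii)] If $\Pi$ is a Euclidean ordered metric Wu plane, then, for all admissible parameters, $RF^*_{field}(\Pi)$ is a Euclidean field, and in its ordering $a<b$ iff $b-a$ is positive in the above sense. \item[(iii)] For every Euclidean field $F$ and all admissible parameters, $RF^*_{field}(PP^*_{wu}(F))\cong F$. \item[(iv)] For every Euclidean ordered metric Wu plane $\Pi$ and all admissible parameters, $PP^*_{wu}(RF^*_{field}(\Pi))\cong\Pi$. \item[(v)] The constructions form a bi-interpretation between the class of Euclidean fields and the class of Euclidean ordered metric Wu planes. That is: $PP^*_{wu}$ (without parameters, points named by pairs, lines by triples) and $RF^*_{field}$ (with parameters $\ell_0,m_0,Z_0$, elements named by points) are given, uniformly on these classes, by first-order formulas defining the admissible parameters, the domains, equality and all relations, hence are interpretations of each class in the other; and there are first-order formulas $\alpha$ (in the language of fields) and $\beta$ (in the language of planes), which may use the parameters, such that for every Euclidean field $F$, every Euclidean ordered metric Wu plane $\Pi$ and all admissible parameters, $\alpha$ defines in $F$ an isomorphism $F\cong RF^*_{field}(PP^*_{wu}(F))$, and $\beta$ defines in $\Pi$ an isomorphism $\Pi\cong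 PP^*_{wu}(RF^*_{field}(\Pi))$. \end{itemize} -/

import Mathlib

universe u

namespace OrigamiGeometry

/-! ### Many-sorted relational first-order logic -/

/-- A relational first-order signature with finitely many sorts.  `arity r s` is the number of
arguments of sort `s` of the relation symbol `r`. -/
structure Signature where
  Srt : Type
  Rel : Type
  arity : Rel → Srt → ℕ
  finite_srt : Finite Srt

/-- A structure of signature `L`. -/
structure Str (L : Signature) where
  carrier : L.Srt → Type u
  rel : ∀ r : L.Rel, (∀ s, Fin (L.arity r s) → carrier s) → Prop

/-- Isomorphisms of structures. -/
structure Str.Iso {L : Signature} (M N : Str.{u} L) where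
  toEquiv : ∀ s, M.carrier s ≃ N.carrier s
  map_rel : ∀ (r : L.Rel) (x : ∀ s, Fin (L.arity r s) → M.carrier s),
    M.rel r x ↔ N.rel r (fun s i => toEquiv s (x s i))

/-- A family of variables (a context) extended by one new variable of sort `s`. -/
inductive Ext {S : Type} (V : S → Type) (s : S) : S → Type
  | old {t : S} (x : V t) : Ext V s t
  | new : Ext V s s

/-- First-order formulas of signature `L`, with equality, whose free variables of sort `s` are
taken from `V s`. -/
inductive Fml (L : Signature) : (L.Srt → Type) → Type 1
  | equal {V : L.Srt → Type} (s : L.Srt) (x y : V s) : Fml L V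
  | rel {V : L.Srt → Type} (r : L.Rel) (x : ∀ s, Fin (L.arity r s) → V s) : Fml L V
  | falsum {V : L.Srt → Type} : Fml L V
  | imp {V : L.Srt → Type} (φ ψ : Fml L V) : Fml L V
  | all {V : L.Srt → Type} (s : L.Srt) (φ : Fml L (Ext V s)) : Fml L V

/-- Assignments of elements of `M` to the variables in `V`. -/
abbrev Val {L : Signature} (M : Str.{u} L) (V : L.Srt → Type) : Type u :=
  ∀ s, V s → M.carrier s

/-- The assignment `v` extended by the value `a` for the new variable. -/
def Val.extend {L : Signature} {M : Str.{u} L} {V : L.Srt → Type} (v : Val M V) {s : L.Srt}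
    (a : M.carrier s) : Val M (Ext V s)
  | _, .old x => v _ x
  | _, .new => a

/-- Truth of a formula in `M` under an assignment. -/
def Fml.Realize {L : Signature} (M : Str.{u} L) :
    ∀ {V : L.Srt → Type}, Fml L V → Val M V → Prop
  | _, .equal s x y, v => v s x = v s y
  | _, .rel r x, v => M.rel r (fun s i => v s (x s i))
  | _, .falsum, _ => False
  | _, .imp φ ψ, v => Fml.Realize M φ v → Fml.Realize M ψ v
  | _, .all s φ, v => ∀ a : M.carrier s, Fml.Realize M φ (v.extend a)

/-- The context with `n s` variables of each sort `s`. -/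
abbrev Vars {S : Type} (n : S → ℕ) : S → Type := fun s => Fin (n s)

/-- The context with exactly one variable, of sort `s`. -/
inductive One {S : Type} (s : S) : S → Type
  | var : One s s

/-- Disjoint union of contexts. -/
abbrev Join {S : Type} (V W : S → Type) : S → Type := fun s => V s ⊕ W s

/-- Assignment of a disjoint union of contexts. -/
def Val.join {L : Signature} {M : Str.{u} L} {V W : L.Srt → Type} (v : Val M V) (w : Val M W) :
    Val M (Join V W) :=
  fun s => Sum.elim (v s) (w s)

/-- The assignment of the value `a` to a single variable. -/
def Val.one {L : Signature} {M : Str.{u} L} {s : L.Srt} (a : M.carrier s) : Val M (One s)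
  | _, .var => a

/-! ### Translation schemes, interpretations, bi-interpretations -/

/-- The numerical data of a translation scheme from `L` to `K`: `par k` parameters of each sort `k`
of `K`, and elements of sort `s` of `L` are named by tuples with `dim s k` entries of each
sort `k` of `K`. -/
structure Shape (L K : Signature) where
  par : K.Srt → ℕ
  dim : L.Srt → K.Srt → ℕ
  dim_pos : ∀ s, ∃ k, 0 < dim s k

/-- The context that has, for each `L`-variable in `V`, a tuple of `K`-variables. -/
abbrev Blocks {L K : Signature} (D : Shape L K) (V : L.Srt → Type) : K.Srt → Type :=
  fun k => Σ s : L.Srt, V s × Fin (D.dim s k)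

/-- A family of tuples, one for each variable in `V`, as an assignment. -/
def Val.blocks {L K : Signature} {D : Shape L K} {M : Str.{u} K} {V : L.Srt → Type}
    (y : ∀ s, V s → Val M (Vars (D.dim s))) : Val M (Blocks D V) :=
  fun k x => y x.1 x.2.1 k x.2.2

/-- A translation scheme from `L` to `K`, with parameters: a formula for the admissible
parameters, and formulas for the domain of each sort, for the interpreted equality on each sort
and for each relation symbol of `L`. -/
structure Translation {L K : Signature} (D : Shape L K) where
  adm : Fml K (Vars D.par)
  dom : ∀ s : L.Srt, Fml K (Join (Vars (D.dim s)) (Vars D.par))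
  eqv : ∀ s : L.Srt, Fml K (Join (Join (Vars (D.dim s)) (Vars (D.dim s))) (Vars D.par))
  rel : ∀ r : L.Rel, Fml K (Join (Blocks D (Vars (L.arity r))) (Vars D.par))

namespace Translation

variable {L K : Signature} {D : Shape L K} (t : Translation D) (M : Str.{u} K)
  (p : Val M (Vars D.par))

/-- The parameters `p` are admissible. -/
def Adm : Prop := t.adm.Realize M p

/-- The tuples that name elements of sort `s`. -/
def Dom (s : L.Srt) : Type u := {x : Val M (Vars (D.dim s)) // (t.dom s).Realize M (x.join p)}

/-- Interpreted equality. -/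
def Eqv (s : L.Srt) (x y : t.Dom M p s) : Prop :=
  (t.eqv s).Realize M ((Val.join x.1 y.1).join p)

/-- Interpreted relations, on tuples. -/
def Holds (r : L.Rel) (x : ∀ s, Fin (L.arity r s) → t.Dom M p s) : Prop :=
  (t.rel r).Realize M (Val.join (Val.blocks fun s i => (x s i).1) p)

/-- The internal `L`-structure defined by the scheme in `M`: the quotient of the domains by the
interpreted equality, with the interpreted relations. -/
def induced : Str.{u} L where
  carrier s := Quot (t.Eqv M p s)
  rel r x := ∃ y : ∀ s, Fin (L.arity r s) → t.Dom M p s,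
    (∀ s i, Quot.mk _ (y s i) = x s i) ∧ t.Holds M p r y

/-- The tuple `x` names the element `b` of the internal structure. -/
def Names (s : L.Srt) (x : Val M (Vars (D.dim s))) (b : (t.induced M p).carrier s) : Prop :=
  ∃ h : (t.dom s).Realize M (x.join p), Quot.mk (t.Eqv M p s) ⟨x, h⟩ = b

/-- The domains are nonempty, and interpreted equality is a congruence. -/
structure WellDefined : Prop where
  nonempty : ∀ s, Nonempty (t.Dom M p s)
  equivalence : ∀ s, Equivalence (t.Eqv M p s)
  congr : ∀ (r : L.Rel) (x y : ∀ s, Fin (L.arity r s) → t.Dom M p s),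
    (∀ s i, t.Eqv M p s (x s i) (y s i)) → t.Holds M p r x → t.Holds M p r y

/-- `t` is an interpretation of the class `S` of `L`-structures in the class `T` of
`K`-structures. -/
def IsInterpretation (T : Str.{u} K → Prop) (S : Str.{u} L → Prop) : Prop :=
  ∀ M, T M → (∃ p, t.Adm M p) ∧ ∀ p, t.Adm M p → t.WellDefined M p ∧ S (t.induced M p)

end Translation

/-- Formulas, one for each sort of `K`, that relate an element of a `K`-structure `M`, an element
of the internal `K`-structure of the internal `L`-structure of `M` (given by a tuple of tuples)
and the parameters of the two schemes. -/
abbrev IsoFormula {L K : Signature} (D : Shape L K) (E : Shape K L) : Type 1 :=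
  ∀ s : K.Srt, Fml K (Join (Join (Join (One s) (Blocks D (Vars (E.dim s)))) (Vars D.par))
    (Blocks D (Vars E.par)))

/-- In every structure `M` of the class `T`, and for all admissible choices of parameters, `α`
defines an isomorphism between `M` and the internal structure of its internal structure. -/
def DefinesIso {L K : Signature} {D : Shape L K} {E : Shape K L} (σ : Translation D)
    (ξ : Translation E) (α : IsoFormula D E) (T : Str.{u} K → Prop) : Prop :=
  ∀ M, T M → ∀ p, σ.Adm M p →
    ∀ (q : Val (σ.induced M p) (Vars E.par)) (q' : ∀ l, Fin (E.par l) → Val M (Vars (D.dim l))),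
      (∀ l i, σ.Names M p l (q' l i) (q l i)) → ξ.Adm (σ.induced M p) q →
      ∃ e : Str.Iso M (ξ.induced (σ.induced M p) q),
        ∀ (s : K.Srt) (a : M.carrier s) (y : ∀ l, Fin (E.dim s l) → Val M (Vars (D.dim l))),
          (α s).Realize M
              ((((Val.one a).join (Val.blocks y)).join p).join (Val.blocks q')) ↔
            ∃ z : Val (σ.induced M p) (Vars (E.dim s)),
              (∀ l i, σ.Names M p l (y l i) (z l i)) ∧
                ξ.Names (σ.induced M p) q s z (e.toEquiv s a)

/-- The schemes `σ` (defining `L`-structures in `K`-structures) and `ξ` (defining `K`-structures in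
`L`-structures), with the formulas `α`, `β`, form a bi-interpretation between the class `T` of
`K`-structures and the class `S` of `L`-structures. -/
structure IsBiInterpretation {L K : Signature} {D : Shape L K} {E : Shape K L}
    (T : Str.{u} K → Prop) (S : Str.{u} L → Prop) (σ : Translation D) (ξ : Translation E)
    (α : IsoFormula D E) (β : IsoFormula E D) : Prop where
  interp_left : σ.IsInterpretation T S
  interp_right : ξ.IsInterpretation S T
  iso_left : DefinesIso σ ξ α T
  iso_right : DefinesIso ξ σ β S

/-! ### Fields as relational structures, Euclidean fields -/

inductive FieldRel
  | add | mul | zero | one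

/-- The one-sorted relational signature of fields: the graphs of `+` and `*`, and `0`, `1`. -/
def fieldSig : Signature where
  Srt := Unit
  Rel := FieldRel
  arity
    | .add, _ => 3
    | .mul, _ => 3
    | .zero, _ => 1
    | .one, _ => 1
  finite_srt := inferInstance

/-- The structure of signature `fieldSig` with given relations. -/
def mkFieldStr (F : Type u) (add mul : F → F → F → Prop) (zero one : F → Prop) :
    Str.{u} fieldSig where
  carrier := fun _ => F
  rel := fun r x => match r, x with
    | .add, x => let y : Fin 3 → F := x (); add (y 0) (y 1) (y 2)
    | .mul, x => let y : Fin 3 → F := x (); mul (y 0) (y 1) (y 2)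
    | .zero, x => let y : Fin 1 → F := x (); zero (y 0)
    | .one, x => let y : Fin 1 → F := x (); one (y 0)

/-- A field as a structure of signature `fieldSig`. -/
def fieldStr (F : Type u) [Field F] : Str.{u} fieldSig :=
  mkFieldStr F (fun a b c => a + b = c) (fun a b c => a * b = c) (fun a => a = 0) (fun a => a = 1)

/-- A Euclidean field: a formally real Pythagorean field in which every element is a square or
the opposite of a square. -/
structure IsEuclideanField (F : Type u) [Field F] : Prop where
  formallyReal : ¬ IsSumSq (-1 : F)
  pythagorean : ∀ x y : F, ∃ z, x ^ 2 + y ^ 2 = z ^ 2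
  square_or_neg_square : ∀ x : F, ∃ y, x = y ^ 2 ∨ -x = y ^ 2

/-- The class of Euclidean fields, as structures of signature `fieldSig`. -/
def EuclideanFieldStr (N : Str.{u} fieldSig) : Prop :=
  ∃ (F : Type u) (_ : Field F), IsEuclideanField F ∧ Nonempty (Str.Iso N (fieldStr F))

/-- The strict version of the ordering `x ≤ y ↔ ∃ z, x + z ^ 2 = y` of a Euclidean field. -/
def SqLt {F : Type u} [Field F] (x y : F) : Prop := x ≠ y ∧ ∃ z, x + z ^ 2 = y

/-! ### Planes with incidence, orthogonality and betweenness -/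

inductive PlaneSort
  | point | line

inductive PlaneRel
  | inc | perp | between

/-- The two-sorted signature of incidence, orthogonality and betweenness. -/
def planeSig : Signature where
  Srt := PlaneSort
  Rel := PlaneRel
  arity
    | .inc, .point => 1
    | .inc, .line => 1
    | .perp, .point => 0
    | .perp, .line => 2
    | .between, .point => 3
    | .between, .line => 0
  finite_srt := Finite.of_surjective (fun b : Bool => if b then PlaneSort.point else PlaneSort.line)
    (by rintro (_ | _); exacts [⟨true, rfl⟩, ⟨false, rfl⟩])

/-- The structure of signature `planeSig` with given points, lines and relations. -/
def mkPlane (Pt Ln : Type u) (inc : Pt → Ln → Prop) (perp : Ln → Ln → Prop)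
    (be : Pt → Pt → Pt → Prop) : Str.{u} planeSig where
  carrier
    | .point => Pt
    | .line => Ln
  rel := fun r x => match r, x with
    | .inc, x =>
      let A : Fin 1 → Pt := x .point
      let l : Fin 1 → Ln := x .line
      inc (A 0) (l 0)
    | .perp, x => let l : Fin 2 → Ln := x .line; perp (l 0) (l 1)
    | .between, x => let A : Fin 3 → Pt := x .point; be (A 0) (A 1) (A 2)

namespace Str

section Relations

variable (M : Str.{u} planeSig)

/-- The points of the plane. -/
abbrev Pt : Type u := M.carrier PlaneSort.point

/-- The lines of the plane. -/
abbrev Ln : Type u := M.carrier PlaneSort.line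

/-- The point `A` lies on the line `l`. -/
def Inc (A : M.Pt) (l : M.Ln) : Prop :=
  M.rel PlaneRel.inc fun s => match s with
    | .point => (fun _ => A : Fin 1 → M.Pt)
    | .line => (fun _ => l : Fin 1 → M.Ln)

/-- The lines `l` and `m` are orthogonal. -/
def Perp (l m : M.Ln) : Prop :=
  M.rel PlaneRel.perp fun s => match s with
    | .point => (Fin.elim0 : Fin 0 → M.Pt)
    | .line => (![l, m] : Fin 2 → M.Ln)

/-- The point `B` lies between `A` and `C`. -/
def Be (A B C : M.Pt) : Prop :=
  M.rel PlaneRel.between fun s => match s with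
    | .point => (![A, B, C] : Fin 3 → M.Pt)
    | .line => (Fin.elim0 : Fin 0 → M.Ln)

/-- The lines `l` and `m` are parallel: they do not meet. -/
def Par (l m : M.Ln) : Prop := ¬ ∃ A, M.Inc A l ∧ M.Inc A m

/-- Three points lie on one line. -/
def Col (A B C : M.Pt) : Prop := ∃ l, M.Inc A l ∧ M.Inc B l ∧ M.Inc C l

/-- `AB` and `CD` are (well-determined and) parallel lines. -/
def ParPts (A B C D : M.Pt) : Prop :=
  A ≠ B ∧ C ≠ D ∧ ∃ l m, M.Inc A l ∧ M.Inc B l ∧ M.Inc C m ∧ M.Inc D m ∧ M.Par l m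

/-- Three lines are pairwise parallel, or pass through a common point. -/
def ParOrConcur (a b c : M.Ln) : Prop :=
  (M.Par a b ∧ M.Par b c ∧ M.Par a c) ∨ ∃ S, M.Inc S a ∧ M.Inc S b ∧ M.Inc S c

end Relations

/-- Desarguesian planes: incidence axioms, axiom of parallels, axiom of infinity and the two
axioms of Desargues. -/
structure IsDesarguesian (M : Str.{u} planeSig) : Prop where
  line_through : ∀ A B : M.Pt, A ≠ B → ∃! l, M.Inc A l ∧ M.Inc B l
  two_points : ∀ l : M.Ln, ∃ A B, A ≠ B ∧ M.Inc A l ∧ M.Inc B l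
  three_points : ∃ A B C : M.Pt, A ≠ B ∧ A ≠ C ∧ B ≠ C ∧ ¬ M.Col A B C
  parallel : ∀ (l : M.Ln) (A : M.Pt), ¬ M.Inc A l → ∃! m, M.Inc A m ∧ M.Par m l
  /-- If `B`, `C` are distinct points on a parallel to `l`, `a 0` lies on `l`, and `a (n + 1)` is
  the point at which the parallel to `a n, B` through `C` meets `l`, then the points `a n` are all
  distinct. -/
  infinite : ∀ (l : M.Ln) (B C : M.Pt) (a : ℕ → M.Pt), M.ParPts B C (a 0) (a 1) →
    (∀ n, M.Inc (a n) l) → (∀ n, M.ParPts (a n) B C (a (n + 1))) → Function.Injective a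
  desargues₁ : ∀ A B C A' B' C' : M.Pt, ¬ M.Col A B C → ¬ M.Col A' B' C' →
    M.ParPts A B A' B' → M.ParPts A C A' C' → M.ParPts B C B' C' →
    ∀ a b c : M.Ln, M.Inc A a → M.Inc A' a → M.Inc B b → M.Inc B' b → M.Inc C c → M.Inc C' c →
      M.ParOrConcur a b c
  desargues₂ : ∀ A B C A' B' C' : M.Pt, ¬ M.Col A B C → ¬ M.Col A' B' C' →
    M.ParPts A B A' B' → M.ParPts A C A' C' →
    ∀ a b c : M.Ln, M.Inc A a → M.Inc A' a → M.Inc B b → M.Inc B' b → M.Inc C c → M.Inc C' c →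
      a ≠ b → a ≠ c → b ≠ c → M.ParOrConcur a b c → M.ParPts B C B' C'

/-- Orthogonal Wu planes. -/
structure IsOrthogonalWu (M : Str.{u} planeSig) : Prop extends M.IsDesarguesian where
  perp_comm : ∀ l m : M.Ln, M.Perp l m ↔ M.Perp m l
  perp_through : ∀ (O : M.Pt) (l : M.Ln), ∃! m, M.Perp l m ∧ M.Inc O m
  perp_perp : ∀ l m n : M.Ln, M.Perp l m → M.Perp l n → M.Par m n ∨ m = n
  exists_nonisotropic : ∀ O : M.Pt, ∃ l, M.Inc O l ∧ ¬ M.Perp l l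
  /-- The three heights of a triangle meet in a point. -/
  heights : ∀ A B C : M.Pt, ¬ M.Col A B C → ∀ a b c ha hb hc : M.Ln,
    M.Inc B a → M.Inc C a → M.Inc C b → M.Inc A b → M.Inc A c → M.Inc B c →
    M.Inc A ha → M.Perp ha a → M.Inc B hb → M.Perp hb b → M.Inc C hc → M.Perp hc c →
    ∃! H, M.Inc H ha ∧ M.Inc H hb ∧ M.Inc H hc

section Symmetry

variable (M : Str.{u} planeSig)

/-- `C` is the symmetric point of `A` with respect to `B`: `ABDE` and `BCDE` are parallelograms
for some `E` off the line `AB` and some `D`. -/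
def SymPoint (A B C : M.Pt) : Prop :=
  (A = B ∧ C = A) ∨ (A ≠ B ∧ M.Col A B C ∧ ∃ E D, ¬ M.Col A B E ∧
    M.ParPts A B E D ∧ M.ParPts A E B D ∧ M.ParPts E B D C)

/-- `N` is the midpoint of `A` and `B`: for some `N'` off the line `AB` and the symmetric point `B'`
of `A` with respect to `N'`, the line through `N'` parallel to `B'B` meets `AB` at `N`. -/
def Midpoint (A B N : M.Pt) : Prop :=
  (A = B ∧ N = A) ∨ (A ≠ B ∧ M.Col A B N ∧ ∃ N' B', ¬ M.Col A B N' ∧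
    M.SymPoint A N' B' ∧ M.ParPts N' N B' B)

/-- `l` is the perpendicular bisector of the distinct points `A`, `B`. -/
def PerpBisector (A B : M.Pt) (l : M.Ln) : Prop :=
  A ≠ B ∧ ∃ N n, M.Midpoint A B N ∧ M.Inc A n ∧ M.Inc B n ∧ M.Inc N l ∧ M.Perp l n

/-- `A` and `B` are symmetric with respect to the line `l`. -/
def Sym (A : M.Pt) (l : M.Ln) (B : M.Pt) : Prop :=
  M.PerpBisector A B l ∨ (A = B ∧ M.Inc A l)

/-- The non-isotropic line `k` is a symmetric axis of the lines `l` and `m`. -/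
def SymAxis (k l m : M.Ln) : Prop :=
  ¬ M.Perp k k ∧ ∀ A, M.Inc A l → ∃ B, M.Inc B m ∧ M.Sym A k B

end Symmetry

/-- Metric Wu planes. -/
structure IsMetricWu (M : Str.{u} planeSig) : Prop extends M.IsOrthogonalWu where
  symAxis : ∀ l m : M.Ln, (∃ A, M.Inc A l ∧ M.Inc A m) → ¬ M.Perp l l → ¬ M.Perp m m →
    ∃ k, M.SymAxis k l m

/-- Ordered metric Wu planes. -/
structure IsOrderedMetricWu (M : Str.{u} planeSig) : Prop extends M.IsMetricWu where
  /-- Betweenness only relates three distinct points on a line. -/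
  be_distinct_col : ∀ A B C : M.Pt, M.Be A B C → A ≠ B ∧ A ≠ C ∧ B ≠ C ∧ M.Col A B C
  be_symm : ∀ A B C : M.Pt, M.Be A B C → M.Be C B A
  be_exists : ∀ A C : M.Pt, A ≠ C → (∃ B, M.Be A B C) ∧ ∃ D, M.Be A C D
  /-- Exactly one of three distinct collinear points lies between the other two. -/
  be_trichotomy : ∀ A B C : M.Pt, A ≠ B → A ≠ C → B ≠ C → M.Col A B C →
    (M.Be A B C ∨ M.Be B A C ∨ M.Be A C B) ∧ ¬ (M.Be A B C ∧ M.Be B A C) ∧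
      ¬ (M.Be A B C ∧ M.Be A C B) ∧ ¬ (M.Be B A C ∧ M.Be A C B)
  pasch : ∀ (A B C : M.Pt) (l : M.Ln), ¬ M.Col A B C → ¬ M.Inc A l → ¬ M.Inc B l → ¬ M.Inc C l →
    ∀ D, M.Inc D l → M.Be A D B → ∃ D', M.Inc D' l ∧ (M.Be A D' C ∨ M.Be B D' C)

/-- The point `A` is closer to the line `l` than to the point `B`. -/
def Closer (M : Str.{u} planeSig) (A : M.Pt) (l : M.Ln) (B : M.Pt) : Prop :=
  ∃ H B' m, M.Inc H l ∧ M.Inc A m ∧ M.Sym H m B' ∧ (M.Be A B' B ∨ B = B')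

/-- Euclidean ordered metric Wu planes. -/
structure IsEuclideanOrderedMetricWu (M : Str.{u} planeSig) : Prop
    extends M.IsOrderedMetricWu where
  /-- If `P₂` is closer to `l` than to `P₁`, then some fold `k` passes through `P₂` and places `P₁`
  onto `l`. -/
  fold : ∀ (P₁ P₂ : M.Pt) (l : M.Ln), M.Closer P₂ l P₁ →
    ∃ k, M.Inc P₂ k ∧ ∃ P₃, M.Sym P₁ k P₃ ∧ M.Inc P₃ l

end Str

/-! ### The Cartesian plane over a field -/

section Cartesian

variable (F : Type u) [Field F]

/-- Coefficients `(a, b, c)` of the equation `a * x + b * y + c = 0` of a line. -/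
def LineEq : Type u := {e : F × F × F // e.1 ≠ 0 ∨ e.2.1 ≠ 0}

/-- Proportional equations define the same line. -/
def lineSetoid : Setoid (LineEq F) where
  r e f := ∃ k : F, k ≠ 0 ∧ f.1 = (k * e.1.1, k * e.1.2.1, k * e.1.2.2)
  iseqv :=
    { refl := fun e => ⟨1, one_ne_zero, by simp⟩
      symm := by
        rintro e f ⟨k, hk, h⟩
        refine ⟨k⁻¹, inv_ne_zero hk, ?_⟩
        simp [h, hk]
      trans := by
        rintro e f g ⟨k, hk, h⟩ ⟨k', hk', h'⟩
        refine ⟨k' * k, mul_ne_zero hk' hk, ?_⟩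
        simp [h, h', mul_assoc] }

/-- Lines of the Cartesian plane. -/
def CartesianLine : Type u := Quotient (lineSetoid F)

/-- The Cartesian plane over `F`, with betweenness given by the ordering `SqLt`: `B` lies
between `A` and `C` if `A ≠ C` and `B = A + t (C - A)` with `0 < t < 1`. -/
def cartesianPlane : Str.{u} planeSig :=
  mkPlane (F × F) (CartesianLine F)
    (fun P l => ∃ e : LineEq F, Quotient.mk (lineSetoid F) e = l ∧
      e.1.1 * P.1 + e.1.2.1 * P.2 + e.1.2.2 = 0)
    (fun l m => ∃ e f : LineEq F, Quotient.mk (lineSetoid F) e = l ∧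
      Quotient.mk (lineSetoid F) f = m ∧ e.1.1 * f.1.1 + e.1.2.1 * f.1.2.1 = 0)
    (fun A B C => A ≠ C ∧ ∃ t : F, SqLt 0 t ∧ SqLt t 1 ∧
      B = (A.1 + t * (C.1 - A.1), A.2 + t * (C.2 - A.2)))

end Cartesian

/-! ### Coordinatization -/

namespace Str

section Coordinates

variable (M : Str.{u} planeSig)

/-- `A` and `B` lie on a common line that is parallel or equal to `l`. -/
def Along (l : M.Ln) (A B : M.Pt) : Prop :=
  ∃ k, M.Inc A k ∧ M.Inc B k ∧ (M.Par k l ∨ k = l)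

/-- Admissible parameters: `l₀`, `m₀` meet in exactly one point and `Z₀` lies on neither. -/
def AdmissibleAxes (l₀ m₀ : M.Ln) (Z₀ : M.Pt) : Prop :=
  (∃! O, M.Inc O l₀ ∧ M.Inc O m₀) ∧ ¬ M.Inc Z₀ l₀ ∧ ¬ M.Inc Z₀ m₀

/-- The points of the line `l₀`. -/
def PointsOn (l₀ : M.Ln) : Type u := {A : M.Pt // M.Inc A l₀}

variable (l₀ m₀ : M.Ln) (Z₀ : M.Pt)

/-- `O` is the origin, the common point of the axes. -/
def IsOrigin (O : M.Pt) : Prop := M.Inc O l₀ ∧ M.Inc O m₀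

/-- `I` is the unit point of the axis `l₀`. -/
def IsUnitPt (I : M.Pt) : Prop := M.Inc I l₀ ∧ M.Along m₀ Z₀ I

/-- The bijection between the axes: `X` on `l₀` and `Y` on `m₀` are the projections of a point `H`
of the diagonal `O Z₀`. -/
def AxisBij (X Y : M.Pt) : Prop :=
  M.Inc X l₀ ∧ M.Inc Y m₀ ∧ ∃ O d H, M.IsOrigin l₀ m₀ O ∧ M.Inc O d ∧ M.Inc Z₀ d ∧ M.Inc H d ∧
    M.Along m₀ X H ∧ M.Along l₀ H Y

/-- The point `P` has coordinates `(X, Y)`, both of them points of `l₀`. -/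
def Coord (P X Y : M.Pt) : Prop :=
  M.Inc X l₀ ∧ M.Along m₀ P X ∧ ∃ W, M.Inc W m₀ ∧ M.Along l₀ P W ∧ M.AxisBij l₀ m₀ Z₀ Y W

/-- The line `l` is not vertical and has slope `a`: the parallel to `l` through the origin
contains the point with coordinates `(1, a)`. -/
def Slope (l : M.Ln) (a : M.Pt) : Prop :=
  ¬ (M.Par l m₀ ∨ l = m₀) ∧ ∃ O I k Q, M.IsOrigin l₀ m₀ O ∧ M.IsUnitPt l₀ m₀ Z₀ I ∧
    M.Inc O k ∧ (M.Par k l ∨ k = l) ∧ M.Inc Q k ∧ M.Coord l₀ m₀ Z₀ Q I a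

/-- The ternary operation `T(a, x, b) = y`: the line of slope `a` through `(0, b)` passes
through `(x, y)`. -/
def Ter (a x b y : M.Pt) : Prop :=
  ∃ l O P Q, M.Slope l₀ m₀ Z₀ l a ∧ M.IsOrigin l₀ m₀ O ∧
    M.Inc P l ∧ M.Coord l₀ m₀ Z₀ P O b ∧ M.Inc Q l ∧ M.Coord l₀ m₀ Z₀ Q x y

/-- The coordinate structure of the plane on the points of `l₀`: `a + b = T(a, 1, b)` and
`a * x = T(a, x, 0)`. -/
def coordField : Str.{u} fieldSig :=
  mkFieldStr (M.PointsOn l₀)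
    (fun a b c => ∃ I, M.IsUnitPt l₀ m₀ Z₀ I ∧ M.Ter l₀ m₀ Z₀ a.1 I b.1 c.1)
    (fun a x c => ∃ O, M.IsOrigin l₀ m₀ O ∧ M.Ter l₀ m₀ Z₀ a.1 x.1 O c.1)
    (fun a => M.IsOrigin l₀ m₀ a.1)
    (fun a => M.IsUnitPt l₀ m₀ Z₀ a.1)

/-- The point `A` of `l₀` is positive: it is not the origin, and the origin does not lie between
`A` and the unit point. -/
def Positive (A : M.Pt) : Prop :=
  ¬ M.IsOrigin l₀ m₀ A ∧
    ∀ O I, M.IsOrigin l₀ m₀ O → M.IsUnitPt l₀ m₀ Z₀ I → ¬ M.Be A O I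

end Coordinates

end Str

/-! ### The two constructions as interpretations -/

/-- The Cartesian plane has no parameters; points are named by pairs, lines by triples. -/
def cartesianShape : Shape planeSig fieldSig where
  par := fun _ => 0
  dim
    | .point, _ => 2
    | .line, _ => 3
  dim_pos
    | .point => ⟨(), Nat.succ_pos 1⟩
    | .line => ⟨(), Nat.succ_pos 2⟩

/-- The coordinate field has two lines and one point as parameters; its elements are named by
points. -/
def coordShape : Shape fieldSig planeSig where
  par
    | .point => 1
    | .line => 2
  dim
    | _, .point => 1
    | _, .line => 0
  dim_pos := fun _ => ⟨PlaneSort.point, Nat.succ_pos 0⟩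

/-- The parameters `l₀`, `m₀`, `Z₀` as an assignment. -/
def axesVal (M : Str.{u} planeSig) (l₀ m₀ : M.Ln) (Z₀ : M.Pt) : Val M (Vars coordShape.par)
  | .point => (fun _ => Z₀ : Fin 1 → M.Pt)
  | .line => (![l₀, m₀] : Fin 2 → M.Ln)

/-- On Euclidean fields `F`, the scheme `σ` defines the Cartesian plane, in such a way that `(x, y)`
names the point `(x, y)` and `(a, b, c)` names the line `a x + b y + c = 0`. -/
def DefinesCartesianPlane (σ : Translation cartesianShape) : Prop :=
  ∀ (F : Type u) [Field F], IsEuclideanField F → ∀ p : Val (fieldStr F) (Vars cartesianShape.par),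
    σ.Adm (fieldStr F) p ∧
    ∃ e : Str.Iso (σ.induced (fieldStr F) p) (cartesianPlane F),
      (∀ x y : F, ∃ b, σ.Names (fieldStr F) p .point (fun _ => (![x, y] : Fin 2 → F)) b ∧
        e.toEquiv .point b = ((x, y) : F × F)) ∧
      (∀ c : LineEq F, ∃ b, σ.Names (fieldStr F) p .line
          (fun _ => (![c.1.1, c.1.2.1, c.1.2.2] : Fin 3 → F)) b ∧
        e.toEquiv .line b = (Quotient.mk (lineSetoid F) c : CartesianLine F))

/-- On Euclidean ordered metric Wu planes `M`, the scheme `ξ` has the parameters `l₀`, `m₀`, `Z₀` and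
defines the coordinate field, in such a way that each point of `l₀` names itself. -/
def DefinesCoordField (ξ : Translation coordShape) : Prop :=
  ∀ M : Str.{u} planeSig, M.IsEuclideanOrderedMetricWu → ∀ (l₀ m₀ : M.Ln) (Z₀ : M.Pt),
    (ξ.Adm M (axesVal M l₀ m₀ Z₀) ↔ M.AdmissibleAxes l₀ m₀ Z₀) ∧
    (M.AdmissibleAxes l₀ m₀ Z₀ →
      ∃ e : Str.Iso (ξ.induced M (axesVal M l₀ m₀ Z₀)) (M.coordField l₀ m₀ Z₀),
        ∀ A : M.PointsOn l₀, ∃ b, ξ.Names M (axesVal M l₀ m₀ Z₀) ()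
            (fun s => match s with
              | .point => (fun _ => A.1 : Fin 1 → M.Pt)
              | .line => (Fin.elim0 : Fin 0 → M.Ln)) b ∧
          e.toEquiv () b = A)

end OrigamiGeometry

open OrigamiGeometry

/-! The bridge between planes and fields is a chart: coordinates with values in a field for which
lines are the linear equations, orthogonality is the vanishing of the dot product of normals, and
betweenness is division in a ratio 0 < t < 1 (`EuclideanChart`). Every plane of the class has such a
chart over a Euclidean field (`exists_euclideanChart`). Conversely, a plane with such a chart over a
Euclidean field satisfies all the axioms (`isEuclideanOrderedMetricWu`), and a chart is the same as
an isomorphism to a Cartesian plane (`EuclideanChart.exists_iso`). The five statements reduce to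
computations in charts.

Existence of a chart. The parallel case of Desargues produces translations and the central case
produces dilatations, both through `exists_pencil_map`. Translations make the points an abelian
group, and dilatations about the origin make up a division ring acting on it. The theorem of the
heights forces this division ring to be commutative and brings orthogonality to the form aa' + κbb'
= 0 (`mul_comm_and_perp`). A symmetric axis carries a vector on one line to a vector of equal norm
on the other, so norms differ by square factors (`exists_norm_ratio`). Hence κ is a square and can
be scaled to 1, and sums of two squares are squares. Pasch's axiom makes betweenness depend on the
division ratio alone and makes the positive scalars closed under quotients and sums. The folding
axiom intersects a circle with a line and so extracts square roots of positive scalars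
(`exists_sqrt`); the ordering is therefore the one given by squares.

Coordinatization. The parameters determine affine, in general oblique, coordinates u, v in which
T(a, x, b) = ax + b (`AxisChart.ter_iff`). The restriction of u to `l₀` identifies the coordinate
structure with the field of the chart.

Bi-interpretation. A presentation of a structure by a translation scheme yields an isomorphism with
the internal structure (`Translation.Presents.exists_iso`). The formula for fields sends t to O +
t(I - O), where I is the unit point. For planes, oblique coordinates would not respect
orthogonality. The parameters do define a unique orthonormal frame with the same origin and unit
point on `l₀` (`exists_orthoFrame`), and coordinates with respect to it give the second formula. -/

namespace OrigamiGeometry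

/-! ### Desarguesian planes in terms of parallelism -/

/-- Given a pencil `S` of traces and a parallelism `R` for which the Desargues property of the
pencil holds, every map of one point along its trace extends to a map that respects traces and
directions. -/
theorem exists_pencil_map {U : Type u} {S : U → U → Prop} {R : U → U → U → U → Prop}
    (hS : Equivalence S)
    (swap : ∀ {A B C D}, R A B C D → R B A D C)
    (fill : ∀ {A A' B}, S A A' → ¬ S A B → ∃ B', S B B' ∧ R A B A' B')
    (uniq : ∀ {A A' B B' B''}, S A A' → ¬ S A B → S B B' → S B B'' → R A B A' B' →
      R A B A' B'' → B' = B'')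
    (des : ∀ {A B C A' B' C'}, S A A' → S B B' → S C C' → ¬ S A B → ¬ S A C → R A B A' B' →
      R A C A' C' → R B C B' C')
    (enough : ∀ A B C, ∃ E, ¬ S A E ∧ ¬ S B E ∧ ¬ S C E) {A A' : U} (hA : S A A') :
    ∃ f : U → U, f A = A' ∧ (∀ B, S B (f B)) ∧ ∀ B C, R B C (f B) (f C) := by
  have key : ∀ B, ∃ B', S B B' ∧ ∀ E E', S E E' → ¬ S A E → ¬ S B E → R A E A' E' →
      R E B E' B' := by
    intro B
    obtain ⟨E, hAE, hBE, -⟩ := enough A B B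
    obtain ⟨E', hE, hR⟩ := fill hA hAE
    obtain ⟨B', hB, hEB⟩ := fill hE (fun h => hBE (hS.symm h))
    -- Change of the auxiliary point from G to F: Desargues for A, G, F makes GF parallel to G'F',
    -- and Desargues for G, F, B makes FB parallel to F'B'. This needs F and G on different traces.
    -- If E and F share a trace, a third trace serves as an intermediate stop.
    have step : ∀ {G G' F F'}, S G G' → S F F' → ¬ S A G → ¬ S B G → ¬ S A F → ¬ S G F →
        R A G A' G' → R A F A' F' → R G B G' B' → R F B F' B' := by
      intro G G' F F' hG hF hAG hBG hAF hGF hRG hRF hGB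
      exact des hG hF hB hGF (fun h => hBG (hS.symm h)) (des hA hG hF hAG hAF hRG hRF) hGB
    refine ⟨B', hB, fun F F' hF hAF hBF hRF => ?_⟩
    obtain ⟨G, hAG, hBG, hEG⟩ := enough A B E
    by_cases hEF : S E F
    · obtain ⟨G', hG, hRG⟩ := fill hA hAG
      exact step hG hF hAG hBG hAF (fun h => hEG (hS.trans hEF (hS.symm h))) hRG hRF
        (step hE hG hAE hBE hAG hEG hR hRG hEB)
    · exact step hE hF hAE hBE hAF hEF hR hRF hEB
  choose f hf hfR using key
  refine ⟨f, ?_, hf, fun B C => ?_⟩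
  · obtain ⟨E, hAE, -, -⟩ := enough A A A
    obtain ⟨E', hE, hR⟩ := fill hA hAE
    exact uniq hE (fun h => hAE (hS.symm h)) (hf A) hA (hfR A E E' hE hAE hAE hR) (swap hR)
  -- One auxiliary point off the traces of A, B and C compares B with C, which is why `enough` has
  -- to avoid three traces.
  · obtain ⟨E, hAE, hBE, hCE⟩ := enough A B C
    obtain ⟨E', hE, hR⟩ := fill hA hAE
    exact des hE (hf B) (hf C) (fun h => hBE (hS.symm h)) (fun h => hCE (hS.symm h))
      (hfR B E E' hE hAE hBE hR) (hfR C E E' hE hAE hCE hR)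

/-- A point outside three classes, given four inequivalent points. -/
theorem exists_not_equiv {U : Type u} {S : U → U → Prop} (hS : Equivalence S) {X₁ X₂ X₃ X₄ : U}
    (h12 : ¬ S X₁ X₂) (h13 : ¬ S X₁ X₃) (h14 : ¬ S X₁ X₄) (h23 : ¬ S X₂ X₃) (h24 : ¬ S X₂ X₄)
    (h34 : ¬ S X₃ X₄) (A B C : U) : ∃ E, ¬ S A E ∧ ¬ S B E ∧ ¬ S C E := by
  by_contra! h
  let X : Fin 4 → U := ![X₁, X₂, X₃, X₄]
  have hX : ∀ i j, i < j → ¬ S (X i) (X j) := by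
    intro i j hij
    fin_cases i <;> fin_cases j <;> first | (exact absurd hij (by decide)) | assumption
  have hv : ∀ i, ∃ j, S ((![A, B, C] : Fin 3 → U) j) (X i) := by
    intro i
    by_cases hA : S A (X i)
    · exact ⟨0, hA⟩
    by_cases hB : S B (X i)
    · exact ⟨1, hB⟩
    exact ⟨2, h _ hA hB⟩
  choose f hf using hv
  obtain ⟨i, j, hij, hfij⟩ := Fintype.exists_ne_map_eq_of_card_lt f (by simp)
  have hi := hf i
  have hj := hf j
  rw [← hfij] at hj
  rcases lt_or_gt_of_ne hij with hlt | hlt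
  · exact hX _ _ hlt (hS.trans (hS.symm hi) hj)
  · exact hX _ _ hlt (hS.trans (hS.symm hj) hi)

/-- `R A B C D` says that `A = B`, or `C = D`, or the lines `AB` and `CD` are parallel or equal.
These are the axioms of an affine plane, apart from those on the existence of points. -/
structure IsAffineParallelism {P : Type u} (R : P → P → P → P → Prop) : Prop where
  comm : ∀ {A B C D}, R A B C D → R C D A B
  swap : ∀ {A B C D}, R A B C D → R B A C D
  refl : ∀ A B, R A B A B
  degenerate : ∀ A B C, R A A B C
  trans : ∀ {A B C D E F}, C ≠ D → R A B C D → R C D E F → R A B E F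
  chain : ∀ {A B X Y Z}, A ≠ B → R X Y A B → R X Z A B → R Y Z A B
  meet : ∀ {A B C D}, ¬ R A B C D → ∀ P Q, ∃ X, R P X A B ∧ R Q X C D

/-- Affine Desarguesian planes whose lines have at least four points. -/
structure IsDesarguesianParallelism {P : Type u} (R : P → P → P → P → Prop) : Prop
    extends IsAffineParallelism R where
  noncollinear : ∃ A B C, ¬ R A B A C
  four_points : ∀ {A B}, A ≠ B → ∃ C D, R A B A C ∧ R A B A D ∧ A ≠ C ∧ A ≠ D ∧ B ≠ C ∧
    B ≠ D ∧ C ≠ D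
  parallel_desargues : ∀ {A B C A' B' C'}, ¬ R A A' A B → ¬ R A A' A C → R A A' B B' →
    R A A' C C' → R A B A' B' → R A C A' C' → R B C B' C'
  central_desargues : ∀ {O A B C A' B' C'}, A' ≠ O → B' ≠ O → C' ≠ O → ¬ R O A O B →
    ¬ R O A O C → R O A O A' → R O B O B' → R O C O C' → R A B A' B' → R A C A' C' →
    R B C B' C'

/-! ### Elementary consequences of the axioms of parallelism -/

namespace IsAffineParallelism

variable {P : Type u} {R : P → P → P → P → Prop} (h : IsAffineParallelism R)
include h

theorem swap_right {A B C D : P} (h₁ : R A B C D) : R A B D C := h.comm (h.swap (h.comm h₁))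

theorem swap_both {A B C D : P} (h₁ : R A B C D) : R B A D C := h.swap (h.swap_right h₁)

theorem degenerate_right (A B C : P) : R B C A A := h.comm (h.degenerate A B C)

theorem trans_left {A B C D E F : P} (hne : C ≠ D) (h₁ : R C D A B) (h₂ : R C D E F) :
    R A B E F := h.trans hne (h.comm h₁) h₂

theorem ne_left {A B C D : P} (hn : ¬ R A B C D) : A ≠ B := by
  rintro rfl
  exact hn (h.degenerate _ _ _)

theorem ne_right {A B C D : P} (hn : ¬ R A B C D) : C ≠ D :=
  h.ne_left fun h₁ => hn (h.comm h₁)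

/-- Collinearity does not depend on the order of the points. -/
theorem rotate {A B C : P} (h₁ : R A B A C) : R B A B C := by
  by_cases hAB : A = B
  · subst hAB
    exact h.degenerate _ _ _
  exact h.comm (h.swap_right (h.chain hAB (h.refl A B) (h.comm h₁)))

/-- Two different common points would give both lines the same direction. Most identifications of
points below say that both are the intersection of the same two lines. -/
theorem uniq {A B C D E F X Y : P} (hn : ¬ R A B C D) (h₁ : R E X A B) (h₂ : R E Y A B)
    (h₃ : R F X C D) (h₄ : R F Y C D) : X = Y := by
  by_contra hne
  exact hn (h.trans_left hne (h.chain (h.ne_left hn) h₁ h₂) (h.chain (h.ne_right hn) h₃ h₄))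

end IsAffineParallelism

/-! ### Translations and dilatations from the Desargues properties -/

namespace IsDesarguesianParallelism

variable {P : Type u} {R : P → P → P → P → Prop} (h : IsDesarguesianParallelism R)
include h

theorem exists_off {A B : P} (hAB : A ≠ B) : ∃ C, ¬ R A B A C := by
  by_contra! hc
  obtain ⟨X, Y, Z, hn⟩ := h.noncollinear
  have key : ∀ X Y, R A B X Y := fun X Y =>
    h.comm (h.chain hAB (h.comm (hc X)) (h.comm (hc Y)))
  exact hn (h.trans_left hAB (key _ _) (key _ _))

theorem equivalence_parallel {A A' : P} (hA : A ≠ A') : Equivalence fun X Y => R X Y A A' where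
  refl _ := h.degenerate _ _ _
  symm h₁ := h.swap h₁
  trans h₁ h₂ := h.chain hA (h.swap h₁) h₂

/-- A line through A other than AA' has four points, and they lie on four different parallels to
AA'; three given points cannot occupy all of these. -/
theorem exists_not_parallel {A A' : P} (hA : A ≠ A') (B C D : P) :
    ∃ E, ¬ R B E A A' ∧ ¬ R C E A A' ∧ ¬ R D E A A' := by
  obtain ⟨T, hT⟩ := h.exists_off hA
  have hAT : A ≠ T := h.ne_right hT
  obtain ⟨X, Y, hX, hY, hAX, hAY, hTX, hTY, hXY⟩ := h.four_points hAT
  have key : ∀ {U V}, U ≠ V → R A T A U → R A T A V → ¬ R U V A A' := fun hUV hU hV h₁ =>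
    hT (h.trans_left hUV h₁ (h.chain hAT (h.comm hU) (h.comm hV)))
  exact exists_not_equiv (h.equivalence_parallel hA) (key hAT (h.degenerate_right _ _ _)
    (h.refl _ _)) (key hAX (h.degenerate_right _ _ _) hX) (key hAY (h.degenerate_right _ _ _) hY)
    (key hTX (h.refl _ _) hX) (key hTY (h.refl _ _) hY) (key hXY hX hY) B C D

/-- The translation that moves `A` to `A'`. -/
theorem exists_translation (A A' : P) : ∃ f : P → P, f A = A' ∧
    (∀ B C, R B C (f B) (f C)) ∧ ∀ B C, R B (f B) C (f C) := by
  by_cases hA : A = A'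
  · subst hA
    exact ⟨id, rfl, fun B C => h.refl _ _, fun B C => h.degenerate _ _ _⟩
  have hS := h.equivalence_parallel hA
  obtain ⟨f, h₁, h₂, h₃⟩ := exists_pencil_map (S := fun X Y => R X Y A A') (R := R) hS
    h.swap_both
    (by
      intro X X' Y hX hXY
      obtain ⟨Y', hY₁, hY₂⟩ := h.meet (fun h₁ => hXY (h.comm h₁)) Y X'
      exact ⟨Y', hY₁, h.swap_right (h.comm (h.swap_right (h.swap (h.swap_right hY₂))))⟩)
    (by
      intro X X' Y Y' Y'' hX hXY h₁ h₂ h₃ h₄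
      exact h.uniq (fun h₁ => hXY (h.comm h₁)) h₁ h₂ (h.comm h₃) (h.comm h₄))
    (by
      intro X Y Z X' Y' Z' hX hY hZ hXY hXZ h₁ h₂
      -- The Desargues property speaks about a genuine direction XX'. If X is fixed, then Y and Z
      -- are fixed as well, and there is nothing to prove.
      by_cases hXX : X = X'
      · subst hXX
        have hYY : Y = Y' := h.uniq (fun h₁ => hXY (h.comm h₁)) (h.degenerate _ _ _) hY
          (h.refl X Y) (h.comm h₁)
        have hZZ : Z = Z' := h.uniq (fun h₁ => hXZ (h.comm h₁)) (h.degenerate _ _ _) hZ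
          (h.refl X Z) (h.comm h₂)
        subst hYY hZZ
        exact h.refl _ _
      · have aux : ∀ {Y}, ¬ R X Y A A' → ¬ R X X' X Y := fun hXY h₁ =>
          hXY (h.trans_left hXX h₁ hX)
        have aux' : ∀ {Y Y'}, R Y Y' A A' → R X X' Y Y' := fun hY => h.trans hA hX (h.comm hY)
        exact h.parallel_desargues (aux hXY) (aux hXZ) (aux' hY) (aux' hZ) h₁ h₂)
    (h.exists_not_parallel hA) (h.refl A A')
  exact ⟨f, h₁, h₃, fun B C => h.trans hA (h₂ B) (h.comm (h₂ C))⟩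

theorem equivalence_central {O : P} :
    Equivalence fun X Y : {X : P // X ≠ O} => R O X.1 O Y.1 where
  refl _ := h.refl _ _
  symm h₁ := h.comm h₁
  trans {_ Y _} h₁ h₂ := h.trans Y.2.symm h₁ h₂

/-- The lines from O to four points of a line that misses O are four different lines of the pencil,
and three given points cannot occupy all of these. -/
theorem exists_not_central {O : P} (A B C : {X : P // X ≠ O}) : ∃ E : {X : P // X ≠ O},
    ¬ R O A.1 O E.1 ∧ ¬ R O B.1 O E.1 ∧ ¬ R O C.1 O E.1 := by
  obtain ⟨T, hT⟩ := h.exists_off A.2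
  have hAT : A.1 ≠ T := by
    rintro rfl
    exact hT (h.degenerate_right _ _ _)
  have hO : ¬ R A.1 T A.1 O := fun h₁ => hT (h.comm h₁)
  obtain ⟨X, Y, hX, hY, hAX, hAY, hTX, hTY, hXY⟩ := h.four_points hAT
  have hne : ∀ {U}, R A.1 T A.1 U → U ≠ O := by
    rintro U hU rfl
    exact hO hU
  have key : ∀ {U V}, U ≠ V → R A.1 T A.1 U → R A.1 T A.1 V → ¬ R O U O V := by
    intro U V hUV hU hV h₁
    have hUO : U ≠ O := hne hU
    have h₂ : R U V A.1 T := h.chain hAT (h.comm hU) (h.comm hV)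
    have h₃ : R U V U O := h.comm (h.rotate h₁)
    have h₄ : R A.1 T U O := h.trans_left hUV h₂ h₃
    exact hO (h.comm (h.chain hAT (h.comm (h.swap_right hU)) (h.comm h₄)))
  exact exists_not_equiv (U := {X : P // X ≠ O}) h.equivalence_central
    (X₁ := A) (X₂ := ⟨T, hne (h.refl _ _)⟩) (X₃ := ⟨X, hne hX⟩) (X₄ := ⟨Y, hne hY⟩)
    (key hAT (h.degenerate_right _ _ _)
    (h.refl _ _)) (key hAX (h.degenerate_right _ _ _) hX) (key hAY (h.degenerate_right _ _ _) hY)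
    (key hTX (h.refl _ _) hX) (key hTY (h.refl _ _) hY) (key hXY hX hY) A B C

/-- The dilatation with centre `O` that moves `A` to `A'`. -/
theorem exists_dilatation {O A A' : P} (hAO : A ≠ O) (hA : R O A O A') : ∃ f : P → P, f O = O ∧
    f A = A' ∧ (∀ B, R O B O (f B)) ∧ ∀ B C, R B C (f B) (f C) := by
  classical
  -- The constant map is admitted as a degenerate dilatation; it will be the scalar zero.
  by_cases hA' : A' = O
  · subst hA'
    exact ⟨fun _ => A', rfl, rfl, fun B => h.degenerate_right _ _ _,
      fun B C => h.degenerate_right _ _ _⟩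
  -- Collinearity with O is transitive only away from O, so the pencil map is built on the
  -- complement of O and O is added by hand.
  obtain ⟨f, h₁, h₂, h₃⟩ := exists_pencil_map (U := {X : P // X ≠ O})
    (S := fun X Y => R O X.1 O Y.1) (R := fun X Y Z W => R X.1 Y.1 Z.1 W.1)
    h.equivalence_central h.swap_both
    (by
      rintro ⟨X, hX⟩ ⟨X', hX'⟩ ⟨Y, hY⟩ hXX hXY
      simp only at hXX hXY
      have hn : ¬ R O Y X Y := fun h₁ =>
        hXY (h.comm (h.rotate (h.swap_right (h.swap h₁))))
      obtain ⟨Y', hY₁, hY₂⟩ := h.meet hn O X'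
      have hne : Y' ≠ O := by
        rintro rfl
        have h₃ : R Y' X' X Y := h.swap hY₂
        have h₄ : R Y' X X Y := h.trans (Ne.symm hX') hXX h₃
        exact hXY (h.rotate (h.swap h₄))
      exact ⟨⟨Y', hne⟩, h.comm hY₁, h.comm hY₂⟩)
    (by
      rintro ⟨X, hX⟩ ⟨X', hX'⟩ ⟨Y, hY⟩ ⟨Y', hY'⟩ ⟨Y'', hY''⟩ hXX hXY h₁ h₂ h₃ h₄
      simp only at hXX hXY h₁ h₂ h₃ h₄
      have hn : ¬ R O Y X Y := fun h₁ =>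
        hXY (h.comm (h.rotate (h.swap_right (h.swap h₁))))
      exact Subtype.ext (h.uniq hn (h.comm h₁) (h.comm h₂) (h.comm h₃) (h.comm h₄)))
    (by
      rintro ⟨X, hX⟩ ⟨Y, hY⟩ ⟨Z, hZ⟩ ⟨X', hX'⟩ ⟨Y', hY'⟩ ⟨Z', hZ'⟩ hXX hYY hZZ hXY hXZ h₁ h₂
      exact h.central_desargues hX' hY' hZ' hXY hXZ hXX hYY hZZ h₁ h₂)
    h.exists_not_central (A := ⟨A, hAO⟩) (A' := ⟨A', hA'⟩) hA
  have hg : ∀ B : P, ∃ B', (B = O → B' = O) ∧ ∀ hB : B ≠ O, B' = (f ⟨B, hB⟩).1 := by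
    intro B
    by_cases hB : B = O
    · exact ⟨O, fun _ => rfl, fun h => absurd hB h⟩
    · exact ⟨(f ⟨B, hB⟩).1, fun h => absurd h hB, fun _ => rfl⟩
  choose g hg₀ hg₁ using hg
  have hgO : ∀ B, R O B O (g B) := by
    intro B
    by_cases hB : B = O
    · subst hB
      exact h.degenerate _ _ _
    · rw [hg₁ B hB]
      exact h₂ ⟨B, hB⟩
  refine ⟨g, hg₀ O rfl, by rw [hg₁ A hAO, h₁], hgO, fun B C => ?_⟩
  by_cases hB : B = O
  · rw [hg₀ B hB, hB]
    exact hgO C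
  by_cases hC : C = O
  · rw [hg₀ C hC, hC]
    exact h.swap_both (hgO B)
  rw [hg₁ B hB, hg₁ C hC]
  exact h₃ ⟨B, hB⟩ ⟨C, hC⟩

/-! ### The group of translations -/

end IsDesarguesianParallelism

/-- Translations: maps that preserve directions and whose traces are parallel. -/
def IsTranslation {P : Type u} (R : P → P → P → P → Prop) (f : P → P) : Prop :=
  (∀ B C, R B C (f B) (f C)) ∧ ∀ B C, R B (f B) C (f C)

namespace IsDesarguesianParallelism

variable {P : Type u} {R : P → P → P → P → Prop} (h : IsDesarguesianParallelism R)
include h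

/-- A map that preserves directions and fixes two points is the identity. -/
theorem eq_id_of_fixed {f : P → P} (hf : ∀ B C, R B C (f B) (f C)) {A B : P} (hAB : A ≠ B)
    (hA : f A = A) (hB : f B = B) (C : P) : f C = C := by
  -- A point C off the line AB is the intersection of AC and BC, and its image lies on both of these
  -- lines. Points of AB are reached with the help of a fixed point off AB.
  have key : ∀ {A B}, f A = A → f B = B → ∀ C, ¬ R A B A C → f C = C := by
    intro A B hA hB C hC
    have h₁ := hf A C
    have h₂ := hf B C
    rw [hA] at h₁
    rw [hB] at h₂
    have hn : ¬ R A C B C := fun h₃ =>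
      hC (by grind [h.comm, h.swap, h.rotate])
    exact h.uniq hn (h.comm h₁) (h.refl _ _) (h.comm h₂) (h.refl _ _)
  obtain ⟨D, hD⟩ := h.exists_off hAB
  by_cases hC : R A B A C
  · by_cases hCA : C = A
    · rw [hCA, hA]
    refine key hA (key hA hB D hD) C fun h₁ => hD (h.trans (Ne.symm hCA) hC (h.comm h₁))
  · exact key hA hB C hC

/-- The image of a point B off the trace of A is the fourth vertex of a parallelogram, hence
determined by the image of A; points on the trace are reached through a point off it. If A is fixed
there is no parallelogram. In that case every C stays on AC, and a moved point B would have a trace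
through A, so that points off this trace would be fixed, which gives the identity. -/
theorem translation_unique {f g : P → P} (hf : IsTranslation R f) (hg : IsTranslation R g)
    {A : P} (hA : f A = g A) : f = g := by
  have fix : ∀ {f : P → P}, IsTranslation R f → f A = A → ∀ B, f B = B := by
    intro f hf hA B
    by_contra hB
    obtain ⟨C, hC⟩ := h.exists_off (Ne.symm hB)
    have key : ∀ C, R A C A (f C) := fun C => by simpa [hA] using hf.1 A C
    have hAB : A ≠ B := by
      rintro rfl
      exact hB hA
    have h₁ : R B (f B) B A := by
      have := key B
      grind [h.comm, h.swap, h.rotate]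
    have hn : ¬ R B (f B) A C := by
      intro h₂
      have h₃ : R B A A C := h.trans_left (Ne.symm hB) h₁ h₂
      exact hC (h.trans (Ne.symm hAB) h₁ (by grind [h.comm, h.swap, h.rotate]))
    have hC' : f C = C := h.uniq hn (h.comm (hf.2 B C)) (h.degenerate _ _ _)
      (h.comm (key C)) (h.refl _ _)
    exact hB (h.eq_id_of_fixed hf.1 (h.ne_right hn) hA hC' B)
  by_cases hAA : f A = A
  · funext B
    rw [fix hf hAA, fix hg (hA ▸ hAA)]
  have off : ∀ {A B}, f A = g A → ¬ R A (f A) A B → f B = g B ∧ f B ≠ B := by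
    intro A B hA hB
    refine ⟨h.uniq hB (h.comm (hf.2 A B)) (hA ▸ h.comm (hg.2 A B)) (h.comm (hf.1 A B))
      (hA ▸ h.comm (hg.1 A B)), fun hBB => ?_⟩
    have := hf.1 A B
    rw [hBB] at this
    grind [h.comm, h.swap, h.rotate]
  funext B
  by_cases hB : R A (f A) A B
  · obtain ⟨C, hC⟩ := h.exists_off (Ne.symm hAA)
    obtain ⟨hC₁, hC₂⟩ := off hA hC
    refine (off hC₁ fun h₁ => hC ?_).1
    have h₂ : R B C A (f A) := h.swap (h.comm (h.trans (Ne.symm hC₂) (hf.2 A C) h₁))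
    have h₃ : R B A A (f A) := h.swap (h.comm hB)
    exact h.comm (h.swap (h.chain (Ne.symm hAA) h₂ h₃))
  · exact (off hA hB).1

theorem comp_directions {f g : P → P} (hf : ∀ B C, R B C (f B) (f C))
    (hg : ∀ B C, R B C (g B) (g C)) (B C : P) : R B C (f (g B)) (f (g C)) := by
  by_cases hBC : g B = g C
  · rw [hBC]
    exact h.degenerate_right _ _ _
  · exact h.trans hBC (hg B C) (hf _ _)

/-- Since g brings f(A) back to A, both translations have the direction of A f(A). For C off this
trace, g(f(C)) lies on the parallel to it through C and also on AC, so C is a second fixed point of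
the composite. -/
theorem translation_inverse {f g : P → P} (hf : IsTranslation R f) (hg : IsTranslation R g)
    {A : P} (hA : g (f A) = A) (B : P) : g (f B) = B := by
  by_cases hAA : f A = A
  · have hid : IsTranslation R (id : P → P) :=
      ⟨fun B C => h.refl _ _, fun B C => h.degenerate _ _ _⟩
    have h₁ : f = id := h.translation_unique hf hid hAA
    have h₂ : g = id := h.translation_unique hg hid (A := A) (by simpa [hAA] using hA)
    rw [h₁, h₂]
    rfl
  obtain ⟨C, hC⟩ := h.exists_off (Ne.symm hAA)
  refine h.eq_id_of_fixed (h.comp_directions hg.1 hf.1) (h.ne_right hC) hA ?_ B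
  have h₁ := hg.2 (f A) (f C)
  have h₂ := hg.1 (f A) (f C)
  rw [hA] at h₁ h₂
  have h₃ := hf.2 A C
  have h₄ := hf.1 A C
  have hne : f A ≠ f C := by
    intro h₅
    rw [← h₅] at h₃
    grind [h.comm, h.swap, h.rotate]
  exact h.uniq hC (h.comm (h.swap h₁)) (h.swap (h.comm h₃)) (h.trans_left hne h₂ (h.comm h₄))
    (h.refl _ _)

/-- With a fixed point the composite is the identity. Without one, two non-parallel traces would
meet in a point whose own trace has both directions, and such a point is fixed. -/
theorem translation_comp {f g : P → P} (hf : IsTranslation R f) (hg : IsTranslation R g) :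
    IsTranslation R (f ∘ g) := by
  refine ⟨fun B C => h.comp_directions hf.1 hg.1 B C, ?_⟩
  by_cases hfix : ∃ A, f (g A) = A
  · obtain ⟨A, hA⟩ := hfix
    intro B C
    simp only [Function.comp, h.translation_inverse hg hf hA]
    exact h.degenerate _ _ _
  push Not at hfix
  intro B C
  by_contra hn
  obtain ⟨X, h₁, h₂⟩ := h.meet hn B C
  have key : ∀ B, R B X B (f (g B)) → R X (f (g X)) B (f (g B)) := by
    intro B hB
    by_cases hBX : B = X
    · subst hBX
      exact h.refl _ _
    have h₃ := h.comp_directions hf.1 hg.1 B X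
    have h₄ : R B (f (g X)) B X := h.chain hBX (h.swap (h.comm hB)) (h.comm h₃)
    exact h.trans hBX (h.chain hBX (h.refl _ _) h₄) hB
  exact hfix X (h.uniq hn (key B h₁) (h.degenerate _ _ _) (key C h₂) (h.degenerate _ _ _))

/-- For different directions, f(g(A)) and g(f(A)) are both the fourth vertex of one parallelogram.
For equal directions, f commutes with a translation r of another direction and with g ∘ r, hence
with g. -/
theorem translation_commute {f g : P → P} (hf : IsTranslation R f) (hg : IsTranslation R g)
    (A : P) : f (g A) = g (f A) := by
  have key : ∀ {f g : P → P}, IsTranslation R f → IsTranslation R g → ∀ {A},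
      ¬ R A (f A) A (g A) → f ∘ g = g ∘ f := by
    intro f g hf hg A hn
    refine h.translation_unique (h.translation_comp hf hg) (h.translation_comp hg hf) (A := A) ?_
    exact h.uniq hn (h.comm (hf.2 A (g A))) (h.comm (hg.1 A (f A))) (h.comm (hf.1 A (g A)))
      (h.comm (hg.2 A (f A)))
  by_cases hfA : f A = A
  · have := h.translation_unique hf
      (⟨fun B C => h.refl _ _, fun B C => h.degenerate _ _ _⟩ : IsTranslation R id) hfA
    simp [this]
  by_cases hgA : g A = A
  · have := h.translation_unique hg
      (⟨fun B C => h.refl _ _, fun B C => h.degenerate _ _ _⟩ : IsTranslation R id) hgA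
    simp [this]
  by_cases hn : R A (f A) A (g A)
  · obtain ⟨C, hC⟩ := h.exists_off (Ne.symm hfA)
    obtain ⟨r, hrA, hr⟩ := h.exists_translation A C
    obtain ⟨t, htC, ht⟩ := h.exists_translation C A
    have h₁ : f ∘ r = r ∘ f := key hf hr (A := A) (by rwa [hrA])
    have h₂ : f ∘ (g ∘ r) = (g ∘ r) ∘ f := by
      refine key hf (h.translation_comp hg hr) (A := A) fun h₃ => ?_
      simp only [Function.comp, hrA] at h₃
      have h₄ : R C (g C) A (f A) := h.trans (Ne.symm hgA) (h.comm (hg.2 A C)) (h.comm hn)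
      exact hC (h.comm (h.swap (h.chain (Ne.symm hfA) (h.swap h₄) (h.swap (h.comm h₃)))))
    have hrt : r (t A) = A := h.translation_inverse ht hr (A := C) (by rw [htC, hrA]) A
    have h₃ := congrFun h₂ (t A)
    have h₄ := congrFun h₁ (t A)
    simp only [Function.comp] at h₃ h₄
    rw [← h₄, hrt] at h₃
    exact h₃
  · exact congrFun (key hf hg hn) A

/-- Every point `O` is the zero of a group structure whose translations are the geometric
translations. -/
theorem exists_addCommGroup (O : P) : ∃ _ : AddCommGroup P, (0 : P) = O ∧
    ∀ A : P, IsTranslation R (A + ·) := by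
  -- The sum A + B is the image of B under the translation from O to A. The group laws are
  -- identities between translations, checked at one point.
  choose tr htr h₁ h₂ using h.exists_translation
  have hT : ∀ A B, IsTranslation R (tr A B) := fun A B => ⟨h₁ A B, h₂ A B⟩
  have hid : ∀ A B, tr A A B = B := fun A B =>
    congrFun (h.translation_unique (hT A A)
      (⟨fun B C => h.refl _ _, fun B C => h.degenerate _ _ _⟩ : IsTranslation R id)
      (A := A) (htr A A)) B
  have hcomm : ∀ A B, tr O A B = tr O B A := by
    intro A B
    have := h.translation_commute (hT O A) (hT O B) O
    rwa [htr, htr] at this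
  refine ⟨{ add := fun A B => tr O A B
            zero := O
            neg := fun A => tr A O O
            add_assoc := fun A B C => ?_
            zero_add := hid O
            add_zero := htr O
            add_comm := hcomm
            neg_add_cancel := fun A => ?_
            nsmul := @nsmulRec P ⟨O⟩ ⟨fun A B => tr O A B⟩
            zsmul := @zsmulRec P ⟨O⟩ ⟨fun A B => tr O A B⟩ ⟨fun A => tr A O O⟩
              (@nsmulRec P ⟨O⟩ ⟨fun A B => tr O A B⟩) }, rfl, hT O⟩
  · refine congrFun (h.translation_unique (hT _ _) (h.translation_comp (hT O A) (hT O B))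
      (A := O) ?_) C
    simp only [Function.comp, htr]
    rfl
  · change tr O (tr A O O) A = O
    have := h.translation_unique (hT O (tr A O O)) (hT A O) (A := O) (htr _ _)
    rw [this, htr]

/-! ### The division ring of scalars -/

variable [AddCommGroup P] (ht : ∀ A : P, IsTranslation R (A + ·))
include ht

/-- Translating A and C to the origin does not change directions, so parallelism depends only on
difference vectors. -/
theorem iff_sub {A B C D : P} : R A B C D ↔ R 0 (B - A) 0 (D - C) := by
  have key : ∀ A B : P, R A B 0 (B - A) := by
    intro A B
    have := (ht (-A)).1 A B
    simpa [sub_eq_neg_add] using this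
  by_cases hAB : A = B
  · subst hAB
    simp [h.degenerate]
  by_cases hCD : C = D
  · subst hCD
    simp [h.degenerate_right]
  constructor
  · intro h₁
    exact h.trans hCD (h.trans_left hAB (key A B) h₁) (key C D)
  · intro h₁
    exact h.trans (C := 0) (D := D - C) (fun h₂ => hCD (sub_eq_zero.1 h₂.symm).symm)
      (h.trans (C := 0) (D := B - A) (fun h₂ => hAB (sub_eq_zero.1 h₂.symm).symm) (key A B) h₁)
      (h.comm (key C D))

theorem add_mem {A B C : P} (h₁ : R 0 A 0 B) (h₂ : R 0 A 0 C) : R 0 A 0 (B + C) := by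
  by_cases hA : 0 = A
  · subst hA
    exact h.degenerate _ _ _
  have h₃ : R B (B + C) 0 A := (h.iff_sub ht).2 (by simpa using h.comm h₂)
  exact h.comm (h.chain hA (h.swap (h.comm h₁)) h₃)

theorem neg_mem {A B : P} (h₁ : R 0 A 0 B) : R 0 A 0 (-B) := by
  have h₂ : R 0 A B 0 := h.swap_right h₁
  rw [h.iff_sub ht] at h₂
  simpa using h₂

/-- The scalars: additive maps that preserve every line through the origin. -/
def scalars : Subring (AddMonoid.End P) where
  carrier := {f | ∀ A, R 0 A 0 (f A)}
  mul_mem' {f g} hf hg A := by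
    by_cases hA : 0 = g A
    · simp [← hA, h.degenerate_right]
    · exact h.trans hA (hg A) (hf (g A))
  one_mem' A := h.refl _ _
  add_mem' hf hg A := h.add_mem ht (hf A) (hg A)
  zero_mem' A := h.degenerate_right _ _ _
  neg_mem' hf A := h.neg_mem ht (hf A)

/-- A map that preserves directions and fixes the origin is additive. -/
theorem map_add_of_directions {f : P → P} (hf : ∀ B C, R B C (f B) (f C)) (h₀ : f 0 = 0)
    (A B : P) : f (A + B) = f A + f B := by
  have h0 : ∀ B, R 0 B 0 (f B) := fun B => by simpa [h₀] using hf 0 B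
  -- For independent A and B the sum is the fourth vertex of a parallelogram, a figure that a map
  -- preserving directions respects.
  have key : ∀ {A B}, ¬ R 0 A 0 B → f (A + B) = f A + f B := by
    intro A B hn
    have hA : A ≠ 0 := (h.ne_left hn).symm
    have hB : B ≠ 0 := (h.ne_right hn).symm
    refine h.uniq hn (E := f B) (F := f A) ?_ ?_ ?_ ?_
    · exact h.trans_left (C := B) (D := A + B) (by simpa using hA) (hf _ _)
        ((h.iff_sub ht).2 (by simpa using h.refl _ _))
    · exact (h.iff_sub ht).2 (by simpa using h.comm (h0 A))
    · exact h.trans_left (C := A) (D := A + B) (by simpa using hB) (hf _ _)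
        ((h.iff_sub ht).2 (by simpa using h.refl _ _))
    · exact (h.iff_sub ht).2 (by simpa using h.comm (h0 B))
  by_cases hA : A = 0
  · simp [hA, h₀]
  by_cases hn : R 0 A 0 B
  swap
  · exact key hn
  -- For dependent A and B, a vector C off their line is added: both bracketings of A + B + C are
  -- sums of independent or zero vectors, and f(C) cancels.
  obtain ⟨C, hC⟩ := h.exists_off (Ne.symm hA)
  have h₁ : ¬ R 0 A 0 (B + C) := by
    intro h₂
    have := h.add_mem ht (h.neg_mem ht hn) h₂
    exact hC (by simpa using this)
  have h₂ : f (B + C) = f B + f C := by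
    by_cases hB : B = 0
    · simp [hB, h₀]
    · exact key fun h₃ => hC (h.trans (Ne.symm hB) hn h₃)
  have h₃ : f (A + B + C) = f (A + B) + f C := by
    by_cases hAB : A + B = 0
    · simp [hAB, h₀]
    · exact key fun h₃ => hC (h.trans (Ne.symm hAB) (h.add_mem ht (h.refl _ _) hn) h₃)
  have h₄ := key h₁
  rw [← add_assoc, h₃, h₂, ← add_assoc] at h₄
  exact add_right_cancel h₄

/-- The scalar is the dilatation that moves A to B, so this is where the central case of Desargues
enters. -/
theorem exists_scalar {A B : P} (hA : A ≠ 0) (hB : R 0 A 0 B) : ∃ f ∈ h.scalars ht, f A = B := by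
  obtain ⟨f, h₁, h₂, h₃, h₄⟩ := h.exists_dilatation hA hB
  exact ⟨AddMonoidHom.mk' f (h.map_add_of_directions ht h₄ h₁), h₃, h₂⟩

/-- If f kills A and B is independent of A, then f(B) = f(A + B) lies on the lines of B and of A +
B, so it is zero. Vectors dependent on A are treated with an independent vector already killed. -/
theorem scalar_eq_zero {f : AddMonoid.End P} (hf : f ∈ h.scalars ht) {A : P} (hA : A ≠ 0)
    (hfA : f A = 0) : f = 0 := by
  have key : ∀ {A B}, f A = 0 → ¬ R 0 A 0 B → f B = 0 := by
    intro A B hA hn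
    have h₁ := hf (A + B)
    rw [map_add, hA, zero_add] at h₁
    have h₂ := hf B
    have hn' : ¬ R 0 (A + B) 0 B := by
      intro h₃
      have h₄ := h.add_mem ht (h.comm h₃) (h.neg_mem ht (h.refl _ _))
      exact hn (h.comm (by simpa using h₄))
    exact h.uniq hn' (E := 0) (F := 0) (h.comm h₁) (h.degenerate _ _ _) (h.comm h₂)
      (h.degenerate _ _ _)
  obtain ⟨C, hC⟩ := h.exists_off (Ne.symm hA)
  have hfC := key hfA hC
  have hC0 : C ≠ 0 := (h.ne_right hC).symm
  ext B
  by_cases hB : R 0 A 0 B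
  · by_cases hB0 : B = 0
    · simp [hB0]
    · exact key hfC fun h₁ => hC (h.trans (Ne.symm hB0) hB (h.comm h₁))
  · exact key hfA hB

/-- A scalar is determined by its value at one nonzero vector. The dilatation that moves f(E) back
to E is therefore a two-sided inverse of f. -/
theorem isUnit_scalar (f : h.scalars ht) : IsUnit f ∨ f = 0 := by
  obtain ⟨A, B, C, hn⟩ := h.noncollinear
  obtain ⟨E, hE⟩ : ∃ E : P, E ≠ 0 := by
    by_contra! h₁
    exact hn (by rw [h₁ A, h₁ B]; exact h.degenerate _ _ _)
  by_cases hf : f.1 E = 0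
  · exact .inr (Subtype.ext (h.scalar_eq_zero ht f.2 hE hf))
  · left
    obtain ⟨g, hg, hgE⟩ := h.exists_scalar ht hf (h.comm (f.2 E))
    have h₁ : (⟨g, hg⟩ : h.scalars ht) * f = 1 := by
      refine sub_eq_zero.1 (Subtype.ext (h.scalar_eq_zero ht (Subtype.prop _) hE ?_))
      change g (f.1 E) - E = 0
      rw [hgE, sub_self]
    have h₂ : f * (⟨g, hg⟩ : h.scalars ht) = 1 := by
      refine sub_eq_zero.1 (Subtype.ext (h.scalar_eq_zero ht (Subtype.prop _) hf ?_))
      change f.1 (g (f.1 E)) - f.1 E = 0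
      rw [hgE, sub_self]
    exact ⟨⟨f, ⟨g, hg⟩, h₂, h₁⟩, rfl⟩

omit [AddCommGroup P] ht in
/-- Coordinates with respect to a triangle `O E₁ E₂`. -/
theorem exists_coordinates {O E₁ E₂ : P} (hn : ¬ R O E₁ O E₂) :
    ∃ (K : Type u) (_ : DivisionRing K) (x y : P → K),
      (∀ A B, x A = x B → y A = y B → A = B) ∧ (∀ a b, ∃ A, x A = a ∧ y A = b) ∧
      x O = 0 ∧ y O = 0 ∧ x E₁ = 1 ∧ y E₁ = 0 ∧ x E₂ = 0 ∧ y E₂ = 1 ∧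
      ∀ A B, A ≠ B → (x A = x B ∧ ∀ C, R A B A C ↔ x C = x A) ∨
        ∃ s b, ∀ C, R A B A C ↔ y C = x C * s + b := by
  obtain ⟨_, rfl, ht⟩ := h.exists_addCommGroup O
  have hE₁ : E₁ ≠ 0 := (h.ne_left hn).symm
  have hE₂ : E₂ ≠ 0 := (h.ne_right hn).symm
  let K := h.scalars ht
  have hnt : Nontrivial K := ⟨0, 1, fun h₁ => hE₁ (by
    have := congrArg (fun f : K => f.1 E₁) h₁
    simpa using this.symm)⟩
  let _ : DivisionRing K := DivisionRing.ofIsUnitOrEqZero (h.isUnit_scalar ht)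
  have hK : ∀ (f : K) (A : P), f • A = f.1 A := fun f A => rfl
  have hspan : ∀ {A B : P}, A ≠ 0 → (R 0 A 0 B ↔ ∃ f : K, f • A = B) := by
    intro A B hA
    constructor
    · intro hB
      obtain ⟨f, hf, hfA⟩ := h.exists_scalar ht hA hB
      exact ⟨⟨f, hf⟩, hfA⟩
    · rintro ⟨f, rfl⟩
      exact f.2 A
  have hex : ∀ A : P, ∃ a b : K, A = a • E₁ + b • E₂ := by
    intro A
    obtain ⟨X, h₁, h₂⟩ := h.meet hn 0 A
    obtain ⟨a, ha⟩ := (hspan hE₁).1 (h.comm h₁)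
    obtain ⟨b, hb⟩ := (hspan (B := A - X) hE₂).1
      (by simpa using h.comm ((h.iff_sub ht).1 (h.swap h₂)))
    exact ⟨a, b, by rw [ha, hb]; abel⟩
  have hindep : ∀ a b : K, a • E₁ + b • E₂ = 0 → a = 0 ∧ b = 0 := by
    intro a b hab
    have hb : b = 0 := by
      by_contra hb
      refine hn ((hspan hE₁).2 ⟨-(b⁻¹ * a), ?_⟩)
      have : b⁻¹ • (a • E₁ + b • E₂) = 0 := by rw [hab, smul_zero]
      rw [smul_add, smul_smul, smul_smul, inv_mul_cancel₀ hb, one_smul] at this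
      rw [neg_smul]
      exact (eq_neg_of_add_eq_zero_right this).symm
    refine ⟨?_, hb⟩
    by_contra ha
    rw [hb, zero_smul, add_zero] at hab
    exact ha (Subtype.ext (h.scalar_eq_zero ht a.2 hE₁ hab))
  choose x y hxy using hex
  have huniq : ∀ a b : K, x (a • E₁ + b • E₂) = a ∧ y (a • E₁ + b • E₂) = b := by
    intro a b
    have h₁ := hxy (a • E₁ + b • E₂)
    obtain ⟨h₂, h₃⟩ := hindep (a - x (a • E₁ + b • E₂)) (b - y (a • E₁ + b • E₂)) (by
      rw [sub_smul, sub_smul, sub_add_sub_comm, ← h₁, sub_self])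
    exact ⟨(sub_eq_zero.1 h₂).symm, (sub_eq_zero.1 h₃).symm⟩
  have hu : ∀ {a b : K} {A}, a • E₁ + b • E₂ = A → x A = a ∧ y A = b := by
    rintro a b A rfl
    exact huniq a b
  have h0 := hu (a := 0) (b := 0) (A := 0) (by simp)
  have h1 := hu (a := 1) (b := 0) (A := E₁) (by simp)
  have h2 := hu (a := 0) (b := 1) (A := E₂) (by simp)
  refine ⟨K, inferInstance, x, y, ?_, fun a b => ⟨_, huniq a b⟩, h0.1, h0.2, h1.1, h1.2, h2.1,
    h2.2, ?_⟩
  · intro A B hx hy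
    rw [hxy A, hxy B, hx, hy]
  intro A B hAB
  have hline : ∀ C, R A B A C ↔ ∃ f : K, x C = x A + f * (x B - x A) ∧
      y C = y A + f * (y B - y A) := by
    intro C
    rw [h.iff_sub ht, hspan (sub_ne_zero.2 hAB.symm)]
    refine exists_congr fun f => ?_
    have : f • (B - A) + A = (x A + f * (x B - x A)) • E₁ + (y A + f * (y B - y A)) • E₂ := by
      conv_lhs => rw [hxy A, hxy B]
      simp only [smul_add, smul_sub, add_smul, mul_sub, sub_smul, mul_smul]
      abel
    rw [eq_sub_iff_add_eq, this]
    constructor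
    · rintro rfl
      exact huniq _ _
    · rintro ⟨h₁, h₂⟩
      rw [hxy C, h₁, h₂]
  by_cases hx : x A = x B
  · refine .inl ⟨hx, fun C => ?_⟩
    have hy : y B - y A ≠ 0 := fun h₁ => hAB (by rw [hxy A, hxy B, hx, sub_eq_zero.1 h₁])
    rw [hline]
    constructor
    · rintro ⟨f, h₁, -⟩
      simpa [hx] using h₁
    · intro h₁
      exact ⟨(y C - y A) * (y B - y A)⁻¹, by simp [h₁, hx], by
        rw [mul_assoc, inv_mul_cancel₀ hy]; simp⟩
  · right
    have hx' : x B - x A ≠ 0 := sub_ne_zero.2 (Ne.symm hx)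
    -- Scalars act from the left, so eliminating the parameter f from the two coordinates leaves the
    -- slope on the right of x. The order matters as long as K is not known to be commutative.
    refine ⟨(x B - x A)⁻¹ * (y B - y A), y A - x A * ((x B - x A)⁻¹ * (y B - y A)), fun C => ?_⟩
    rw [hline]
    constructor
    · rintro ⟨f, h₁, h₂⟩
      have h₃ : x C - x A = f * (x B - x A) := by rw [h₁]; abel
      rw [h₂, add_sub_left_comm, ← sub_mul, h₃, ← mul_assoc, mul_assoc f, mul_inv_cancel₀ hx',
        mul_one]
    · intro h₁
      refine ⟨(x C - x A) * (x B - x A)⁻¹, ?_, ?_⟩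
      · rw [mul_assoc, inv_mul_cancel₀ hx']
        simp
      · rw [h₁, mul_assoc, sub_mul]
        abel

end IsDesarguesianParallelism

/-! ### Parallelism of a Desarguesian plane -/

namespace Str

variable {M : Str.{u} planeSig}

/-- `l` and `m` are parallel or equal. -/
def ParEq (M : Str.{u} planeSig) (l m : M.Ln) : Prop := M.Par l m ∨ l = m

/-- `A = B`, or `C = D`, or `AB` and `CD` are parallel or equal. -/
def Parallelism (M : Str.{u} planeSig) (A B C D : M.Pt) : Prop :=
  ∃ l m, M.Inc A l ∧ M.Inc B l ∧ M.Inc C m ∧ M.Inc D m ∧ M.ParEq l m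

theorem Par.symm {l m : M.Ln} (h : M.Par l m) : M.Par m l := fun ⟨A, h₁, h₂⟩ => h ⟨A, h₂, h₁⟩

theorem ParEq.symm {l m : M.Ln} (h : M.ParEq l m) : M.ParEq m l := by
  rcases h with h | rfl
  · exact .inl h.symm
  · exact .inr rfl

theorem ParEq.eq {l m : M.Ln} (h : M.ParEq l m) {A : M.Pt} (h₁ : M.Inc A l) (h₂ : M.Inc A m) :
    l = m := by
  rcases h with h | rfl
  · exact absurd ⟨A, h₁, h₂⟩ h
  · rfl

namespace IsDesarguesian

variable (h : M.IsDesarguesian)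
include h

theorem line_unique {A B : M.Pt} (hAB : A ≠ B) {l m : M.Ln} (h₁ : M.Inc A l) (h₂ : M.Inc B l)
    (h₃ : M.Inc A m) (h₄ : M.Inc B m) : l = m :=
  (h.line_through A B hAB).unique ⟨h₁, h₂⟩ ⟨h₃, h₄⟩

theorem parEq_trans {l m n : M.Ln} (h₁ : M.ParEq l m) (h₂ : M.ParEq m n) : M.ParEq l n := by
  rcases h₁ with h₁ | rfl
  swap
  · exact h₂
  rcases h₂ with h₂ | rfl
  swap
  · exact .inl h₁
  by_cases hln : M.Par l n
  · exact .inl hln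
  · obtain ⟨A, hAl, hAn⟩ := not_not.1 hln
    exact .inr ((h.parallel m A fun hA => h₁ ⟨A, hAl, hA⟩).unique ⟨hAl, h₁⟩ ⟨hAn, h₂.symm⟩)

theorem exists_parEq (l : M.Ln) (A : M.Pt) : ∃ m, M.Inc A m ∧ M.ParEq m l := by
  by_cases hA : M.Inc A l
  · exact ⟨l, hA, .inr rfl⟩
  · obtain ⟨m, hm, -⟩ := h.parallel l A hA
    exact ⟨m, hm.1, .inl hm.2⟩

theorem exists_line (A B : M.Pt) : ∃ l, M.Inc A l ∧ M.Inc B l := by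
  by_cases hAB : A = B
  · subst hAB
    obtain ⟨X, Y, Z, hXY, -⟩ := h.three_points
    obtain ⟨l, -⟩ := h.line_through X Y hXY
    obtain ⟨m, hm, -⟩ := h.exists_parEq l A
    exact ⟨m, hm, hm⟩
  · obtain ⟨l, hl, -⟩ := h.line_through A B hAB
    exact ⟨l, hl⟩

theorem affineParallelism : IsAffineParallelism M.Parallelism where
  comm := fun ⟨l, m, h₁, h₂, h₃, h₄, h₅⟩ => ⟨m, l, h₃, h₄, h₁, h₂, h₅.symm⟩
  swap := fun ⟨l, m, h₁, h₂, h₃, h₄, h₅⟩ => ⟨l, m, h₂, h₁, h₃, h₄, h₅⟩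
  refl A B := by
    obtain ⟨l, h₁, h₂⟩ := h.exists_line A B
    exact ⟨l, l, h₁, h₂, h₁, h₂, .inr rfl⟩
  degenerate A B C := by
    obtain ⟨m, h₁, h₂⟩ := h.exists_line B C
    obtain ⟨l, h₃, h₄⟩ := h.exists_parEq m A
    exact ⟨l, m, h₃, h₃, h₁, h₂, h₄⟩
  trans := by
    rintro A B C D E F hCD ⟨l, m, h₁, h₂, h₃, h₄, h₅⟩ ⟨m', n, h₆, h₇, h₈, h₉, h₁₀⟩
    obtain rfl := h.line_unique hCD h₃ h₄ h₆ h₇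
    exact ⟨l, n, h₁, h₂, h₈, h₉, h.parEq_trans h₅ h₁₀⟩
  chain := by
    rintro A B X Y Z hAB ⟨l, m, h₁, h₂, h₃, h₄, h₅⟩ ⟨l', m', h₆, h₇, h₈, h₉, h₁₀⟩
    obtain rfl := h.line_unique hAB h₃ h₄ h₈ h₉
    obtain rfl := (h.parEq_trans h₅ h₁₀.symm).eq h₁ h₆
    exact ⟨l, m, h₂, h₇, h₃, h₄, h₅⟩
  meet := by
    intro A B C D hn P Q
    obtain ⟨l, h₁, h₂⟩ := h.exists_line A B
    obtain ⟨m, h₃, h₄⟩ := h.exists_line C D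
    obtain ⟨l', h₅, h₆⟩ := h.exists_parEq l P
    obtain ⟨m', h₇, h₈⟩ := h.exists_parEq m Q
    by_cases hp : M.Par l' m'
    · exact absurd ⟨l, m, h₁, h₂, h₃, h₄, h.parEq_trans h₆.symm
        (h.parEq_trans (.inl hp) h₈)⟩ hn
    · obtain ⟨X, hX, hX'⟩ := not_not.1 hp
      exact ⟨X, ⟨l', l, h₅, hX, h₁, h₂, h₆⟩, ⟨m', m, h₇, hX', h₃, h₄, h₈⟩⟩

omit h in
theorem parallelism_iff_col {A B C : M.Pt} : M.Parallelism A B A C ↔ M.Col A B C := by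
  constructor
  · rintro ⟨l, m, h₁, h₂, h₃, h₄, h₅⟩
    obtain rfl := h₅.eq h₁ h₃
    exact ⟨l, h₁, h₂, h₄⟩
  · rintro ⟨l, h₁, h₂, h₃⟩
    exact ⟨l, l, h₁, h₂, h₁, h₃, .inr rfl⟩

theorem parPts_iff {A B C D : M.Pt} : M.ParPts A B C D ↔
    A ≠ B ∧ C ≠ D ∧ M.Parallelism A B C D ∧ ¬ M.Parallelism A B A C := by
  rw [parallelism_iff_col]
  constructor
  · rintro ⟨hAB, hCD, l, m, h₁, h₂, h₃, h₄, h₅⟩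
    refine ⟨hAB, hCD, ⟨l, m, h₁, h₂, h₃, h₄, .inl h₅⟩, ?_⟩
    rintro ⟨l', h₆, h₇, h₈⟩
    obtain rfl := h.line_unique hAB h₁ h₂ h₆ h₇
    exact h₅ ⟨C, h₈, h₃⟩
  · rintro ⟨hAB, hCD, ⟨l, m, h₁, h₂, h₃, h₄, h₅⟩, h₆⟩
    refine ⟨hAB, hCD, l, m, h₁, h₂, h₃, h₄, h₅.resolve_right ?_⟩
    rintro rfl
    exact h₆ ⟨l, h₁, h₂, h₃⟩

/-- Both cases of the second axiom of Desargues, with fewer nondegeneracy conditions. -/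
theorem desargues_aux {A B C A' B' C' : M.Pt} (hAB₀ : A' ≠ B') (hAC₀ : A' ≠ C')
    (hB : ¬ M.Parallelism A B A A') (hC : ¬ M.Parallelism A C A A')
    (hAB : M.Parallelism A B A' B') (hAC : M.Parallelism A C A' C') {a b c : M.Ln}
    (h₁ : M.Inc A a) (h₁' : M.Inc A' a) (h₂ : M.Inc B b) (h₂' : M.Inc B' b) (h₃ : M.Inc C c)
    (h₃' : M.Inc C' c) (hp : ParOrConcur M a b c) : M.Parallelism B C B' C' := by
  have r := h.affineParallelism
  have hneB := r.ne_left hB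
  have hneC := r.ne_left hC
  by_cases hbc : b = c
  · subst hbc
    exact ⟨b, b, h₂, h₃, h₂', h₃', .inr rfl⟩
  have hab : a ≠ b := by
    rintro rfl
    exact hB ⟨a, a, h₁, h₂, h₁, h₁', .inr rfl⟩
  have hac : a ≠ c := by
    rintro rfl
    exact hC ⟨a, a, h₁, h₃, h₁, h₁', .inr rfl⟩
  -- The axiom covers only proper triangles on three distinct traces. A collinear triple goes to a
  -- collinear triple on a parallel or equal line.
  by_cases hcol : M.Parallelism A B A C
  · have hcol' : M.Parallelism A' B' A' C' :=
      r.trans_left hneB hAB (r.trans hneC hcol hAC)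
    have h₄ : M.Parallelism B C A B := by grind [r.comm, r.swap, r.rotate]
    have h₅ : M.Parallelism A' B' B' C' := by grind [r.comm, r.swap, r.rotate]
    exact r.trans hneB h₄ (r.trans hAB₀ hAB h₅)
  have hcol' : ¬ M.Parallelism A' B' A' C' := fun h₄ =>
    hcol (r.trans hAB₀ hAB (r.trans hAC₀ h₄ (r.comm hAC)))
  obtain ⟨-, -, l, m, h₄, h₅, h₆, h₇, h₈⟩ := h.desargues₂ A B C A' B' C'
    (mt parallelism_iff_col.2 hcol) (mt parallelism_iff_col.2 hcol')
    (h.parPts_iff.2 ⟨hneB, hAB₀, hAB, hB⟩) (h.parPts_iff.2 ⟨hneC, hAC₀, hAC, hC⟩)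
    a b c h₁ h₁' h₂ h₂' h₃ h₃' hab hac hbc hp
  exact ⟨l, m, h₄, h₅, h₆, h₇, .inl h₈⟩

theorem parallel_desargues {A B C A' B' C' : M.Pt} (hB : ¬ M.Parallelism A A' A B)
    (hC : ¬ M.Parallelism A A' A C) (hBB : M.Parallelism A A' B B')
    (hCC : M.Parallelism A A' C C') (hAB : M.Parallelism A B A' B')
    (hAC : M.Parallelism A C A' C') : M.Parallelism B C B' C' := by
  have r := h.affineParallelism
  have hAA := r.ne_left hB
  have ne : ∀ {B B'}, ¬ M.Parallelism A A' A B → M.Parallelism A A' B B' → A' ≠ B' := by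
    rintro B _ hB hBB rfl
    grind [r.comm, r.swap, r.rotate]
  obtain ⟨a, b, h₁, h₁', h₂, h₂', h₅⟩ := id hBB
  obtain ⟨a', c, h₆, h₆', h₃, h₃', h₇⟩ := id hCC
  obtain rfl := h.line_unique hAA h₁ h₁' h₆ h₆'
  have par : ∀ {B b}, ¬ M.Parallelism A A' A B → M.Inc B b → M.ParEq a b → M.Par a b := by
    intro B b hB h₂ h₅
    refine h₅.resolve_right ?_
    rintro rfl
    exact hB ⟨a, a, h₁, h₁', h₁, h₂, .inr rfl⟩
  rcases h.parEq_trans h₅.symm h₇ with h₈ | rfl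
  · exact h.desargues_aux (ne hB hBB) (ne hC hCC) (fun h₁ => hB (r.comm h₁))
      (fun h₁ => hC (r.comm h₁)) hAB hAC h₁ h₁' h₂ h₂' h₃ h₃'
      (.inl ⟨par hB h₂ h₅, h₈, par hC h₃ h₇⟩)
  · exact ⟨b, b, h₂, h₃, h₂', h₃', .inr rfl⟩

theorem central_desargues {O A B C A' B' C' : M.Pt} (hA' : A' ≠ O) (hB' : B' ≠ O) (hC' : C' ≠ O)
    (hB : ¬ M.Parallelism O A O B) (hC : ¬ M.Parallelism O A O C)
    (hAA : M.Parallelism O A O A') (hBB : M.Parallelism O B O B')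
    (hCC : M.Parallelism O C O C') (hAB : M.Parallelism A B A' B')
    (hAC : M.Parallelism A C A' C') : M.Parallelism B C B' C' := by
  have r := h.affineParallelism
  have hOA := r.ne_left hB
  have hOB := r.ne_right hB
  have hOC := r.ne_right hC
  -- The reduction to the axiom requires the trace AA' to be spanned by two points; if A is fixed, B
  -- and C are intersections of fixed lines and are fixed too.
  by_cases hA : A = A'
  · subst hA
    have key : ∀ {B B'}, ¬ M.Parallelism O A O B → M.Parallelism O B O B' →
        M.Parallelism A B A B' → B' = B := by
      intro B B' hB hBB hAB
      have hn : ¬ M.Parallelism O B A B := by grind [r.comm, r.swap, r.rotate]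
      exact r.uniq hn (r.comm hBB) (r.refl _ _) (r.comm hAB) (r.refl _ _)
    obtain rfl := key hB hBB hAB
    obtain rfl := key hC hCC hAC
    exact r.refl _ _
  have ne : ∀ {B B'}, O ≠ B → B' ≠ O → ¬ M.Parallelism O A O B → M.Parallelism O B O B' →
      A' ≠ B' := by
    rintro B _ hOB hB' hB hBB rfl
    exact hB (r.trans hA'.symm hAA (r.comm hBB))
  have off : ∀ {B}, ¬ M.Parallelism O A O B → ¬ M.Parallelism A B A A' := by
    intro B hB h₁
    have h₂ : M.Parallelism A A' O A := by grind [r.comm, r.swap, r.rotate]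
    have h₃ : M.Parallelism A B O A := r.trans hA h₁ h₂
    grind [r.comm, r.swap, r.rotate]
  obtain ⟨a, h₀, h₁, h₁'⟩ := parallelism_iff_col.1 hAA
  obtain ⟨b, g₀, h₂, h₂'⟩ := parallelism_iff_col.1 hBB
  obtain ⟨c, k₀, h₃, h₃'⟩ := parallelism_iff_col.1 hCC
  exact h.desargues_aux (ne hOB hB' hB hBB) (ne hOC hC' hC hCC) (off hB) (off hC) hAB hAC
    h₁ h₁' h₂ h₂' h₃ h₃' (.inr ⟨O, h₀, g₀, k₀⟩)

theorem desarguesianParallelism (h4 : ∀ A B : M.Pt, A ≠ B → ∃ C D, M.Col A B C ∧ M.Col A B D ∧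
    A ≠ C ∧ A ≠ D ∧ B ≠ C ∧ B ≠ D ∧ C ≠ D) : IsDesarguesianParallelism M.Parallelism where
  toIsAffineParallelism := h.affineParallelism
  noncollinear := by
    obtain ⟨A, B, C, -, -, -, hn⟩ := h.three_points
    exact ⟨A, B, C, mt parallelism_iff_col.1 hn⟩
  four_points {A B} hAB := by
    simpa only [parallelism_iff_col] using h4 A B hAB
  parallel_desargues := h.parallel_desargues
  central_desargues := h.central_desargues

end IsDesarguesian

/-- One further point lies between A and B and another lies beyond B; they differ because only one
of three collinear points can be the middle one. -/
theorem IsOrderedMetricWu.four_points (h : M.IsOrderedMetricWu) (A B : M.Pt) (hAB : A ≠ B) :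
    ∃ C D, M.Col A B C ∧ M.Col A B D ∧ A ≠ C ∧ A ≠ D ∧ B ≠ C ∧ B ≠ D ∧ C ≠ D := by
  obtain ⟨⟨C, hC⟩, D, hD⟩ := h.be_exists A B hAB
  obtain ⟨h₁, -, h₂, l, h₃, h₄, h₅⟩ := h.be_distinct_col _ _ _ hC
  obtain ⟨-, h₆, h₇, hcol⟩ := h.be_distinct_col _ _ _ hD
  refine ⟨C, D, ⟨l, h₃, h₅, h₄⟩, hcol, h₁, h₆, h₂.symm, h₇, ?_⟩
  rintro rfl
  exact (h.be_trichotomy A C B h₁ hAB h₂ ⟨l, h₃, h₄, h₅⟩).2.2.1 ⟨hC, hD⟩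

/-- Coordinates over a division ring, with prescribed axes. -/
theorem IsDesarguesian.exists_coordinates (h : M.IsDesarguesian)
    (h4 : ∀ A B : M.Pt, A ≠ B → ∃ C D, M.Col A B C ∧ M.Col A B D ∧
      A ≠ C ∧ A ≠ D ∧ B ≠ C ∧ B ≠ D ∧ C ≠ D) {O : M.Pt} {l m : M.Ln} (hlm : l ≠ m)
    (hl : M.Inc O l) (hm : M.Inc O m) :
    ∃ (K : Type u) (_ : DivisionRing K) (x y : M.Pt → K),
      (∀ A B, x A = x B → y A = y B → A = B) ∧ (∀ a b, ∃ A, x A = a ∧ y A = b) ∧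
      (∀ A, M.Inc A l ↔ y A = 0) ∧ (∀ A, M.Inc A m ↔ x A = 0) ∧
      (∀ n, (∃ c, ∀ A, M.Inc A n ↔ x A = c) ∨ ∃ s b, ∀ A, M.Inc A n ↔ y A = x A * s + b) ∧
      (∀ c, ∃ n, ∀ A, M.Inc A n ↔ x A = c) ∧ (∀ s b, ∃ n, ∀ A, M.Inc A n ↔ y A = x A * s + b) ∧
      ∀ n n', (∀ A, M.Inc A n ↔ M.Inc A n') → n = n' := by
  have r := h.desarguesianParallelism h4
  have other : ∀ l : M.Ln, M.Inc O l → ∃ E, O ≠ E ∧ M.Inc E l := by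
    intro l _
    obtain ⟨A, B, hAB, hA, hB⟩ := h.two_points l
    by_cases hO : O = A
    · exact ⟨B, hO ▸ hAB, hB⟩
    · exact ⟨A, hO, hA⟩
  obtain ⟨E₁, hE₁, hE₁l⟩ := other l hl
  obtain ⟨E₂, hE₂, hE₂m⟩ := other m hm
  have hn : ¬ M.Parallelism O E₁ O E₂ := by
    rw [parallelism_iff_col]
    rintro ⟨n, h₁, h₂, h₃⟩
    exact hlm ((h.line_unique hE₁ hl hE₁l h₁ h₂).trans (h.line_unique hE₂ h₁ h₃ hm hE₂m))
  obtain ⟨K, _, x, y, hext, hex, hxO, hyO, hx₁, hy₁, hx₂, hy₂, hline⟩ := r.exists_coordinates hn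
  have inc_iff : ∀ {A B n}, A ≠ B → M.Inc A n → M.Inc B n →
      ∀ C, M.Inc C n ↔ M.Parallelism A B A C := by
    intro A B n hAB hA hB C
    rw [parallelism_iff_col]
    constructor
    · exact fun hC => ⟨n, hA, hB, hC⟩
    · rintro ⟨n', h₁, h₂, h₃⟩
      rwa [h.line_unique hAB hA hB h₁ h₂]
  have form : ∀ n, (∃ c, ∀ A, M.Inc A n ↔ x A = c) ∨
      ∃ s b, ∀ A, M.Inc A n ↔ y A = x A * s + b := by
    intro n
    obtain ⟨A, B, hAB, hA, hB⟩ := h.two_points n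
    rcases hline A B hAB with ⟨-, h₁⟩ | ⟨s, b, h₁⟩
    · exact .inl ⟨x A, fun C => (inc_iff hAB hA hB C).trans (h₁ C)⟩
    · exact .inr ⟨s, b, fun C => (inc_iff hAB hA hB C).trans (h₁ C)⟩
  have h10 : (1 : K) ≠ 0 := one_ne_zero
  refine ⟨K, inferInstance, x, y, hext, hex, ?_, ?_, form, ?_, ?_, ?_⟩
  · rcases form l with ⟨c, h₁⟩ | ⟨s, b, h₁⟩
    · have h₂ := (h₁ O).1 hl
      have h₃ := (h₁ E₁).1 hE₁l
      rw [hxO] at h₂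
      rw [hx₁] at h₃
      exact absurd (h₃.trans h₂.symm) h10
    · have h₂ := (h₁ O).1 hl
      have h₃ := (h₁ E₁).1 hE₁l
      simp only [hxO, hyO, zero_mul, zero_add] at h₂
      simp only [hx₁, hy₁, ← h₂, one_mul, add_zero] at h₃
      simpa [← h₂, ← h₃] using h₁
  · rcases form m with ⟨c, h₁⟩ | ⟨s, b, h₁⟩
    · have h₂ := (h₁ O).1 hm
      rw [hxO] at h₂
      simpa [← h₂] using h₁
    · have h₂ := (h₁ O).1 hm
      have h₃ := (h₁ E₂).1 hE₂m
      simp only [hxO, hyO, zero_mul, zero_add] at h₂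
      simp only [hx₂, hy₂, ← h₂, zero_mul, add_zero] at h₃
      exact absurd h₃ h10
  · intro c
    obtain ⟨A, hA, hA'⟩ := hex c 0
    obtain ⟨B, hB, hB'⟩ := hex c 1
    have hAB : A ≠ B := by
      rintro rfl
      exact h10 (hB'.symm.trans hA')
    obtain ⟨n, hn, -⟩ := h.line_through A B hAB
    rcases form n with ⟨d, h₁⟩ | ⟨s, b, h₁⟩
    · refine ⟨n, ?_⟩
      rw [← hA, (h₁ A).1 hn.1]
      exact h₁
    · have h₂ := (h₁ A).1 hn.1
      have h₃ := (h₁ B).1 hn.2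
      rw [hA, hA'] at h₂
      rw [hB, hB', ← h₂] at h₃
      exact absurd h₃ h10
  · intro s b
    obtain ⟨A, hA, hA'⟩ := hex 0 b
    obtain ⟨B, hB, hB'⟩ := hex 1 (s + b)
    have hAB : A ≠ B := by
      rintro rfl
      exact h10 (hB.symm.trans hA)
    obtain ⟨n, hn, -⟩ := h.line_through A B hAB
    rcases form n with ⟨d, h₁⟩ | ⟨s', b', h₁⟩
    · have h₂ := (h₁ A).1 hn.1
      have h₃ := (h₁ B).1 hn.2
      exact absurd (hB.symm.trans (h₃.trans (h₂.symm.trans hA))) h10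
    · have h₂ := (h₁ A).1 hn.1
      have h₃ := (h₁ B).1 hn.2
      simp only [hA, hA', zero_mul, zero_add] at h₂
      simp only [hB, hB', one_mul, ← h₂, add_left_inj] at h₃
      refine ⟨n, ?_⟩
      rw [h₂, h₃]
      exact h₁
  · intro n n' hnn
    obtain ⟨A, B, hAB, hA, hB⟩ := h.two_points n
    exact h.line_unique hAB hA hB ((hnn A).1 hA) ((hnn B).1 hB)

end Str

namespace Str

variable {M : Str.{u} planeSig}

/-! ### Orthogonality in coordinates -/

/-- The line orthogonal to l through a point of n is parallel or equal to m, and there is only one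
such line through that point, namely n. -/
theorem IsOrthogonalWu.perp_parEq (h : M.IsOrthogonalWu) {l m n : M.Ln} (h₁ : M.Perp l m)
    (h₂ : M.ParEq m n) : M.Perp l n := by
  obtain ⟨A, -, -, hA, -⟩ := h.two_points n
  obtain ⟨k, ⟨hk, hAk⟩, -⟩ := h.perp_through A l
  have h₃ : M.ParEq m k := h.perp_perp _ _ _ h₁ hk
  rwa [(h.parEq_trans h₂.symm h₃).eq hA hAk]

theorem IsOrthogonalWu.parEq_perp (h : M.IsOrthogonalWu) {l m n : M.Ln} (h₁ : M.Perp l m)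
    (h₂ : M.ParEq l n) : M.Perp n m :=
  (h.perp_comm _ _).1 (h.perp_parEq ((h.perp_comm _ _).1 h₁) h₂)

/-- `l` is the line with equation `y = x * s + b`. -/
def HasSlope {K : Type u} [DivisionRing K] (x y : M.Pt → K) (l : M.Ln) (s b : K) : Prop :=
  ∀ A, M.Inc A l ↔ y A = x A * s + b

/-- Let p(s) be the slope of the lines orthogonal to those of slope s. In a triangle (a, 0), (b, 0),
(0, c) the height from the third vertex is the axis `m`, and the other two heights must meet it in
one point, which gives b p(-a⁻¹c) = a p(-b⁻¹c). For b = 1 and c = 1 this determines p from κ =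
p(-1), and consistency for general c forces ab = ba. -/
theorem IsOrthogonalWu.mul_comm_and_perp (h : M.IsOrthogonalWu) {K : Type u} [DivisionRing K]
    {x y : M.Pt → K} (hex : ∀ a b, ∃ A, x A = a ∧ y A = b) {l m : M.Ln}
    (hl : ∀ A, M.Inc A l ↔ y A = 0) (hm : ∀ A, M.Inc A m ↔ x A = 0) (hlm : M.Perp l m)
    (form : ∀ n, (∃ c, ∀ A, M.Inc A n ↔ x A = c) ∨ ∃ s b, HasSlope x y n s b)
    (line : ∀ s b, ∃ n, HasSlope x y n s b) :
    (∀ a b : K, a * b = b * a) ∧ ∃ κ : K, κ ≠ 0 ∧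
      (∀ n n' s b t c, HasSlope x y n s b → HasSlope x y n' t c →
        (M.Perp n n' ↔ κ + t * s = 0)) ∧
      (∀ n n' s b c, HasSlope x y n s b → (∀ A, M.Inc A n' ↔ x A = c) →
        (M.Perp n n' ↔ s = 0)) ∧
      (∀ n n' c c', (∀ A, M.Inc A n ↔ x A = c) → (∀ A, M.Inc A n' ↔ x A = c') →
        ¬ M.Perp n n') := by
  have h10 : (1 : K) ≠ 0 := one_ne_zero
  obtain ⟨O, hxO, hyO⟩ := hex 0 0
  have parV : ∀ {n n' c c'}, (∀ A, M.Inc A n ↔ x A = c) → (∀ A, M.Inc A n' ↔ x A = c') →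
      M.ParEq n n' := by
    intro n n' c c' h₁ h₂
    by_cases hp : M.Par n n'
    · exact .inl hp
    · obtain ⟨A, hA, hA'⟩ := not_not.1 hp
      obtain rfl : c = c' := ((h₁ A).1 hA).symm.trans ((h₂ A).1 hA')
      obtain ⟨B, hB, hB'⟩ := hex c 0
      obtain ⟨C, hC, hC'⟩ := hex c 1
      exact .inr (h.line_unique (A := B) (B := C) (by rintro rfl; exact h10 (hC'.symm.trans hB'))
        ((h₁ _).2 hB) ((h₁ _).2 hC) ((h₂ _).2 hB) ((h₂ _).2 hC))
  have parS : ∀ {n n' s b b'}, HasSlope x y n s b → HasSlope x y n' s b' → M.ParEq n n' := by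
    intro n n' s b b' h₁ h₂
    by_cases hp : M.Par n n'
    · exact .inl hp
    · obtain ⟨A, hA, hA'⟩ := not_not.1 hp
      obtain rfl : b = b' := add_left_cancel (((h₁ A).1 hA).symm.trans ((h₂ A).1 hA'))
      obtain ⟨B, hB, hB'⟩ := hex 0 b
      obtain ⟨C, hC, hC'⟩ := hex 1 (s + b)
      exact .inr (h.line_unique (A := B) (B := C) (by rintro rfl; exact h10 (hC.symm.trans hB))
        ((h₁ _).2 (by simp [hB, hB'])) ((h₁ _).2 (by simp [hC, hC']))
        ((h₂ _).2 (by simp [hB, hB'])) ((h₂ _).2 (by simp [hC, hC'])))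
  have slope_unique : ∀ {n n' s b t c}, HasSlope x y n s b → HasSlope x y n' t c →
      M.ParEq n n' → s = t := by
    intro n n' s b t c h₁ h₂ h₃
    by_contra hst
    have hst' : s - t ≠ 0 := sub_ne_zero.2 hst
    obtain ⟨A, hA, hA'⟩ := hex ((c - b) * (s - t)⁻¹) ((c - b) * (s - t)⁻¹ * s + b)
    have hA₁ : M.Inc A n := (h₁ A).2 (by rw [hA, hA'])
    have hA₂ : M.Inc A n' := (h₂ A).2 (by
      have : (c - b) * (s - t)⁻¹ * (s - t) = c - b := by
        rw [mul_assoc, inv_mul_cancel₀ hst', mul_one]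
      rw [mul_sub] at this
      rw [hA, hA', ← sub_eq_zero]
      have h₄ := sub_eq_zero.2 this
      rw [← h₄]
      abel)
    obtain rfl := h₃.eq hA₁ hA₂
    obtain ⟨B, hB, hB'⟩ := hex 0 b
    obtain ⟨C, hC, hC'⟩ := hex 1 (s + b)
    have h₄ := (h₂ B).1 ((h₁ B).2 (by simp [hB, hB']))
    have h₅ := (h₂ C).1 ((h₁ C).2 (by simp [hC, hC']))
    simp only [hB, hB', zero_mul, zero_add] at h₄
    simp only [hC, hC', one_mul, h₄, add_left_inj] at h₅
    exact hst h₅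
  have not_parEq : ∀ {n n' s b c}, HasSlope x y n s b → (∀ A, M.Inc A n' ↔ x A = c) →
      ¬ M.ParEq n n' := by
    intro n n' s b c h₁ h₂ h₃
    obtain ⟨A, hA, hA'⟩ := hex c (c * s + b)
    obtain rfl := h₃.eq ((h₁ A).2 (by rw [hA, hA'])) ((h₂ A).2 hA)
    obtain ⟨B, hB, hB'⟩ := hex (c + 1) ((c + 1) * s + b)
    have := (h₂ B).1 ((h₁ B).2 (by rw [hB, hB']))
    rw [hB] at this
    simp at this
  have hl' : HasSlope x y l 0 0 := fun A => by simpa using hl A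
  have perp_l : ∀ {n}, M.Perp n l → M.ParEq m n := fun hn =>
    h.perp_perp _ _ _ hlm ((h.perp_comm _ _).1 hn)
  have perp_m : ∀ {n}, M.Perp n m → M.ParEq l n := fun hn =>
    h.perp_perp _ _ _ ((h.perp_comm _ _).1 hlm) ((h.perp_comm _ _).1 hn)
  have hSV : ∀ n n' s b c, HasSlope x y n s b → (∀ A, M.Inc A n' ↔ x A = c) →
      (M.Perp n n' ↔ s = 0) := by
    intro n n' s b c h₁ h₂
    constructor
    · intro h₃
      exact slope_unique h₁ hl' (perp_m (h.perp_parEq h₃ (parV h₂ hm))).symm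
    · rintro rfl
      exact h.parEq_perp (h.perp_parEq hlm (parV hm h₂)) (parS hl' h₁)
  have hVV : ∀ n n' c c', (∀ A, M.Inc A n ↔ x A = c) → (∀ A, M.Inc A n' ↔ x A = c') →
      ¬ M.Perp n n' := by
    intro n n' c c' h₁ h₂ h₃
    exact not_parEq hl' h₁ (perp_m (h.perp_parEq h₃ (parV h₂ hm)))
  have hp : ∀ s : K, s ≠ 0 → ∃ t, t ≠ 0 ∧ ∀ n n' b r c, HasSlope x y n s b →
      HasSlope x y n' r c → (M.Perp n n' ↔ r = t) := by
    intro s hs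
    obtain ⟨n, hn⟩ := line s 0
    obtain ⟨n', ⟨hn', -⟩, -⟩ := h.perp_through O n
    rcases form n' with ⟨c, hc⟩ | ⟨t, b', hb'⟩
    · exact absurd ((hSV _ _ _ _ _ hn hc).1 hn') hs
    refine ⟨t, ?_, ?_⟩
    · rintro rfl
      exact not_parEq hn hm (perp_l (h.perp_parEq hn' (parS hb' hl'))).symm
    · intro k k' b r c hk hk'
      constructor
      · intro h₁
        exact slope_unique hk' hb' (h.perp_perp _ _ _ (h.parEq_perp h₁ (parS hk hn)) hn')
      · rintro rfl
        exact h.parEq_perp (h.perp_parEq hn' (parS hb' hk')) (parS hn hk)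
  -- Lines of slope 0 have vertical perpendiculars; p takes the irrelevant value 0 there, so that it
  -- becomes a total function.
  have hp' : ∀ s : K, ∃ t, s ≠ 0 → t ≠ 0 ∧ ∀ n n' b r c, HasSlope x y n s b →
      HasSlope x y n' r c → (M.Perp n n' ↔ r = t) := by
    intro s
    by_cases hs : s = 0
    · exact ⟨0, fun h₁ => absurd hs h₁⟩
    · obtain ⟨t, ht⟩ := hp s hs
      exact ⟨t, fun _ => ht⟩
  choose p hp₁ using hp'
  have heights : ∀ a b c : K, a ≠ 0 → b ≠ 0 → c ≠ 0 → a ≠ b →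
      b * p (-(a⁻¹ * c)) = a * p (-(b⁻¹ * c)) := by
    intro a b c ha hb hc hab
    obtain ⟨A, hA, hA'⟩ := hex a 0
    obtain ⟨B, hB, hB'⟩ := hex b 0
    obtain ⟨C, hC, hC'⟩ := hex 0 c
    have hAl : M.Inc A l := (hl A).2 hA'
    have hBl : M.Inc B l := (hl B).2 hB'
    have hAB : A ≠ B := by
      rintro rfl
      exact hab (hA.symm.trans hB)
    obtain ⟨nA, hnA⟩ := line (-(a⁻¹ * c)) c
    obtain ⟨nB, hnB⟩ := line (-(b⁻¹ * c)) c
    obtain ⟨kA, hkA⟩ := line (p (-(b⁻¹ * c))) (-(a * p (-(b⁻¹ * c))))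
    obtain ⟨kB, hkB⟩ := line (p (-(a⁻¹ * c))) (-(b * p (-(a⁻¹ * c))))
    have hcol : ¬ M.Col A B C := by
      rintro ⟨k, h₁, h₂, h₃⟩
      obtain rfl := h.line_unique hAB hAl hBl h₁ h₂
      exact hc (hC'.symm.trans ((hl C).1 h₃))
    have s₁ : -(a⁻¹ * c) ≠ 0 := neg_ne_zero.2 (mul_ne_zero (inv_ne_zero ha) hc)
    have s₂ : -(b⁻¹ * c) ≠ 0 := neg_ne_zero.2 (mul_ne_zero (inv_ne_zero hb) hc)
    obtain ⟨H, ⟨h₁, h₂, h₃⟩, -⟩ := h.heights A B C hcol nB nA l kA kB m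
      ((hnB B).2 (by simp [hB, hB', hb])) ((hnB C).2 (by simp [hC, hC']))
      ((hnA C).2 (by simp [hC, hC'])) ((hnA A).2 (by simp [hA, hA', ha]))
      hAl hBl ((hkA A).2 (by simp [hA, hA']))
      ((h.perp_comm _ _).1 (((hp₁ _ s₂).2 _ _ _ _ _ hnB hkA).2 rfl))
      ((hkB B).2 (by simp [hB, hB']))
      ((h.perp_comm _ _).1 (((hp₁ _ s₁).2 _ _ _ _ _ hnA hkB).2 rfl))
      ((hm C).2 hC) ((h.perp_comm _ _).1 hlm)
    rw [hkA, (hm H).1 h₃] at h₁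
    rw [hkB, (hm H).1 h₃] at h₂
    rw [h₁] at h₂
    simpa using h₂.symm
  set κ := p (-1) with hκ
  have hκ0 : κ ≠ 0 := (hp₁ (-1) (by simp)).1
  have q₁ : ∀ a c : K, a ≠ 0 → c ≠ 0 → p (-(a⁻¹ * c)) = a * p (-c) := by
    intro a c ha hc
    by_cases ha1 : a = 1
    · simp [ha1]
    · simpa using heights a 1 c ha h10 hc ha1
  have q₂ : ∀ a : K, a ≠ 0 → p (-a) = a⁻¹ * κ := by
    intro a ha
    simpa using q₁ a⁻¹ 1 (inv_ne_zero ha) h10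
  have comm : ∀ a b : K, a * b = b * a := by
    intro a b
    by_cases ha : a = 0
    · simp [ha]
    by_cases hb : b = 0
    · simp [hb]
    -- The two evaluations of p(-a⁻¹b⁻¹) are baκ and abκ.
    have h₁ := q₁ a b⁻¹ ha (inv_ne_zero hb)
    rw [q₂ _ (mul_ne_zero (inv_ne_zero ha) (inv_ne_zero hb)), q₂ _ (inv_ne_zero hb), mul_inv_rev,
      inv_inv, inv_inv, ← mul_assoc] at h₁
    exact (mul_right_cancel₀ hκ0 h₁).symm
  refine ⟨comm, κ, hκ0, ?_, hSV, hVV⟩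
  intro n n' s b t c hn hn'
  by_cases hs : s = 0
  · subst hs
    simp only [mul_zero, add_zero, hκ0, iff_false]
    intro h₁
    exact not_parEq hn' hm (perp_l ((h.perp_comm _ _).1 (h.parEq_perp h₁ (parS hn hl')))).symm
  · rw [(hp₁ s hs).2 _ _ _ _ _ hn hn', ← neg_neg s, q₂ _ (neg_ne_zero.2 hs), neg_neg, inv_neg,
      neg_mul, comm _ κ, eq_neg_iff_add_eq_zero]
    constructor
    · intro h₁
      have : (t + κ * s⁻¹) * s = 0 := by rw [h₁, zero_mul]
      rwa [add_mul, mul_assoc, inv_mul_cancel₀ hs, mul_one, add_comm] at this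
    · intro h₁
      have : (κ + t * s) * s⁻¹ = 0 := by rw [h₁, zero_mul]
      rwa [add_mul, mul_assoc t, mul_inv_cancel₀ hs, mul_one, add_comm] at this

/-! ### Charts -/

/-- `l` is the line with equation `a x + b y + c = 0`. -/
def HasEq {F : Type u} [Field F] (x y : M.Pt → F) (l : M.Ln) (a b c : F) : Prop :=
  (a ≠ 0 ∨ b ≠ 0) ∧ ∀ A, M.Inc A l ↔ a * x A + b * y A + c = 0

/-- Affine coordinates on a plane. -/
structure AffineChart {F : Type u} [Field F] (x y : M.Pt → F) : Prop where
  ext : ∀ A B, x A = x B → y A = y B → A = B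
  exists_pt : ∀ a b, ∃ A, x A = a ∧ y A = b
  exists_eq : ∀ l, ∃ a b c, HasEq x y l a b c
  exists_line : ∀ a b c, a ≠ 0 ∨ b ≠ 0 → ∃ l, HasEq x y l a b c
  line_ext : ∀ l m : M.Ln, (∀ A, M.Inc A l ↔ M.Inc A m) → l = m

/-- Affine coordinates with orthogonal axes, the squares of the units having the ratio `κ`. -/
structure OrthogonalChart {F : Type u} [Field F] (κ : F) (x y : M.Pt → F) : Prop
    extends AffineChart x y where
  perp_iff : ∀ {l m a b c a' b' c'}, HasEq x y l a b c → HasEq x y m a' b' c' →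
    (M.Perp l m ↔ a * a' + κ * (b * b') = 0)

theorem IsOrthogonalWu.exists_orthogonalChart (h : M.IsOrthogonalWu)
    (h4 : ∀ A B : M.Pt, A ≠ B → ∃ C D, M.Col A B C ∧ M.Col A B D ∧
      A ≠ C ∧ A ≠ D ∧ B ≠ C ∧ B ≠ D ∧ C ≠ D) :
    ∃ (F : Type u) (_ : Field F) (κ : F) (x y : M.Pt → F), κ ≠ 0 ∧ OrthogonalChart κ x y := by
  obtain ⟨O, -, -, -⟩ := h.three_points
  obtain ⟨l, hl, hll⟩ := h.exists_nonisotropic O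
  -- Because l is not isotropic, its perpendicular through O is a different line, and the two can
  -- serve as axes.
  obtain ⟨m, ⟨hlm, hm⟩, -⟩ := h.perp_through O l
  have hne : l ≠ m := by
    rintro rfl
    exact hll hlm
  obtain ⟨K, _, x, y, hext, hex, hl', hm', form, lineV, line, hle⟩ :=
    h.exists_coordinates h4 hne hl hm
  obtain ⟨comm, κ, hκ, hSS, hSV, hVV⟩ := h.mul_comm_and_perp hex hl' hm' hlm form line
  let _ : Field K := { ‹DivisionRing K› with mul_comm := comm }
  have key : ∀ {l a b c}, HasEq x y l a b c → (b = 0 ∧ a ≠ 0 ∧ ∀ A, M.Inc A l ↔ x A = -c / a) ∨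
      (b ≠ 0 ∧ HasSlope x y l (-a / b) (-c / b)) := by
    rintro l a b c ⟨hab, hA⟩
    by_cases hb : b = 0
    · have ha : a ≠ 0 := hab.resolve_right (not_not.2 hb)
      refine .inl ⟨hb, ha, fun A => ?_⟩
      rw [hA, hb, eq_div_iff ha, eq_neg_iff_add_eq_zero, mul_comm a]
      simp
    · refine .inr ⟨hb, fun A => ?_⟩
      rw [hA]
      constructor
      · intro h₁
        field_simp
        linear_combination h₁
      · intro h₁
        rw [h₁]
        field_simp
        ring
  refine ⟨K, inferInstance, κ, x, y, hκ, ⟨⟨hext, hex, ?_, ?_, hle⟩, ?_⟩⟩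
  · intro l
    rcases form l with ⟨c, hc⟩ | ⟨s, b, hs⟩
    · refine ⟨1, 0, -c, .inl one_ne_zero, fun A => ?_⟩
      rw [hc, one_mul, zero_mul, add_zero, ← sub_eq_add_neg, sub_eq_zero]
    · refine ⟨-s, 1, -b, .inr one_ne_zero, fun A => ?_⟩
      rw [hs]
      constructor
      · intro h₁
        linear_combination h₁
      · intro h₁
        linear_combination h₁
  · intro a b c hab
    by_cases hb : b = 0
    · have ha : a ≠ 0 := hab.resolve_right (not_not.2 hb)
      obtain ⟨n, hn⟩ := lineV (-c / a)
      refine ⟨n, hab, fun A => ?_⟩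
      rw [hn, hb, eq_div_iff ha, eq_neg_iff_add_eq_zero, mul_comm a]
      simp
    · obtain ⟨n, hn⟩ := line (-a / b) (-c / b)
      refine ⟨n, hab, fun A => ?_⟩
      rw [hn]
      constructor
      · intro h₁
        rw [h₁]
        field_simp
        ring
      · intro h₁
        field_simp
        linear_combination h₁
  · intro l m a b c a' b' c' h₁ h₂
    rcases key h₁ with ⟨hb, ha, h₃⟩ | ⟨hb, h₃⟩ <;> rcases key h₂ with ⟨hb', ha', h₄⟩ | ⟨hb', h₄⟩
    · simp [hVV _ _ _ _ h₃ h₄, hb, hb', ha, ha']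
    · rw [h.perp_comm, hSV _ _ _ _ _ h₄ h₃]
      simp [hb, hb', ha]
    · rw [hSV _ _ _ _ _ h₃ h₄]
      simp [hb, hb', ha']
    · rw [hSS _ _ _ _ _ _ h₃ h₄]
      constructor
      · intro h₅
        field_simp at h₅
        linear_combination h₅
      · intro h₅
        field_simp
        linear_combination h₅

end Str

namespace Str

variable {M : Str.{u} planeSig} {F : Type u} [Field F] {x y : M.Pt → F}

/-! ### Computations in charts -/

/-- The determinant of the vectors `AB` and `CD`. -/
def cross (x y : M.Pt → F) (A B C D : M.Pt) : F :=
  (x B - x A) * (y D - y C) - (y B - y A) * (x D - x C)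

namespace AffineChart

variable (h : AffineChart x y)
include h

theorem ne_iff {A B : M.Pt} : A ≠ B ↔ x B - x A ≠ 0 ∨ y B - y A ≠ 0 := by
  rw [← not_iff_not, not_not, not_or, not_not, not_not, sub_eq_zero, sub_eq_zero]
  constructor
  · rintro rfl
    exact ⟨rfl, rfl⟩
  · rintro ⟨h₁, h₂⟩
    exact h.ext _ _ h₁.symm h₂.symm

theorem line_eq {l m : M.Ln} {a b c k : F} (h₁ : HasEq x y l a b c)
    (h₂ : HasEq x y m (k * a) (k * b) (k * c)) : l = m := by
  have hk : k ≠ 0 := by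
    rintro rfl
    have := h₂.1
    simp at this
  refine h.line_ext l m fun A => ?_
  rw [h₁.2, h₂.2, mul_assoc, mul_assoc, ← mul_add, ← mul_add, mul_eq_zero]
  simp [hk]

theorem line_eq' {l m : M.Ln} {a b c : F} (h₁ : HasEq x y l a b c)
    (h₂ : HasEq x y m a b c) : l = m :=
  h.line_ext l m fun A => by rw [h₁.2, h₂.2]

/-- A line given by a point and a normal vector. -/
theorem exists_line_through (A : M.Pt) {a b : F} (hab : a ≠ 0 ∨ b ≠ 0) :
    ∃ l, HasEq x y l a b (-(a * x A + b * y A)) ∧ M.Inc A l := by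
  obtain ⟨l, hl⟩ := h.exists_line a b (-(a * x A + b * y A)) hab
  exact ⟨l, hl, (hl.2 A).2 (by ring)⟩

theorem parEq_iff {l m : M.Ln} {a b c a' b' c' : F} (h₁ : HasEq x y l a b c)
    (h₂ : HasEq x y m a' b' c') : M.ParEq l m ↔ a * b' = a' * b := by
  constructor
  · intro hp
    by_contra hne
    have hd : a * b' - a' * b ≠ 0 := sub_ne_zero.2 hne
    -- Cramer's rule gives the common point (u, v). The lines then coincide, but moving from it by
    -- the direction vector (b, -a) of l leaves m.
    obtain ⟨u, hu⟩ : ∃ u, u * (a * b' - a' * b) = b * c' - b' * c :=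
      ⟨_, div_mul_cancel₀ _ hd⟩
    obtain ⟨v, hv⟩ : ∃ v, v * (a * b' - a' * b) = a' * c - a * c' :=
      ⟨_, div_mul_cancel₀ _ hd⟩
    have h₃ : a * u + b * v + c = 0 := by
      refine mul_right_cancel₀ hd ?_
      linear_combination a * hu + b * hv
    have h₄ : a' * u + b' * v + c' = 0 := by
      refine mul_right_cancel₀ hd ?_
      linear_combination a' * hu + b' * hv
    obtain ⟨A, hA, hA'⟩ := h.exists_pt u v
    obtain rfl := hp.eq ((h₁.2 A).2 (by rw [hA, hA', h₃])) ((h₂.2 A).2 (by rw [hA, hA', h₄]))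
    obtain ⟨B, hB, hB'⟩ := h.exists_pt (u + b) (v - a)
    have := (h₂.2 B).1 ((h₁.2 B).2 (by rw [hB, hB']; linear_combination h₃))
    rw [hB, hB'] at this
    exact hd (by linear_combination h₄ - this)
  · intro he
    by_cases hp : M.Par l m
    · exact .inl hp
    obtain ⟨A, hA, hA'⟩ := not_not.1 hp
    rw [h₁.2] at hA
    rw [h₂.2] at hA'
    obtain ⟨k, hk, hk'⟩ : ∃ k, a' = k * a ∧ b' = k * b := by
      rcases h₁.1 with ha | hb
      · exact ⟨a' / a, by field_simp, by field_simp; linear_combination he⟩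
      · exact ⟨b' / b, by field_simp; linear_combination -he, by field_simp⟩
    have hc : c' = k * c := by
      rw [hk, hk'] at hA'
      linear_combination hA' - k * hA
    subst hk hk' hc
    exact .inr (h.line_eq h₁ h₂)

theorem exists_common {l m : M.Ln} {a b c a' b' c' : F} (h₁ : HasEq x y l a b c)
    (h₂ : HasEq x y m a' b' c') (hd : a * b' ≠ a' * b) : ∃ A, M.Inc A l ∧ M.Inc A m := by
  by_contra hp
  exact hd ((h.parEq_iff h₁ h₂).1 (.inl hp))

/-- The line through two points. -/
theorem hasEq_of_inc {A B : M.Pt} (hAB : A ≠ B) {l : M.Ln} (hA : M.Inc A l) (hB : M.Inc B l) :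
    HasEq x y l (y B - y A) (-(x B - x A)) (x B * y A - x A * y B) := by
  obtain ⟨a, b, c, hl⟩ := h.exists_eq l
  have h₁ := (hl.2 A).1 hA
  have h₂ := (hl.2 B).1 hB
  have h₃ := h.ne_iff.1 hAB
  refine ⟨?_, fun C => ?_⟩
  · rcases h₃ with h₃ | h₃
    · exact .inr (neg_ne_zero.2 h₃)
    · exact .inl h₃
  obtain ⟨k, hk, hk'⟩ : ∃ k, a = k * (y B - y A) ∧ b = k * -(x B - x A) := by
    rcases h₃ with h₃ | h₃
    · exact ⟨-b / (x B - x A), by field_simp; linear_combination h₂ - h₁, by field_simp⟩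
    · exact ⟨a / (y B - y A), by field_simp, by field_simp; linear_combination h₂ - h₁⟩
  have hk0 : k ≠ 0 := by
    rintro rfl
    have := hl.1
    simp [hk, hk'] at this
  rw [hl.2]
  have : a * x C + b * y C + c =
      k * ((y B - y A) * x C + -(x B - x A) * y C + (x B * y A - x A * y B)) := by
    rw [hk, hk'] at h₁ ⊢
    linear_combination h₁
  rw [this, mul_eq_zero]
  simp [hk0]

theorem exists_line_of_ne (A B : M.Pt) : ∃ l, M.Inc A l ∧ M.Inc B l := by
  by_cases hAB : A = B
  · obtain ⟨l, -, hl⟩ := h.exists_line_through A (a := 1) (b := 0) (.inl one_ne_zero)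
    exact ⟨l, hl, hAB ▸ hl⟩
  · obtain ⟨l, hl, hA⟩ := h.exists_line_through A (a := y B - y A) (b := -(x B - x A)) (by
      rcases h.ne_iff.1 hAB with h₁ | h₁
      · exact .inr (neg_ne_zero.2 h₁)
      · exact .inl h₁)
    exact ⟨l, hA, (hl.2 B).2 (by ring)⟩

theorem col_iff {A B C : M.Pt} : M.Col A B C ↔ cross x y A B A C = 0 := by
  by_cases hAB : A = B
  · subst hAB
    obtain ⟨l, h₁, h₂⟩ := h.exists_line_of_ne A C
    exact iff_of_true ⟨l, h₁, h₁, h₂⟩ (by simp [cross])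
  obtain ⟨l, hA, hB⟩ := h.exists_line_of_ne A B
  have hl := h.hasEq_of_inc hAB hA hB
  have : M.Col A B C ↔ M.Inc C l := by
    constructor
    · rintro ⟨m, h₁, h₂, h₃⟩
      rwa [h.line_eq' hl (h.hasEq_of_inc hAB h₁ h₂)]
    · exact fun hC => ⟨l, hA, hB, hC⟩
  rw [this, hl.2, cross, ← neg_eq_zero]
  constructor <;> intro h₁ <;> linear_combination h₁

theorem parPts_iff {A B C D : M.Pt} : M.ParPts A B C D ↔
    A ≠ B ∧ C ≠ D ∧ cross x y A B C D = 0 ∧ cross x y A B A C ≠ 0 := by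
  refine and_congr_right fun hAB => and_congr_right fun hCD => ?_
  obtain ⟨l, hA, hB⟩ := h.exists_line_of_ne A B
  obtain ⟨m, hC, hD⟩ := h.exists_line_of_ne C D
  have hl := h.hasEq_of_inc hAB hA hB
  have hm := h.hasEq_of_inc hCD hC hD
  have hp := h.parEq_iff hl hm
  have hx : cross x y A B C D = 0 ↔ M.ParEq l m := by
    rw [hp, cross]
    constructor <;> intro h₁ <;> linear_combination h₁
  rw [hx, Ne, ← h.col_iff]
  constructor
  · rintro ⟨l', m', h₁, h₂, h₃, h₄, h₅⟩
    obtain rfl := h.line_eq' hl (h.hasEq_of_inc hAB h₁ h₂)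
    obtain rfl := h.line_eq' hm (h.hasEq_of_inc hCD h₃ h₄)
    refine ⟨.inl h₅, ?_⟩
    rintro ⟨k, h₆, h₇, h₈⟩
    obtain rfl := h.line_eq' hl (h.hasEq_of_inc hAB h₆ h₇)
    exact h₅ ⟨C, h₈, hC⟩
  · rintro ⟨h₁, h₂⟩
    refine ⟨l, m, hA, hB, hC, hD, h₁.resolve_right ?_⟩
    rintro rfl
    exact h₂ ⟨l, hA, hB, hC⟩

theorem along_iff {l : M.Ln} {a b c : F} (hl : HasEq x y l a b c) {A B : M.Pt} :
    M.Along l A B ↔ a * (x B - x A) + b * (y B - y A) = 0 := by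
  obtain ⟨k, hk, hA⟩ := h.exists_line_through A hl.1
  have hkl : M.ParEq k l := (h.parEq_iff hk hl).2 rfl
  have : M.Along l A B ↔ M.Inc B k := by
    constructor
    · rintro ⟨k', h₁, h₂, h₃⟩
      obtain ⟨a', b', c', hk'⟩ := h.exists_eq k'
      have h₄ := (h.parEq_iff hk' hl).1 h₃
      have h₅ : M.ParEq k k' := (h.parEq_iff hk hk').2 h₄.symm
      rwa [h₅.eq hA h₁]
    · exact fun hB => ⟨k, hA, hB, hkl⟩
  rw [this, hk.2]
  constructor <;> intro h₁ <;> linear_combination h₁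

/-- The first parallelogram forces D = E + B - A and the second C = D + B - E. The determinant of A,
B, E, nonzero as E is off AB, is what gets cancelled. -/
theorem symPoint_iff {A B C : M.Pt} :
    M.SymPoint A B C ↔ x A + x C = 2 * x B ∧ y A + y C = 2 * y B := by
  by_cases hAB : A = B
  · subst hAB
    constructor
    · rintro (⟨-, rfl⟩ | ⟨h₁, -⟩)
      · exact ⟨by ring, by ring⟩
      · exact absurd rfl h₁
    · rintro ⟨h₁, h₂⟩
      exact .inl ⟨rfl, h.ext _ _ (by linear_combination h₁) (by linear_combination h₂)⟩
  constructor
  · rintro (⟨h₁, -⟩ | ⟨-, h₁, E, D, h₂, h₃, h₄, h₅⟩)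
    · exact absurd h₁ hAB
    rw [h.col_iff] at h₁ h₂
    obtain ⟨-, -, h₆, -⟩ := h.parPts_iff.1 h₃
    obtain ⟨-, -, h₇, -⟩ := h.parPts_iff.1 h₄
    obtain ⟨-, -, h₈, -⟩ := h.parPts_iff.1 h₅
    simp only [cross] at h₁ h₂ h₆ h₇ h₈
    have hD₁ : x D = x E + x B - x A := by
      refine mul_right_cancel₀ h₂ ?_
      linear_combination (x E - x A) * h₆ - (x B - x A) * h₇
    have hD₂ : y D = y E + y B - y A := by
      refine mul_right_cancel₀ h₂ ?_
      linear_combination (y E - y A) * h₆ - (y B - y A) * h₇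
    rw [hD₁, hD₂] at h₈
    constructor
    · refine mul_right_cancel₀ h₂ ?_
      grind
    · refine mul_right_cancel₀ h₂ ?_
      grind
  · rintro ⟨h₁, h₂⟩
    obtain ⟨E, hE⟩ : ∃ E, cross x y A B A E ≠ 0 := by
      rcases h.ne_iff.1 hAB with h₃ | h₃
      · obtain ⟨E, hE, hE'⟩ := h.exists_pt (x A) (y A + 1)
        exact ⟨E, by simpa [cross, hE, hE'] using h₃⟩
      · obtain ⟨E, hE, hE'⟩ := h.exists_pt (x A - 1) (y A)
        exact ⟨E, by simpa [cross, hE, hE'] using h₃⟩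
    obtain ⟨D, hD, hD'⟩ := h.exists_pt (x E + x B - x A) (y E + y B - y A)
    have hC : x C = 2 * x B - x A := by linear_combination h₁
    have hC' : y C = 2 * y B - y A := by linear_combination h₂
    have ne : ∀ {P Q}, (x Q - x P) * (y E - y A) - (y Q - y P) * (x E - x A) ≠ 0 ∨
        (x B - x A) * (y Q - y P) - (y B - y A) * (x Q - x P) ≠ 0 → P ≠ Q := by
      rintro P _ h₁ rfl
      simp at h₁
    refine .inr ⟨hAB, h.col_iff.2 ?_, E, D, mt h.col_iff.1 hE, ?_, ?_, ?_⟩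
    · simp only [cross, hC, hC']
      ring
    all_goals
      simp only [h.parPts_iff, cross, hC, hC', hD, hD'] at hE ⊢
    · exact ⟨hAB, ne (.inl (by rw [hD, hD']; convert hE using 1; ring)), by ring, by
        convert hE using 1⟩
    · exact ⟨ne (.inr hE), ne (.inr (by rw [hD, hD']; convert hE using 1; ring)), by ring, by
        convert neg_ne_zero.2 hE using 1; ring⟩
    · exact ⟨ne (.inl (by convert hE using 1; ring)), ne (.inl (by
        rw [hD, hD', hC, hC']; convert hE using 1; ring)), by ring, by
        convert hE using 1; ring⟩

/-- N' is the midpoint of A and B', and the parallel to B'B through the midpoint of one side of the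
triangle AB'B bisects the side AB. -/
theorem midpoint_iff (h2 : (2 : F) ≠ 0) {A B N : M.Pt} :
    M.Midpoint A B N ↔ 2 * x N = x A + x B ∧ 2 * y N = y A + y B := by
  by_cases hAB : A = B
  · subst hAB
    constructor
    · rintro (⟨-, rfl⟩ | ⟨h₁, -⟩)
      · exact ⟨by ring, by ring⟩
      · exact absurd rfl h₁
    · rintro ⟨h₁, h₂⟩
      exact .inl ⟨rfl, h.ext _ _ (mul_left_cancel₀ h2 (by linear_combination h₁))
        (mul_left_cancel₀ h2 (by linear_combination h₂))⟩
  constructor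
  · rintro (⟨h₁, -⟩ | ⟨-, h₁, N', B', h₂, h₃, h₄⟩)
    · exact absurd h₁ hAB
    rw [h.col_iff] at h₁ h₂
    obtain ⟨h₅, h₆⟩ := h.symPoint_iff.1 h₃
    obtain ⟨-, -, h₇, -⟩ := h.parPts_iff.1 h₄
    have hB₁ : x B' = 2 * x N' - x A := by linear_combination h₅
    have hB₂ : y B' = 2 * y N' - y A := by linear_combination h₆
    simp only [cross, hB₁, hB₂] at h₁ h₂ h₇
    constructor
    · refine mul_right_cancel₀ h₂ ?_
      grind
    · refine mul_right_cancel₀ h₂ ?_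
      grind
  · rintro ⟨h₁, h₂⟩
    obtain ⟨E, hE⟩ : ∃ E, cross x y A B A E ≠ 0 := by
      rcases h.ne_iff.1 hAB with h₃ | h₃
      · obtain ⟨E, hE, hE'⟩ := h.exists_pt (x A) (y A + 1)
        exact ⟨E, by simpa [cross, hE, hE'] using h₃⟩
      · obtain ⟨E, hE, hE'⟩ := h.exists_pt (x A - 1) (y A)
        exact ⟨E, by simpa [cross, hE, hE'] using h₃⟩
    obtain ⟨D, hD, hD'⟩ := h.exists_pt (2 * x E - x A) (2 * y E - y A)
    have hB : x B = 2 * x N - x A := by linear_combination -h₁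
    have hB' : y B = 2 * y N - y A := by linear_combination -h₂
    have ne : ∀ {P Q}, (x B - x A) * (y Q - y P) - (y B - y A) * (x Q - x P) ≠ 0 → P ≠ Q := by
      rintro P _ h₁ rfl
      simp at h₁
    refine .inr ⟨hAB, h.col_iff.2 ?_, E, D, mt h.col_iff.1 hE, h.symPoint_iff.2 ?_,
      h.parPts_iff.2 ?_⟩
    · simp only [cross, hB, hB']
      ring
    · rw [hD, hD']
      exact ⟨by ring, by ring⟩
    simp only [cross, hD, hD'] at hE ⊢
    rw [hB, hB'] at hE
    refine ⟨ne ?_, ne ?_, ?_, ?_⟩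
    · rw [hB, hB']
      convert neg_ne_zero.2 hE using 1
      ring
    · rw [hD, hD', hB, hB']
      convert mul_ne_zero h2 (neg_ne_zero.2 hE) using 1
      ring
    · rw [hB, hB']
      ring
    · refine fun h₃ => hE ?_
      linear_combination 2 * h₃

end AffineChart

/-! ### Perpendicular bisectors and symmetric points by distances -/

namespace OrthogonalChart

variable {κ : F} (h : OrthogonalChart κ x y)
include h

/-- The perpendicular bisector is the set of equidistant points. -/
theorem perpBisector_iff (hκ : κ ≠ 0) (h2 : (2 : F) ≠ 0) {A B : M.Pt} {l : M.Ln} :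
    M.PerpBisector A B l ↔ A ≠ B ∧ ∀ P, M.Inc P l ↔
      κ * (x P - x A) ^ 2 + (y P - y A) ^ 2 = κ * (x P - x B) ^ 2 + (y P - y B) ^ 2 := by
  refine and_congr_right fun hAB => ?_
  have hne := h.ne_iff.1 hAB
  have hab : κ * (x B - x A) ≠ 0 ∨ y B - y A ≠ 0 := by simpa [hκ] using hne
  obtain ⟨N, hN, hN'⟩ := h.exists_pt ((x A + x B) / 2) ((y A + y B) / 2)
  have hN₁ : 2 * x N = x A + x B := by rw [hN]; field_simp
  have hN₂ : 2 * y N = y A + y B := by rw [hN']; field_simp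
  -- The normal (κ(x B - x A), y B - y A) is both the one orthogonal to AB for the form aa' + κbb'
  -- and, up to the factor 2, the one left when the quadratic terms of the equation of equal
  -- distances cancel.
  obtain ⟨m, hm, hNm⟩ := h.exists_line_through N hab
  have hm' : ∀ P, M.Inc P m ↔
      κ * (x P - x A) ^ 2 + (y P - y A) ^ 2 = κ * (x P - x B) ^ 2 + (y P - y B) ^ 2 := by
    intro P
    rw [hm.2]
    constructor
    · intro h₁
      linear_combination 2 * h₁ + κ * (x B - x A) * hN₁ + (y B - y A) * hN₂
    · intro h₁
      refine mul_left_cancel₀ h2 ?_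
      linear_combination h₁ - κ * (x B - x A) * hN₁ - (y B - y A) * hN₂
  obtain ⟨n, hA, hB⟩ := h.exists_line_of_ne A B
  have hn := h.hasEq_of_inc hAB hA hB
  have hmn : M.Perp m n := (h.perp_iff hm hn).2 (by ring)
  constructor
  · rintro ⟨N', n', h₁, h₂, h₃, h₄, h₅⟩
    rw [h.midpoint_iff h2] at h₁
    obtain rfl : N = N' := h.ext _ _ (mul_left_cancel₀ h2 (hN₁.trans h₁.1.symm))
      (mul_left_cancel₀ h2 (hN₂.trans h₁.2.symm))
    obtain rfl := h.line_eq' hn (h.hasEq_of_inc hAB h₂ h₃)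
    obtain ⟨a, b, c, hl⟩ := h.exists_eq l
    have h₆ := (h.perp_iff hl hn).1 h₅
    have h₇ : M.ParEq l m := (h.parEq_iff hl hm).2 (by linear_combination h₆)
    obtain rfl := h₇.eq h₄ hNm
    exact hm'
  · intro h₁
    obtain rfl : l = m := h.line_ext _ _ fun P => (h₁ P).trans (hm' P).symm
    exact ⟨N, n, (h.midpoint_iff h2).2 ⟨hN₁, hN₂⟩, hA, hB, hNm, hmn⟩

theorem dist_eq_of_sym (hκ : κ ≠ 0) (h2 : (2 : F) ≠ 0) {A B P : M.Pt} {l : M.Ln}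
    (hs : M.Sym A l B) (hP : M.Inc P l) :
    κ * (x P - x A) ^ 2 + (y P - y A) ^ 2 = κ * (x P - x B) ^ 2 + (y P - y B) ^ 2 := by
  rcases hs with hs | ⟨rfl, -⟩
  · exact (((h.perpBisector_iff hκ h2).1 hs).2 P).1 hP
  · rfl

/-- The symmetry axis of two points. -/
theorem exists_sym (hκ : κ ≠ 0) (h2 : (2 : F) ≠ 0) {A B P : M.Pt}
    (hP : κ * (x P - x A) ^ 2 + (y P - y A) ^ 2 = κ * (x P - x B) ^ 2 + (y P - y B) ^ 2) :
    ∃ l, M.Inc P l ∧ M.Sym A l B := by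
  by_cases hAB : A = B
  · subst hAB
    obtain ⟨l, h₁, h₂⟩ := h.exists_line_of_ne A P
    exact ⟨l, h₂, .inr ⟨rfl, h₁⟩⟩
  have hab : κ * (x B - x A) ≠ 0 ∨ y B - y A ≠ 0 := by simpa [hκ] using h.ne_iff.1 hAB
  obtain ⟨l, hl, hPl⟩ := h.exists_line_through P hab
  refine ⟨l, hPl, .inl ((h.perpBisector_iff hκ h2).2 ⟨hAB, fun Q => ?_⟩)⟩
  rw [hl.2]
  constructor
  · intro h₁
    linear_combination 2 * h₁ + hP
  · intro h₁
    refine mul_left_cancel₀ h2 ?_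
    linear_combination h₁ - hP

end OrthogonalChart

end Str

namespace Str

variable {M : Str.{u} planeSig} {F : Type u} [Field F] {x y : M.Pt → F}

/-! ### The metric axioms in coordinates -/

/-- On the line y = 0, with B = (0, 1) and C = (1, 1), the points of the axiom of infinity are (n,
0). In characteristic two the points for n = 0 and n = 2 would coincide. -/
theorem AffineChart.two_ne_zero (h : AffineChart x y) (hM : M.IsDesarguesian) : (2 : F) ≠ 0 := by
  intro h2
  obtain ⟨l, hl⟩ := h.exists_line 0 1 0 (.inr one_ne_zero)
  obtain ⟨B, hB, hB'⟩ := h.exists_pt 0 1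
  obtain ⟨C, hC, hC'⟩ := h.exists_pt 1 1
  have ha : ∀ n : ℕ, ∃ A, x A = n ∧ y A = 0 := fun n => h.exists_pt _ _
  choose a ha ha' using ha
  have inj := hM.infinite l B C a
    (h.parPts_iff.2 ⟨h.ne_iff.2 (by simp [hB, hC]), h.ne_iff.2 (by simp [ha]),
      by simp [cross, hB, hB', hC, hC', ha, ha'], by simp [cross, hB, hB', hC, hC', ha, ha']⟩)
    (fun n => (hl.2 _).2 (by simp [ha']))
    (fun n => h.parPts_iff.2 ⟨h.ne_iff.2 (by simp [hB', ha']), h.ne_iff.2 (by simp [hC', ha']),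
      by simp [cross, hB, hB', hC, hC', ha, ha'],
      by
        simp only [cross, hB, hB', hC, hC', ha, ha']
        intro h₁
        exact one_ne_zero (α := F) (by linear_combination -h₁)⟩)
  have : a 2 = a 0 := h.ext _ _ (by simp [ha, h2]) (by simp [ha'])
  exact absurd (inj this) (by decide)

/-- The symmetric axis of the lines spanned by the two vectors passes through the origin and carries
the first vector to a multiple of the second. Points of the axis are equidistant from symmetric
points, so the two norms differ by the square of that multiplier. -/
theorem IsMetricWu.exists_norm_ratio (hM : M.IsMetricWu) {κ : F} (h : OrthogonalChart κ x y)
    (hκ : κ ≠ 0) {u₁ u₂ v₁ v₂ : F} (hu : κ * u₁ ^ 2 + u₂ ^ 2 ≠ 0) (hv : κ * v₁ ^ 2 + v₂ ^ 2 ≠ 0)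
    (huv : u₁ * v₂ - u₂ * v₁ ≠ 0) :
    ∃ s, κ * u₁ ^ 2 + u₂ ^ 2 = s ^ 2 * (κ * v₁ ^ 2 + v₂ ^ 2) := by
  have h2 := h.two_ne_zero hM.toIsDesarguesian
  obtain ⟨O, hO, hO'⟩ := h.exists_pt 0 0
  obtain ⟨U, hU, hU'⟩ := h.exists_pt u₁ u₂
  have line : ∀ {u₁ u₂ : F}, κ * u₁ ^ 2 + u₂ ^ 2 ≠ 0 → ∃ l, HasEq x y l u₂ (-u₁) 0 ∧
      M.Inc O l ∧ ¬ M.Perp l l := by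
    intro u₁ u₂ hu
    obtain ⟨l, hl⟩ := h.exists_line u₂ (-u₁) 0 (by
      by_contra! h₁
      simp [h₁.1, neg_eq_zero.1 h₁.2] at hu)
    refine ⟨l, hl, (hl.2 O).2 (by simp [hO, hO']), ?_⟩
    rw [h.perp_iff hl hl]
    intro h₁
    exact hu (by linear_combination h₁)
  obtain ⟨l, hl, hOl, hll⟩ := line hu
  obtain ⟨m, hm, hOm, hmm⟩ := line hv
  have hUl : M.Inc U l := (hl.2 U).2 (by rw [hU, hU']; ring)
  have hUm : ¬ M.Inc U m := by
    rw [hm.2, hU, hU']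
    intro h₁
    exact huv (by linear_combination h₁)
  obtain ⟨k, -, hk⟩ := hM.symAxis l m ⟨O, hOl, hOm⟩ hll hmm
  obtain ⟨B₀, hB₀, hs₀⟩ := hk O hOl
  obtain ⟨B, hB, hs⟩ := hk U hUl
  -- Otherwise O has a different image on m, so m is orthogonal to k. The line from U to its image B
  -- is orthogonal to k as well, hence parallel or equal to m; it contains B on m, so it is m,
  -- although U is off m.
  have hOk : M.Inc O k := by
    rcases hs₀ with ⟨hne₀, -, n₀, -, h₁, h₂, -, h₃⟩ | ⟨-, h₁⟩
    swap
    · exact h₁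
    rcases hs with ⟨hne, -, n, -, h₄, h₅, -, h₆⟩ | ⟨rfl, -⟩
    swap
    · exact absurd hB hUm
    have h₇ : M.ParEq n₀ n := hM.perp_perp _ _ _ h₃ h₆
    obtain rfl := hM.line_unique hne₀ h₁ h₂ hOm hB₀
    obtain rfl := h₇.eq hB h₅
    exact absurd h₄ hUm
  have hd := h.dist_eq_of_sym hκ h2 hs hOk
  simp only [hO, hO', hU, hU', zero_sub, neg_sq] at hd
  have hB' := (hm.2 B).1 hB
  by_cases hv₁ : v₁ = 0
  · have hv₂ : v₂ ≠ 0 := by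
      rintro rfl
      simp [hv₁] at huv
    refine ⟨y B / v₂, ?_⟩
    have hx : x B = 0 := by
      refine mul_left_cancel₀ hv₂ ?_
      linear_combination hB' + y B * hv₁
    rw [hd, hx, hv₁]
    field_simp
    ring
  · refine ⟨x B / v₁, ?_⟩
    have hy : y B = v₂ * x B / v₁ := by
      field_simp
      linear_combination -hB'
    rw [hd, hy]
    field_simp

/-- The unit vectors of the axes have norms κ and 1, so κ is a square s², and measuring the first
coordinate in units 1/s turns κ into 1. -/
theorem IsMetricWu.exists_rectangularChart (hM : M.IsMetricWu)
    (h4 : ∀ A B : M.Pt, A ≠ B → ∃ C D, M.Col A B C ∧ M.Col A B D ∧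
      A ≠ C ∧ A ≠ D ∧ B ≠ C ∧ B ≠ D ∧ C ≠ D) :
    ∃ (F : Type u) (_ : Field F) (x y : M.Pt → F), OrthogonalChart 1 x y := by
  obtain ⟨F, _, κ, x, y, hκ, h⟩ := hM.exists_orthogonalChart h4
  obtain ⟨s, hs⟩ := hM.exists_norm_ratio h hκ (u₁ := 1) (u₂ := 0) (v₁ := 0) (v₂ := 1)
    (by simpa using hκ) (by simp) (by simp)
  have hs' : κ = s ^ 2 := by linear_combination hs
  have hs0 : s ≠ 0 := by
    rintro rfl
    simp [hs'] at hκ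
  have conv : ∀ {l a b c}, HasEq (fun A => s * x A) y l a b c ↔ HasEq x y l (a * s) b c := by
    intro l a b c
    simp only [HasEq, mul_assoc, ne_eq, mul_eq_zero, hs0, or_false]
  refine ⟨F, inferInstance, fun A => s * x A, y, ⟨⟨?_, ?_, ?_, ?_, h.line_ext⟩, ?_⟩⟩
  · intro A B h₁ h₂
    exact h.ext A B (mul_left_cancel₀ hs0 h₁) h₂
  · intro a b
    obtain ⟨A, hA, hA'⟩ := h.exists_pt (a / s) b
    exact ⟨A, by rw [hA]; field_simp, hA'⟩
  · intro l
    obtain ⟨a, b, c, hl⟩ := h.exists_eq l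
    exact ⟨a / s, b, c, conv.2 (by rwa [div_mul_cancel₀ _ hs0])⟩
  · intro a b c hab
    obtain ⟨l, hl⟩ := h.exists_line (a * s) b c (by simpa [hs0] using hab)
    exact ⟨l, conv.2 hl⟩
  · intro l m a b c a' b' c' h₁ h₂
    rw [h.perp_iff (conv.1 h₁) (conv.1 h₂), hs']
    constructor
    · intro h₃
      refine mul_left_cancel₀ (pow_ne_zero 2 hs0) ?_
      linear_combination h₃
    · intro h₃
      linear_combination s ^ 2 * h₃

/-- The norm of (u, v) is a square times the norm of (0, 1). -/
theorem IsMetricWu.pythagorean (hM : M.IsMetricWu) (h : OrthogonalChart 1 x y) (u v : F) :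
    ∃ z, u ^ 2 + v ^ 2 = z ^ 2 := by
  by_cases hu : u = 0
  · exact ⟨v, by simp [hu]⟩
  by_cases huv : u ^ 2 + v ^ 2 = 0
  · exact ⟨0, by simp [huv]⟩
  obtain ⟨s, hs⟩ := hM.exists_norm_ratio h one_ne_zero (u₁ := u) (u₂ := v) (v₁ := 0) (v₂ := 1)
    (by simpa using huv) (by simp) (by simpa using hu)
  exact ⟨s, by linear_combination hs⟩

/-! ### The ordering in coordinates -/

/-- `B = A + t (C - A)`. -/
def IsRatio (x y : M.Pt → F) (t : F) (A B C : M.Pt) : Prop :=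
  x B = x A + t * (x C - x A) ∧ y B = y A + t * (y C - y A)

/-- The points that divide a segment in the ratio `t` lie between its end points. -/
def IsInner (x y : M.Pt → F) (t : F) : Prop :=
  ∀ A B C, A ≠ C → IsRatio x y t A B C → M.Be A B C

/-- The positive scalars: the origin does not separate `t` and `1`. -/
def IsPos (x y : M.Pt → F) (t : F) : Prop := t ≠ 0 ∧ ¬ IsInner x y (t / (t - 1))

theorem IsRatio.symm {t : F} {A B C : M.Pt} (h : IsRatio x y t A B C) :
    IsRatio x y (1 - t) C B A :=
  ⟨by linear_combination h.1, by linear_combination h.2⟩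

theorem AffineChart.exists_ratio (h : AffineChart x y) {A B C : M.Pt} (hAC : A ≠ C)
    (hcol : M.Col A B C) : ∃ t, IsRatio x y t A B C := by
  rw [h.col_iff, cross] at hcol
  rcases h.ne_iff.1 hAC with h₁ | h₁
  · refine ⟨(x B - x A) / (x C - x A), ?_, ?_⟩
    · field_simp
      ring
    · field_simp
      linear_combination -hcol
  · refine ⟨(y B - y A) / (y C - y A), ?_, ?_⟩
    · field_simp
      linear_combination hcol
    · field_simp
      ring

theorem AffineChart.exists_point_ratio (h : AffineChart x y) (t : F) (A C : M.Pt) :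
    ∃ B, IsRatio x y t A B C :=
  h.exists_pt _ _

/-! ### From Pasch's axiom to an ordering of the scalars -/

section Order

variable (hM : M.IsOrderedMetricWu) (h : AffineChart x y)
include hM h

/-- Pasch's axiom is applied to the triangle A, C, X and the parallel to CX through B. This parallel
cannot meet CX, so it meets AX between A and X, and there it divides in the same ratio t. -/
theorem IsOrderedMetricWu.be_of_noncollinear {t : F} {A B C X B' : M.Pt}
    (hn : ¬ M.Col A C X) (hB : IsRatio x y t A B C) (hB' : IsRatio x y t A B' X)
    (hbe : M.Be A B C) : M.Be A B' X := by
  obtain ⟨hAB, hAC, hBC, -⟩ := hM.be_distinct_col _ _ _ hbe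
  have hn' := mt h.col_iff.2 hn
  simp only [cross] at hn'
  have ht0 : t ≠ 0 := by
    rintro rfl
    exact hAB (h.ext _ _ (by simp [hB.1]) (by simp [hB.2]))
  have ht1 : 1 - t ≠ 0 := by
    intro ht
    exact hBC (h.ext _ _ (by linear_combination hB.1 - (x C - x A) * ht)
      (by linear_combination hB.2 - (y C - y A) * ht))
  have hCX : C ≠ X := by
    rintro rfl
    exact hn' (by ring)
  have hAX : A ≠ X := by
    rintro rfl
    exact hn' (by ring)
  obtain ⟨m, hm, -⟩ := h.exists_line_through B (a := y X - y C) (b := -(x X - x C)) (by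
    rcases h.ne_iff.1 hCX with h₁ | h₁
    · exact .inr (neg_ne_zero.2 h₁)
    · exact .inl h₁)
  obtain ⟨hB₁, hB₂⟩ := hB
  have key : ∀ P, M.Inc P m ↔ (y X - y C) * (x P - x B) - (x X - x C) * (y P - y B) = 0 := by
    intro P
    rw [hm.2]
    constructor <;> intro h₁ <;> linear_combination h₁
  have hCm : ¬ M.Inc C m := by
    rw [key, hB₁, hB₂]
    intro h₁
    exact mul_ne_zero ht1 hn' (by linear_combination h₁)
  obtain ⟨D, hD, hD'⟩ := hM.pasch A C X m hn
    (by
      rw [key, hB₁, hB₂]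
      intro h₁
      exact mul_ne_zero ht0 hn' (by linear_combination -h₁))
    hCm
    (by
      rw [key] at hCm ⊢
      intro h₁
      exact hCm (by linear_combination h₁))
    B ((key B).2 (by ring)) hbe
  rcases hD' with h₁ | h₁
  · obtain ⟨-, -, -, hcol⟩ := hM.be_distinct_col _ _ _ h₁
    obtain ⟨w, hw₁, hw₂⟩ := h.exists_ratio hAX hcol
    have hwt : w - t = 0 := by
      have := (key D).1 hD
      rw [hB₁, hB₂, hw₁, hw₂] at this
      refine (mul_eq_zero.1 (?_ : (w - t) * _ = 0)).resolve_right hn'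
      linear_combination this
    obtain rfl : D = B' := h.ext _ _
      (by rw [hw₁, hB'.1]; linear_combination (x X - x A) * hwt)
      (by rw [hw₂, hB'.2]; linear_combination (y X - y A) * hwt)
    exact h₁
  · obtain ⟨-, -, -, hcol⟩ := hM.be_distinct_col _ _ _ h₁
    obtain ⟨w, hw₁, hw₂⟩ := h.exists_ratio hCX hcol
    refine absurd ((key C).2 ?_) hCm
    have := (key D).1 hD
    rw [hw₁, hw₂] at this
    linear_combination this

/-- Betweenness at a given ratio survives a change of the far end point, directly off the line and
through an auxiliary point Y on it. By symmetry it also survives a change of the near end point.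
Three such changes, passing through a point P different from A and A', connect any two segments. -/
theorem IsOrderedMetricWu.isInner_of_be {t : F} {A B C : M.Pt} (hB : IsRatio x y t A B C)
    (hbe : M.Be A B C) : IsInner x y t := by
  have same : ∀ {t A B C C' B'}, A ≠ C' → IsRatio x y t A B C → IsRatio x y t A B' C' →
      M.Be A B C → M.Be A B' C' := by
    intro t A B C C' B' hAC' hB hB' hbe
    by_cases hn : M.Col A C C'
    · have hAC := (hM.be_distinct_col _ _ _ hbe).2.1
      obtain ⟨Y, hY⟩ : ∃ Y, cross x y A C A Y ≠ 0 := by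
        rcases h.ne_iff.1 hAC with h₃ | h₃
        · obtain ⟨E, hE, hE'⟩ := h.exists_pt (x A) (y A + 1)
          exact ⟨E, by simpa [cross, hE, hE'] using h₃⟩
        · obtain ⟨E, hE, hE'⟩ := h.exists_pt (x A - 1) (y A)
          exact ⟨E, by simpa [cross, hE, hE'] using h₃⟩
      have hY' := mt h.col_iff.1 hY
      obtain ⟨Z, hZ⟩ := h.exists_point_ratio t A Y
      refine hM.be_of_noncollinear h ?_ hZ hB' (hM.be_of_noncollinear h hY' hB hZ hbe)
      rintro ⟨l, h₁, h₂, h₃⟩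
      obtain ⟨l', h₄, h₅, h₆⟩ := hn
      obtain rfl := hM.line_unique hAC' h₁ h₃ h₄ h₆
      exact hY' ⟨l, h₁, h₅, h₂⟩
    · exact hM.be_of_noncollinear h hn hB hB' hbe
  have flip : ∀ {t A B C A' B'}, A' ≠ C → IsRatio x y t A B C → IsRatio x y t A' B' C →
      M.Be A B C → M.Be A' B' C := fun hA hB hB' hbe =>
    hM.be_symm _ _ _ (same hA.symm hB.symm hB'.symm (hM.be_symm _ _ _ hbe))
  intro A' B' C' hAC' hB'
  obtain ⟨P, hP⟩ : ∃ P, P ≠ A ∧ P ≠ A' := by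
    obtain ⟨X, Y, Z, hXY, hXZ, hYZ, -⟩ := hM.three_points
    by_contra! h₁
    by_cases h₂ : X = A
    · exact hYZ ((h₁ Y (h₂ ▸ hXY.symm)).trans (h₁ Z (h₂ ▸ hXZ.symm)).symm)
    by_cases h₃ : Y = A
    · exact hXZ ((h₁ X h₂).trans (h₁ Z (h₃ ▸ hYZ.symm)).symm)
    · exact hXY ((h₁ X h₂).trans (h₁ Y h₃).symm)
  obtain ⟨Q, hQ⟩ := h.exists_point_ratio t A P
  obtain ⟨Q', hQ'⟩ := h.exists_point_ratio t A' P
  exact same hAC' hQ' hB' (flip hP.2.symm hQ hQ' (same hP.1.symm hB hQ hbe))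

theorem IsOrderedMetricWu.be_iff_isInner {A B C : M.Pt} :
    M.Be A B C ↔ A ≠ C ∧ ∃ t, IsInner x y t ∧ IsRatio x y t A B C := by
  constructor
  · intro hbe
    obtain ⟨-, hAC, -, hcol⟩ := hM.be_distinct_col _ _ _ hbe
    obtain ⟨t, ht⟩ := h.exists_ratio hAC hcol
    exact ⟨hAC, t, hM.isInner_of_be h ht hbe, ht⟩
  · rintro ⟨hAC, t, ht, hB⟩
    exact ht A B C hAC hB

/-- For the points 0, t and 1 of an axis, the three possible middle points divide the outer two in
the ratios t/(t - 1), t and t⁻¹. -/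
theorem IsOrderedMetricWu.isInner_trichotomy {t : F} (ht0 : t ≠ 0) (ht1 : t ≠ 1) :
    (IsInner x y t ∨ IsInner x y (t / (t - 1)) ∨ IsInner x y t⁻¹) ∧
      ¬ (IsInner x y t ∧ IsInner x y (t / (t - 1))) ∧ ¬ (IsInner x y t ∧ IsInner x y t⁻¹) := by
  have ht1' : t - 1 ≠ 0 := sub_ne_zero.2 ht1
  obtain ⟨O, hO, hO'⟩ := h.exists_pt 0 0
  obtain ⟨T, hT, hT'⟩ := h.exists_pt t 0
  obtain ⟨I, hI, hI'⟩ := h.exists_pt 1 0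
  have hOT : O ≠ T := h.ne_iff.2 (.inl (by simpa [hO, hT] using ht0))
  have hOI : O ≠ I := h.ne_iff.2 (.inl (by simp [hO, hI]))
  have hTI : T ≠ I := h.ne_iff.2 (.inl (by rw [hT, hI]; exact sub_ne_zero.2 ht1.symm))
  have h₁ : M.Be O T I ↔ IsInner x y t := by
    have hr : IsRatio x y t O T I := by simp [IsRatio, *]
    exact ⟨hM.isInner_of_be h hr, fun hi => hi _ _ _ hOI hr⟩
  have h₂ : M.Be T O I ↔ IsInner x y (t / (t - 1)) := by
    have hr : IsRatio x y (t / (t - 1)) T O I := by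
      simp only [IsRatio, *]
      constructor
      · field_simp
        ring
      · ring
    exact ⟨hM.isInner_of_be h hr, fun hi => hi _ _ _ hTI hr⟩
  have h₃ : M.Be O I T ↔ IsInner x y t⁻¹ := by
    have hr : IsRatio x y t⁻¹ O I T := by simp [IsRatio, *]
    exact ⟨hM.isInner_of_be h hr, fun hi => hi _ _ _ hOT hr⟩
  have := hM.be_trichotomy O T I hOT hOI hTI (h.col_iff.2 (by simp [cross, hO', hT', hI']))
  rw [h₁, h₂, h₃] at this
  exact ⟨this.1, this.2.1, this.2.2.1⟩

theorem IsOrderedMetricWu.ne_of_isInner {t : F} (ht : IsInner x y t) : t ≠ 0 ∧ t ≠ 1 := by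
  obtain ⟨O, hO, hO'⟩ := h.exists_pt 0 0
  obtain ⟨I, hI, hI'⟩ := h.exists_pt 1 0
  have hOI : O ≠ I := h.ne_iff.2 (.inl (by simp [hO, hI]))
  constructor
  · rintro rfl
    exact (hM.be_distinct_col _ _ _ (ht O O I hOI (by simp [IsRatio]))).1 rfl
  · rintro rfl
    exact (hM.be_distinct_col _ _ _ (ht O I I hOI (by simp [IsRatio]))).2.2.1 rfl

omit h in
theorem IsOrderedMetricWu.isInner_symm {t : F} (ht : IsInner x y t) : IsInner x y (1 - t) :=
  fun A B C hAC hB => hM.be_symm _ _ _ (ht C B A hAC.symm (by simpa using hB.symm))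

theorem IsOrderedMetricWu.isPos_one : IsPos x y (1 : F) :=
  -- At t = 1 the quotient t/(t - 1) has the default value 0, which is not an inner ratio.
  ⟨one_ne_zero, fun h₁ => (hM.ne_of_isInner h h₁).1 (by simp)⟩

/-- If a/b were not positive, the origin would lie between (0, a) and (0, b). By Pasch, the line y =
0 would separate one of them from (1, 1), at the ratio a/(a - 1) or b/(b - 1), which positivity of a
and b excludes. -/
theorem IsOrderedMetricWu.isPos_div {a b : F} (ha : IsPos x y a) (hb : IsPos x y b) :
    IsPos x y (a / b) := by
  have ha0 := ha.1
  have hb0 := hb.1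
  refine ⟨div_ne_zero ha0 hb0, fun hi => ?_⟩
  have hab : a ≠ b := by
    rintro rfl
    exact (hM.ne_of_isInner h hi).1 (by simp [ha0])
  have hab' : a - b ≠ 0 := sub_ne_zero.2 hab
  obtain ⟨A, hA, hA'⟩ := h.exists_pt 0 a
  obtain ⟨B, hB, hB'⟩ := h.exists_pt 0 b
  obtain ⟨C, hC, hC'⟩ := h.exists_pt 1 1
  obtain ⟨O, hO, hO'⟩ := h.exists_pt 0 0
  obtain ⟨l, hl⟩ := h.exists_line 0 1 0 (.inr one_ne_zero)
  have hl' : ∀ P, M.Inc P l ↔ y P = 0 := fun P => by simpa using hl.2 P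
  have hcol : ¬ M.Col A B C := by
    rw [h.col_iff]
    simp only [cross, hA, hA', hB, hB', hC, hC']
    intro h₁
    exact hab' (by linear_combination h₁)
  have hbe : M.Be A O B := by
    refine hi _ _ _ (h.ne_iff.2 (.inr (by rw [hA', hB']; exact sub_ne_zero.2 hab.symm))) ?_
    simp only [IsRatio, *]
    constructor
    · ring
    · have : a / b / (a / b - 1) = a / (a - b) := by
        have h₁ : a / b - 1 ≠ 0 := by
          rw [sub_ne_zero, Ne, div_eq_one_iff_eq hb0]
          exact hab
        field_simp
      rw [this]
      field_simp
      ring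
  have key : ∀ {a A D}, IsPos x y a → y A = a → y D = 0 → ¬ M.Be A D C := by
    intro a A D ha hA hD hbe
    obtain ⟨-, t, ht, -, hr⟩ := (hM.be_iff_isInner h).1 hbe
    rw [hD, hA, hC'] at hr
    have ha1 : a - 1 ≠ 0 := by
      intro h₁
      have : a = 1 := sub_eq_zero.1 h₁
      simp [this] at hr
    refine ha.2 ?_
    rwa [(eq_div_iff ha1).2 (by linear_combination hr : t * (a - 1) = a)] at ht
  obtain ⟨D, hD, hD'⟩ := hM.pasch A B C l hcol (by simpa [hl', hA'] using ha0)
    (by simpa [hl', hB'] using hb0) (by simp [hl', hC']) O ((hl' O).2 hO') hbe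
  rcases hD' with h₁ | h₁
  · exact key ha hA' ((hl' D).1 hD) h₁
  · exact key hb hB' ((hl' D).1 hD) h₁

theorem IsOrderedMetricWu.isPos_mul {a b : F} (ha : IsPos x y a) (hb : IsPos x y b) :
    IsPos x y (a * b) := by
  simpa using hM.isPos_div h ha (hM.isPos_div h (hM.isPos_one h) hb)

theorem IsOrderedMetricWu.isPos_inv {a : F} (ha : IsPos x y a) : IsPos x y a⁻¹ := by
  simpa using hM.isPos_div h (hM.isPos_one h) ha

/-- At t = -1 the ratios t and t⁻¹ agree, so neither can be inner, and only t/(t - 1) remains. -/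
theorem IsOrderedMetricWu.not_isPos_neg_one : ¬ IsPos x y (-1 : F) := by
  have h2 := h.two_ne_zero hM.toIsDesarguesian
  have hne : (-1 : F) ≠ 1 := fun h₁ => h2 (by linear_combination -h₁)
  obtain ⟨h₁, -, h₂⟩ := hM.isInner_trichotomy h (neg_ne_zero.2 one_ne_zero) hne
  rw [inv_neg, inv_one] at h₁ h₂
  intro h₃
  have := h₃.2
  tauto

theorem IsOrderedMetricWu.isInner_iff {t : F} :
    IsInner x y t ↔ IsPos x y t ∧ IsPos x y (1 - t) := by
  have key : ∀ {t}, IsInner x y t → IsPos x y t := by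
    intro t ht
    obtain ⟨h0, h1⟩ := hM.ne_of_isInner h ht
    exact ⟨h0, fun h₁ => (hM.isInner_trichotomy h h0 h1).2.1 ⟨ht, h₁⟩⟩
  constructor
  · exact fun ht => ⟨key ht, key (hM.isInner_symm ht)⟩
  · rintro ⟨h₁, h₂⟩
    have h0 := h₁.1
    have h1 : t ≠ 1 := fun h₃ => h₂.1 (by rw [h₃, sub_self])
    rcases (hM.isInner_trichotomy h h0 h1).1 with h₃ | h₃ | h₃
    · exact h₃
    · exact absurd h₃ h₁.2
    -- Here 1 - t⁻¹ is positive, and (1 - t⁻¹)t/(1 - t) = -1 would be positive too.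
    · have h₄ := key (hM.isInner_symm h₃)
      have h₅ := hM.isPos_div h (hM.isPos_mul h h₄ h₁) h₂
      refine absurd ?_ (hM.not_isPos_neg_one h)
      convert h₅ using 1
      have h₆ := h₂.1
      field_simp
      ring

/-- If a is not positive, then s = a/(a - 1) is inner, so s and 1 - s are positive, and s/(1 - s) =
-a. -/
theorem IsOrderedMetricWu.isPos_or_neg {a : F} (ha : a ≠ 0) : IsPos x y a ∨ IsPos x y (-a) := by
  by_cases hp : IsPos x y a
  · exact .inl hp
  · right
    have hi : IsInner x y (a / (a - 1)) := by
      by_contra h₁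
      exact hp ⟨ha, h₁⟩
    have ha1 : a - 1 ≠ 0 := by
      intro h₁
      rw [h₁, div_zero] at hi
      exact (hM.ne_of_isInner h hi).1 rfl
    obtain ⟨h₁, h₂⟩ := (hM.isInner_iff h).1 hi
    convert hM.isPos_div h h₁ h₂ using 1
    have h₃ : 1 - a / (a - 1) ≠ 0 := h₂.1
    have h₄ : 1 - a / (a - 1) = -1 / (a - 1) := by
      field_simp
      ring
    rw [h₄]
    field_simp

/-- The trichotomy is applied to a/(a + b). If this ratio or its inverse is inner, it is positive,
and multiplicativity gives the sign of a + b. The remaining ratio is -a/b, whose positivity would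
make -1 positive. -/
theorem IsOrderedMetricWu.isPos_add {a b : F} (ha : IsPos x y a) (hb : IsPos x y b) :
    IsPos x y (a + b) := by
  have ha0 := ha.1
  have hb0 := hb.1
  have hab : a + b ≠ 0 := by
    intro h₁
    refine hM.not_isPos_neg_one h ?_
    convert hM.isPos_div h ha hb using 1
    field_simp
    linear_combination -h₁
  have h₀ : a / (a + b) ≠ 1 := by
    rw [Ne, div_eq_one_iff_eq hab]
    simpa using hb0
  rcases (hM.isInner_trichotomy h (div_ne_zero ha0 hab) h₀).1 with h₁ | h₁ | h₁
  · have h₂ := hM.isPos_inv h (hM.isPos_div h ((hM.isInner_iff h).1 h₁).1 ha)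
    convert h₂ using 1
    field_simp
  · have h₂ := hM.isPos_div h (hM.isPos_mul h ((hM.isInner_iff h).1 h₁).1 hb) ha
    refine absurd ?_ (hM.not_isPos_neg_one h)
    convert h₂ using 1
    have h₃ : a / (a + b) - 1 ≠ 0 := sub_ne_zero.2 h₀
    have h₄ : a / (a + b) - 1 = -b / (a + b) := by
      field_simp
      ring
    rw [h₄]
    field_simp
  · have h₂ := hM.isPos_mul h ((hM.isInner_iff h).1 h₁).1 ha
    convert h₂ using 1
    field_simp

theorem IsOrderedMetricWu.isPos_sq {a : F} (ha : a ≠ 0) : IsPos x y (a ^ 2) := by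
  rcases hM.isPos_or_neg h ha with h₁ | h₁
  · rw [sq]
    exact hM.isPos_mul h h₁ h₁
  · rw [← neg_sq, sq]
    exact hM.isPos_mul h h₁ h₁

theorem IsOrderedMetricWu.formallyReal : ¬ IsSumSq (-1 : F) := by
  have key : ∀ s : F, IsSumSq s → s = 0 ∨ IsPos x y s := by
    intro s hs
    induction hs with
    | zero => exact .inl rfl
    | sq_add a hs ih =>
      by_cases ha : a = 0
      · simpa [ha] using ih
      right
      rw [← sq]
      rcases ih with rfl | ih
      · simpa using hM.isPos_sq h ha
      · exact hM.isPos_add h (hM.isPos_sq h ha) ih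
  intro h₁
  rcases key _ h₁ with h₂ | h₂
  · simp at h₂
  · exact hM.not_isPos_neg_one h h₂

end Order

/-- Write a = r² - e² with 0 < e < r. The point (0, e) of the line y = e is symmetric to (e, 0),
which lies between the origin and (r, 0), so the fold axiom applies. A fold through the origin
carries (r, 0) to a point (z, e) at the same distance from the origin, and z² = a. -/
theorem IsEuclideanOrderedMetricWu.exists_sqrt (hM : M.IsEuclideanOrderedMetricWu)
    (h : OrthogonalChart 1 x y) {a : F} (ha : IsPos x y a) : ∃ z, a = z ^ 2 := by
  have hO := hM.toIsOrderedMetricWu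
  have hc := h.toAffineChart
  have h2 := hc.two_ne_zero hM.toIsDesarguesian
  have p2 : IsPos x y (2 : F) := by
    rw [← one_add_one_eq_two]
    exact hO.isPos_add hc (hO.isPos_one hc) (hO.isPos_one hc)
  by_cases ha1 : a = 1
  · exact ⟨1, by simp [ha1]⟩
  -- The identity ((a + 1)/2)² - ((a - 1)/2)² = a, with the sign of e chosen to make it positive; r
  -- - e is then 1 or a. The case e = 0 has been removed with a = 1.
  obtain ⟨e, he, r, hr, hre⟩ : ∃ e, IsPos x y e ∧ ∃ r, IsPos x y (r - e) ∧ r ^ 2 - e ^ 2 = a := by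
    have hd : (a - 1) / 2 ≠ 0 := div_ne_zero (sub_ne_zero.2 ha1) h2
    rcases hO.isPos_or_neg hc hd with h₁ | h₁
    · refine ⟨_, h₁, (a + 1) / 2, ?_, ?_⟩
      · convert hO.isPos_one hc using 1
        field_simp
        ring
      · field_simp
        ring
    · refine ⟨_, h₁, (a + 1) / 2, ?_, ?_⟩
      · convert ha using 1
        field_simp
        ring
      · field_simp
        ring
  have hrp : IsPos x y r := by
    simpa using hO.isPos_add hc hr he
  have hr0 := hrp.1
  obtain ⟨P₂, hP₂, hP₂'⟩ := hc.exists_pt 0 0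
  obtain ⟨P₁, hP₁, hP₁'⟩ := hc.exists_pt r 0
  obtain ⟨H, hH, hH'⟩ := hc.exists_pt 0 e
  obtain ⟨B, hB, hB'⟩ := hc.exists_pt e 0
  obtain ⟨l, hl⟩ := hc.exists_line 0 1 (-e) (.inr one_ne_zero)
  obtain ⟨m, hm, hs⟩ := h.exists_sym one_ne_zero h2 (A := H) (B := B) (P := P₂)
    (by simp [hP₂, hP₂', hH, hH', hB, hB'])
  have hbe : M.Be P₂ B P₁ := by
    refine (hO.be_iff_isInner hc).2 ⟨hc.ne_iff.2 (.inl (by simpa [hP₁, hP₂] using hr0)), e / r,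
      (hO.isInner_iff hc).2 ⟨hO.isPos_div hc he hrp, ?_⟩, ?_⟩
    · convert hO.isPos_div hc hr hrp using 1
      field_simp
    · simp [IsRatio, hB, hB', hP₁, hP₁', hP₂, hP₂', hr0]
  obtain ⟨k, hk, P₃, hs₃, hP₃⟩ := hM.fold P₁ P₂ l
    ⟨H, B, m, (hl.2 H).2 (by simp [hH']), hm, hs, .inl hbe⟩
  have hd := h.dist_eq_of_sym one_ne_zero h2 hs₃ hk
  have hy : y P₃ = e := by
    have := (hl.2 P₃).1 hP₃
    linear_combination this
  rw [hP₂, hP₂', hP₁, hP₁', hy] at hd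
  exact ⟨x P₃, by linear_combination hd - hre⟩

/-- Rectangular coordinates in which betweenness is given by the ordering of the field. -/
structure EuclideanChart {F : Type u} [Field F] (x y : M.Pt → F) : Prop
    extends OrthogonalChart 1 x y where
  be_iff : ∀ {A B C}, M.Be A B C ↔ A ≠ C ∧ ∃ t, SqLt 0 t ∧ SqLt t 1 ∧ IsRatio x y t A B C

/-- Nonzero squares are positive and positive scalars are squares, so geometric positivity of t - s
means that t exceeds s in the ordering by squares, and inner ratios are those between 0 and 1. -/
theorem IsEuclideanOrderedMetricWu.exists_euclideanChart (hM : M.IsEuclideanOrderedMetricWu) :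
    ∃ (F : Type u) (_ : Field F) (x y : M.Pt → F), IsEuclideanField F ∧ EuclideanChart x y := by
  have hO := hM.toIsOrderedMetricWu
  obtain ⟨F, _, x, y, h⟩ := hM.exists_rectangularChart hO.four_points
  have hc := h.toAffineChart
  have hpos : ∀ {s t : F}, SqLt s t ↔ IsPos x y (t - s) := by
    intro s t
    constructor
    · rintro ⟨h₁, z, rfl⟩
      have hz : z ≠ 0 := by
        rintro rfl
        simp at h₁
      simpa using hO.isPos_sq hc hz
    · intro h₁
      obtain ⟨z, hz⟩ := hM.exists_sqrt h h₁
      exact ⟨fun h₂ => h₁.1 (by rw [h₂, sub_self]), z, by rw [← hz]; ring⟩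
  refine ⟨F, inferInstance, x, y, ⟨hO.formallyReal hc, hM.pythagorean h, fun a => ?_⟩, h, ?_⟩
  · by_cases ha : a = 0
    · exact ⟨0, by simp [ha]⟩
    rcases hO.isPos_or_neg hc ha with h₁ | h₁
    · obtain ⟨z, hz⟩ := hM.exists_sqrt h h₁
      exact ⟨z, .inl hz⟩
    · obtain ⟨z, hz⟩ := hM.exists_sqrt h h₁
      exact ⟨z, .inr hz⟩
  · intro A B C
    rw [hO.be_iff_isInner hc]
    refine and_congr_right fun _ => exists_congr fun t => ?_
    rw [hO.isInner_iff hc, hpos, hpos, sub_zero, and_assoc]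

end Str

/-! ### The ordering of a Euclidean field -/

theorem IsEuclideanField.exists_order {F : Type u} [Field F] (hF : IsEuclideanField F) :
    ∃ (_ : LinearOrder F) (_ : IsStrictOrderedRing F), (∀ a b : F, SqLt a b ↔ a < b) ∧
      ∀ a : F, 0 ≤ a → ∃ z, a = z ^ 2 := by
  classical
  -- Otherwise -1 = (w/z)². This gives antisymmetry of the ordering; the Pythagorean property gives
  -- transitivity, and every element being a square up to sign gives totality.
  have anis : ∀ z w : F, z ^ 2 + w ^ 2 = 0 → z = 0 := by
    intro z w h
    by_contra hz
    refine hF.formallyReal ?_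
    have h₁ : (-1 : F) = w / z * (w / z) := by
      field_simp
      linear_combination -h
    rw [h₁]
    exact (IsSquare.mul_self (w / z)).isSumSq
  let o : LinearOrder F :=
    { le := fun a b => ∃ z, a + z ^ 2 = b
      lt := fun a b => SqLt a b
      le_refl := fun a => ⟨0, by ring⟩
      le_trans := by
        rintro a b c ⟨z, rfl⟩ ⟨w, rfl⟩
        obtain ⟨v, hv⟩ := hF.pythagorean z w
        exact ⟨v, by rw [← hv]; ring⟩
      le_antisymm := by
        rintro a b ⟨z, rfl⟩ ⟨w, hw⟩
        have := anis z w (by linear_combination hw)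
        simp [this]
      lt_iff_le_not_ge := by
        intro a b
        constructor
        · rintro ⟨h₁, z, rfl⟩
          refine ⟨⟨z, rfl⟩, ?_⟩
          rintro ⟨w, hw⟩
          have := anis z w (by linear_combination hw)
          simp [this] at h₁
        · rintro ⟨h₁, h₂⟩
          refine ⟨?_, h₁⟩
          rintro rfl
          exact h₂ ⟨0, by ring⟩
      le_total := by
        intro a b
        obtain ⟨z, hz | hz⟩ := hF.square_or_neg_square (b - a)
        · exact .inl ⟨z, by rw [← hz]; ring⟩
        · exact .inr ⟨z, by rw [← hz]; ring⟩
      toDecidableLE := Classical.decRel _ }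
  have : IsOrderedAddMonoid F :=
    { add_le_add_left := by
        rintro a b ⟨z, rfl⟩ c
        exact ⟨z, by ring⟩ }
  have : ZeroLEOneClass F := ⟨⟨1, by ring⟩⟩
  refine ⟨o, IsStrictOrderedRing.of_mul_pos ?_, fun a b => Iff.rfl, ?_⟩
  · rintro a b ⟨ha, z, rfl⟩ ⟨hb, w, rfl⟩
    simp only [zero_add] at ha hb ⊢
    exact ⟨(mul_ne_zero ha.symm hb.symm).symm, z * w, by ring⟩
  · rintro a ⟨z, rfl⟩
    exact ⟨z, by ring⟩

namespace Str

variable {M : Str.{u} planeSig} {F : Type u} [Field F] {x y : M.Pt → F}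

/-! ### The axioms in a chart -/

/-! ### Incidence, parallels, infinity and Desargues in a chart -/

namespace AffineChart

variable (h : AffineChart x y)
include h

theorem exists_smul {A B C D : M.Pt} (hAB : A ≠ B) (hc : cross x y A B C D = 0) :
    ∃ t, x D = x C + t * (x B - x A) ∧ y D = y C + t * (y B - y A) := by
  rw [cross] at hc
  rcases h.ne_iff.1 hAB with h₁ | h₁
  · refine ⟨(x D - x C) / (x B - x A), ?_, ?_⟩
    · field_simp
      ring
    · field_simp
      linear_combination hc
  · refine ⟨(y D - y C) / (y B - y A), ?_, ?_⟩
    · field_simp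
      linear_combination -hc
    · field_simp
      ring

theorem line_unique {A B : M.Pt} (hAB : A ≠ B) {l m : M.Ln} (h₁ : M.Inc A l) (h₂ : M.Inc B l)
    (h₃ : M.Inc A m) (h₄ : M.Inc B m) : l = m :=
  h.line_eq' (h.hasEq_of_inc hAB h₁ h₂) (h.hasEq_of_inc hAB h₃ h₄)

theorem inc_iff_cross {A B : M.Pt} (hAB : A ≠ B) {l : M.Ln} (hA : M.Inc A l) (hB : M.Inc B l)
    (C : M.Pt) : M.Inc C l ↔ cross x y A B A C = 0 := by
  rw [← h.col_iff]
  constructor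
  · exact fun hC => ⟨l, hA, hB, hC⟩
  · rintro ⟨m, h₁, h₂, h₃⟩
    rwa [h.line_unique hAB hA hB h₁ h₂]

theorem parEq_iff_cross {A B C D : M.Pt} (hAB : A ≠ B) (hCD : C ≠ D) {l m : M.Ln}
    (hA : M.Inc A l) (hB : M.Inc B l) (hC : M.Inc C m) (hD : M.Inc D m) :
    M.ParEq l m ↔ cross x y A B C D = 0 := by
  rw [h.parEq_iff (h.hasEq_of_inc hAB hA hB) (h.hasEq_of_inc hCD hC hD), cross]
  constructor <;> intro h₁ <;> linear_combination h₁

theorem exists_point_on {l : M.Ln} {a b c : F} (hl : HasEq x y l a b c) : ∃ A, M.Inc A l := by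
  by_cases ha : a = 0
  · have hb := hl.1.resolve_left (not_not.2 ha)
    obtain ⟨A, hA, hA'⟩ := h.exists_pt 0 (-c / b)
    exact ⟨A, (hl.2 A).2 (by rw [hA, hA']; field_simp; ring)⟩
  · obtain ⟨A, hA, hA'⟩ := h.exists_pt (-c / a) 0
    exact ⟨A, (hl.2 A).2 (by rw [hA, hA']; field_simp; ring)⟩

/-- Each step of the construction completes a parallelogram and adds the fixed vector C - B; in
characteristic zero its multiples are distinct. -/
theorem infinite [CharZero F] (l : M.Ln) (B C : M.Pt) (a : ℕ → M.Pt)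
    (h₁ : M.ParPts B C (a 0) (a 1)) (h₂ : ∀ n, M.Inc (a n) l)
    (h₃ : ∀ n, M.ParPts (a n) B C (a (n + 1))) : Function.Injective a := by
  obtain ⟨hBC, h01, h₄, -⟩ := h.parPts_iff.1 h₁
  obtain ⟨v, hv₁, hv₂⟩ := h.exists_smul hBC h₄
  have hv : v ≠ 0 := by
    rintro rfl
    exact h01 (h.ext _ _ (by simp [hv₁]) (by simp [hv₂]))
  have step : ∀ n, x (a (n + 1)) = x (a n) + (x C - x B) ∧
      y (a (n + 1)) = y (a n) + (y C - y B) := by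
    intro n
    have h₅ := (h.inc_iff_cross h01 (h₂ 0) (h₂ 1) _).1 (h₂ n)
    have h₆ := (h.inc_iff_cross h01 (h₂ 0) (h₂ 1) _).1 (h₂ (n + 1))
    have h₇ : cross x y B C (a n) (a (n + 1)) = 0 := by
      simp only [cross, hv₁, hv₂] at h₅ h₆ ⊢
      refine mul_left_cancel₀ hv ?_
      linear_combination h₆ - h₅
    obtain ⟨w, hw₁, hw₂⟩ := h.exists_smul hBC h₇
    obtain ⟨-, -, h₈, h₉⟩ := h.parPts_iff.1 (h₃ n)
    simp only [cross, hw₁, hw₂] at h₈ h₉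
    have hw : w - 1 = 0 := by
      refine (mul_eq_zero.1 (?_ : (w - 1) * _ = 0)).resolve_right h₉
      linear_combination h₈
    rw [hw₁, hw₂]
    exact ⟨by linear_combination (x C - x B) * hw, by linear_combination (y C - y B) * hw⟩
  have hn : ∀ n, x (a n) = x (a 0) + n * (x C - x B) ∧ y (a n) = y (a 0) + n * (y C - y B) := by
    intro n
    induction n with
    | zero => simp
    | succ n ih =>
      rw [(step n).1, (step n).2, ih.1, ih.2]
      push_cast
      exact ⟨by ring, by ring⟩
  intro m n hmn
  have h₅ := (hn m).1.symm.trans ((congrArg x hmn).trans (hn n).1)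
  have h₆ := (hn m).2.symm.trans ((congrArg y hmn).trans (hn n).2)
  have h₇ : (m : F) = n := by
    rcases h.ne_iff.1 hBC with h₇ | h₇
    · exact mul_right_cancel₀ h₇ (add_left_cancel h₅)
    · exact mul_right_cancel₀ h₇ (add_left_cancel h₆)
  exact_mod_cast h₇

/-- The sides of the second triangle are r, s and t times those of the first, and closing up the
triangle forces r = s = t. For r = 1 the triangles differ by a translation and the traces are
parallel; otherwise they differ by a homothety and the traces meet in its centre. -/
theorem desargues₁ {A B C A' B' C' : M.Pt} (hn : ¬ M.Col A B C) (hAB : M.ParPts A B A' B')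
    (hAC : M.ParPts A C A' C') (hBC : M.ParPts B C B' C') {a b c : M.Ln} (h₁ : M.Inc A a)
    (h₁' : M.Inc A' a) (h₂ : M.Inc B b) (h₂' : M.Inc B' b) (h₃ : M.Inc C c)
    (h₃' : M.Inc C' c) : M.ParOrConcur a b c := by
  rw [h.col_iff] at hn
  obtain ⟨hAB₀, -, hAB₁, hAB₂⟩ := h.parPts_iff.1 hAB
  obtain ⟨hAC₀, -, hAC₁, hAC₂⟩ := h.parPts_iff.1 hAC
  obtain ⟨hBC₀, -, hBC₁, hBC₂⟩ := h.parPts_iff.1 hBC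
  obtain ⟨r, hr₁, hr₂⟩ := h.exists_smul hAB₀ hAB₁
  obtain ⟨s, hs₁, hs₂⟩ := h.exists_smul hAC₀ hAC₁
  obtain ⟨t, ht₁, ht₂⟩ := h.exists_smul hBC₀ hBC₁
  have e₁ : s * (x C - x A) - r * (x B - x A) = t * (x C - x B) := by
    linear_combination ht₁ - hs₁ + hr₁
  have e₂ : s * (y C - y A) - r * (y B - y A) = t * (y C - y B) := by
    linear_combination ht₂ - hs₂ + hr₂
  have hst : s - t = 0 := by
    refine (mul_eq_zero.1 (?_ : (s - t) * cross x y A B A C = 0)).resolve_right hn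
    rw [cross]
    linear_combination (x B - x A) * e₂ - (y B - y A) * e₁
  have hrt : r - t = 0 := by
    refine (mul_eq_zero.1 (?_ : (r - t) * cross x y A B A C = 0)).resolve_right hn
    rw [cross]
    linear_combination (x C - x A) * e₂ - (y C - y A) * e₁
  obtain rfl : s = t := sub_eq_zero.1 hst
  obtain rfl : r = s := sub_eq_zero.1 hrt
  have hA : A ≠ A' := by
    rintro rfl
    simp [cross] at hAB₂
  have hB : B ≠ B' := by
    rintro rfl
    simp [cross] at hBC₂
  have hC : C ≠ C' := by
    rintro rfl
    refine hAC₂ ?_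
    simp only [cross] at hAC₁ ⊢
    linear_combination -hAC₁
  by_cases hr : r = 1
  · left
    have par : ∀ {A B A' B' a b}, A ≠ A' → B ≠ B' → M.Inc A a → M.Inc A' a → M.Inc B b →
        M.Inc B' b → x B' = x A' + 1 * (x B - x A) → y B' = y A' + 1 * (y B - y A) →
        cross x y A B A A' ≠ 0 → M.Par a b := by
      intro A B A' B' a b hA hB h₁ h₁' h₂ h₂' hx hy hne
      refine ((h.parEq_iff_cross hA hB h₁ h₁' h₂ h₂').2 ?_).resolve_right ?_
      · rw [cross, hx, hy]
        ring
      · rintro rfl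
        refine hne ?_
        have := (h.inc_iff_cross hA h₁ h₁' _).1 h₂
        rw [cross] at this ⊢
        linear_combination -this
    subst hr
    exact ⟨par hA hB h₁ h₁' h₂ h₂' hr₁ hr₂ hAB₂, par hB hC h₂ h₂' h₃ h₃' ht₁ ht₂ hBC₂,
      par hA hC h₁ h₁' h₃ h₃' hs₁ hs₂ hAC₂⟩
  · right
    have hr' : 1 - r ≠ 0 := sub_ne_zero.2 (Ne.symm hr)
    -- The fixed point of the homothety that sends P to A' + r(P - A).
    obtain ⟨S, hS, hS'⟩ := h.exists_pt ((x A' - r * x A) / (1 - r)) ((y A' - r * y A) / (1 - r))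
    refine ⟨S, (h.inc_iff_cross hA h₁ h₁' S).2 ?_, (h.inc_iff_cross hB h₂ h₂' S).2 ?_,
      (h.inc_iff_cross hC h₃ h₃' S).2 ?_⟩
    · rw [cross, hS, hS']
      field_simp
      ring
    · rw [cross, hS, hS', hr₁, hr₂]
      field_simp
      ring
    · rw [cross, hS, hS', hs₁, hs₂]
      field_simp
      ring

/-- It suffices to see that the factors r of AB and s of AC agree. Parallel traces give r = s = 1.
If the traces meet in S = A + α(A' - A), both factors solve 1 + α(r - 1) = 0. The sides BC and B'C'
are then proportional, and they are different lines because C is off BB'. -/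
theorem desargues₂ {A B C A' B' C' : M.Pt} (hn : ¬ M.Col A B C) (hn' : ¬ M.Col A' B' C')
    (hAB : M.ParPts A B A' B') (hAC : M.ParPts A C A' C') {a b c : M.Ln} (h₁ : M.Inc A a)
    (h₁' : M.Inc A' a) (h₂ : M.Inc B b) (h₂' : M.Inc B' b) (h₃ : M.Inc C c)
    (h₃' : M.Inc C' c) (hbc : b ≠ c) (hp : M.ParOrConcur a b c) : M.ParPts B C B' C' := by
  rw [h.col_iff] at hn hn'
  obtain ⟨hAB₀, -, hAB₁, hAB₂⟩ := h.parPts_iff.1 hAB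
  obtain ⟨hAC₀, -, hAC₁, hAC₂⟩ := h.parPts_iff.1 hAC
  obtain ⟨r, hr₁, hr₂⟩ := h.exists_smul hAB₀ hAB₁
  obtain ⟨s, hs₁, hs₂⟩ := h.exists_smul hAC₀ hAC₁
  have hA : A ≠ A' := by
    rintro rfl
    simp [cross] at hAB₂
  have hB : B ≠ B' := by
    rintro rfl
    refine hAB₂ ?_
    simp only [cross] at hAB₁ ⊢
    linear_combination -hAB₁
  have hC : C ≠ C' := by
    rintro rfl
    refine hAC₂ ?_
    simp only [cross] at hAC₁ ⊢
    linear_combination -hAC₁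
  have hBC : B ≠ C := by
    rintro rfl
    exact hn (by rw [cross]; ring)
  have hB'C' : B' ≠ C' := by
    rintro rfl
    exact hn' (by rw [cross]; ring)
  have main : r = s ∧ ¬ M.Inc C b := by
    rcases hp with ⟨hp₁, hp₂, hp₃⟩ | ⟨S, hSa, hSb, hSc⟩
    · have one : ∀ {B B' b r}, B ≠ B' → M.Inc B b → M.Inc B' b →
          x B' = x A' + r * (x B - x A) → y B' = y A' + r * (y B - y A) →
          cross x y A B A A' ≠ 0 → M.Par a b → r = 1 := by
        intro B B' b r hB h₂ h₂' hr₁ hr₂ hne hp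
        have h₄ := (h.parEq_iff_cross hA hB h₁ h₁' h₂ h₂').1 (.inl hp)
        rw [cross, hr₁, hr₂] at h₄
        rw [cross] at hne
        refine sub_eq_zero.1 ((mul_eq_zero.1 (?_ : (r - 1) * _ = 0)).resolve_right hne)
        linear_combination -h₄
      exact ⟨(one hB h₂ h₂' hr₁ hr₂ hAB₂ hp₁).trans (one hC h₃ h₃' hs₁ hs₂ hAC₂ hp₃).symm,
        fun hCb => hp₂ ⟨C, hCb, h₃⟩⟩
    · obtain ⟨α, hα₁, hα₂⟩ := h.exists_smul hA ((h.inc_iff_cross hA h₁ h₁' S).1 hSa)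
      have key : ∀ {B B' b r}, B ≠ B' → M.Inc B b → M.Inc B' b → M.Inc S b →
          x B' = x A' + r * (x B - x A) → y B' = y A' + r * (y B - y A) →
          cross x y A B A A' ≠ 0 → 1 + α * (r - 1) = 0 ∧ S ≠ B := by
        intro B B' b r hB h₂ h₂' hSb hr₁ hr₂ hne
        obtain ⟨β, hβ₁, hβ₂⟩ := h.exists_smul hB ((h.inc_iff_cross hB h₂ h₂' S).1 hSb)
        rw [cross] at hne
        rw [hr₁, hα₁] at hβ₁
        rw [hr₂, hα₂] at hβ₂
        have h₄ : α - β = 0 := by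
          refine (mul_eq_zero.1 (?_ : (α - β) * _ = 0)).resolve_right hne
          linear_combination (x B - x A) * hβ₂ - (y B - y A) * hβ₁
        have h₅ : 1 + β * (r - 1) = 0 := by
          refine (mul_eq_zero.1 (?_ : (1 + β * (r - 1)) * _ = 0)).resolve_right hne
          linear_combination (x A' - x A) * hβ₂ - (y A' - y A) * hβ₁
        obtain rfl := sub_eq_zero.1 h₄
        refine ⟨h₅, ?_⟩
        rintro rfl
        have hα0 : α ≠ 0 := by
          rintro rfl
          simp at h₅
        refine hne ?_
        rw [hα₁, hα₂]
        ring
      obtain ⟨h₄, -⟩ := key hB h₂ h₂' hSb hr₁ hr₂ hAB₂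
      obtain ⟨h₅, hSC⟩ := key hC h₃ h₃' hSc hs₁ hs₂ hAC₂
      have hα0 : α ≠ 0 := by
        rintro rfl
        simp at h₄
      refine ⟨mul_left_cancel₀ hα0 (by linear_combination h₄ - h₅), fun hCb => ?_⟩
      exact hbc (h.line_unique hSC hSb hCb hSc h₃)
  obtain ⟨rfl, hCb⟩ := main
  rw [h.inc_iff_cross hB h₂ h₂'] at hCb
  refine h.parPts_iff.2 ⟨hBC, hB'C', ?_, fun h₄ => hCb ?_⟩
  · rw [cross, hr₁, hr₂, hs₁, hs₂]
    ring
  · rw [cross] at h₄ ⊢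
    linear_combination -h₄

theorem isDesarguesian [CharZero F] : M.IsDesarguesian where
  line_through A B hAB := by
    obtain ⟨l, hA, hB⟩ := h.exists_line_of_ne A B
    exact ⟨l, ⟨hA, hB⟩, fun m hm => h.line_unique hAB hm.1 hm.2 hA hB⟩
  two_points l := by
    obtain ⟨a, b, c, hl⟩ := h.exists_eq l
    obtain ⟨A, hA⟩ := h.exists_point_on hl
    obtain ⟨B, hB, hB'⟩ := h.exists_pt (x A + b) (y A - a)
    refine ⟨A, B, h.ne_iff.2 ?_, hA, (hl.2 B).2 ?_⟩
    · rw [hB, hB']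
      simpa [or_comm] using hl.1
    · rw [hB, hB']
      linear_combination (hl.2 A).1 hA
  three_points := by
    obtain ⟨O, hO, hO'⟩ := h.exists_pt 0 0
    obtain ⟨A, hA, hA'⟩ := h.exists_pt 1 0
    obtain ⟨B, hB, hB'⟩ := h.exists_pt 0 1
    refine ⟨O, A, B, h.ne_iff.2 ?_, h.ne_iff.2 ?_, h.ne_iff.2 ?_, ?_⟩
    · simp [hO, hA]
    · simp [hO', hB']
    · simp [hA, hB]
    · simp [h.col_iff, cross, *]
  parallel l A hA := by
    obtain ⟨a, b, c, hl⟩ := h.exists_eq l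
    obtain ⟨m, hm, hAm⟩ := h.exists_line_through A hl.1
    have hml : M.ParEq m l := (h.parEq_iff hm hl).2 rfl
    refine ⟨m, ⟨hAm, hml.resolve_right ?_⟩, ?_⟩
    · rintro rfl
      exact hA hAm
    · rintro n ⟨hAn, hnl⟩
      obtain ⟨a', b', c', hn⟩ := h.exists_eq n
      have h₁ := (h.parEq_iff hn hl).1 (.inl hnl)
      exact ((h.parEq_iff hn hm).2 h₁).eq hAn hAm
  infinite := h.infinite
  desargues₁ A B C A' B' C' hn _ hAB hAC hBC a b c h₁ h₁' h₂ h₂' h₃ h₃' :=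
    h.desargues₁ hn hAB hAC hBC h₁ h₁' h₂ h₂' h₃ h₃'
  desargues₂ A B C A' B' C' hn hn' hAB hAC a b c h₁ h₁' h₂ h₂' h₃ h₃' _ _ hbc hp :=
    h.desargues₂ hn hn' hAB hAC h₁ h₁' h₂ h₂' h₃ h₃' hbc hp

end AffineChart

/-! ### Heights, symmetric axes and circles in a chart -/

namespace OrthogonalChart

variable [LinearOrder F] [IsStrictOrderedRing F] (h : OrthogonalChart 1 x y)
include h

omit [LinearOrder F] [IsStrictOrderedRing F] in
theorem inc_perp_iff {l m : M.Ln} (hp : M.Perp l m) {A B C : M.Pt} (hA : M.Inc A l)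
    (hBC : B ≠ C) (hB : M.Inc B m) (hC : M.Inc C m) (P : M.Pt) :
    M.Inc P l ↔ (x C - x B) * (x P - x A) + (y C - y B) * (y P - y A) = 0 := by
  obtain ⟨k, hk, hAk⟩ := h.exists_line_through A (h.ne_iff.1 hBC)
  obtain ⟨a, b, c, hl⟩ := h.exists_eq l
  have h₁ := (h.perp_iff hl (h.hasEq_of_inc hBC hB hC)).1 hp
  obtain rfl := ((h.parEq_iff hl hk).2 (by linear_combination h₁)).eq hA hAk
  rw [hk.2]
  constructor <;> intro h₂ <;> linear_combination h₂

omit [LinearOrder F] [IsStrictOrderedRing F] in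
theorem isOrthogonalWu [CharZero F] : M.IsOrthogonalWu where
  toIsDesarguesian := h.isDesarguesian
  perp_comm l m := by
    obtain ⟨a, b, c, hl⟩ := h.exists_eq l
    obtain ⟨a', b', c', hm⟩ := h.exists_eq m
    rw [h.perp_iff hl hm, h.perp_iff hm hl, mul_comm a, mul_comm b]
  perp_through O l := by
    obtain ⟨a, b, c, hl⟩ := h.exists_eq l
    obtain ⟨m, hm, hO⟩ := h.exists_line_through O (a := -b) (b := a)
      (by simpa [or_comm] using hl.1)
    refine ⟨m, ⟨(h.perp_iff hl hm).2 (by ring), hO⟩, ?_⟩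
    rintro n ⟨h₁, h₂⟩
    obtain ⟨a', b', c', hn⟩ := h.exists_eq n
    have h₃ := (h.perp_iff hl hn).1 h₁
    exact ((h.parEq_iff hn hm).2 (by linear_combination h₃)).eq h₂ hO
  perp_perp l m n h₁ h₂ := by
    obtain ⟨a, b, c, hl⟩ := h.exists_eq l
    obtain ⟨a', b', c', hm⟩ := h.exists_eq m
    obtain ⟨a'', b'', c'', hn⟩ := h.exists_eq n
    rw [h.perp_iff hl hm] at h₁
    rw [h.perp_iff hl hn] at h₂
    refine (h.parEq_iff hm hn).2 ?_
    rcases hl.1 with ha | hb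
    · refine mul_left_cancel₀ ha ?_
      linear_combination b'' * h₁ - b' * h₂
    · refine mul_left_cancel₀ hb ?_
      linear_combination a' * h₂ - a'' * h₁
  exists_nonisotropic O := by
    obtain ⟨l, hl, hO⟩ := h.exists_line_through O (a := 0) (b := 1) (.inr one_ne_zero)
    exact ⟨l, hO, by simp [h.perp_iff hl hl]⟩
  heights A B C hn a b c ha hb hc hBa hCa hCb hAb hAc hBc hA hpa hB hpb hC hpc := by
    rw [h.col_iff, cross] at hn
    have hBC : B ≠ C := by
      rintro rfl
      exact hn (by ring)
    have hCA : C ≠ A := by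
      rintro rfl
      exact hn (by ring)
    have hAB : A ≠ B := by
      rintro rfl
      exact hn (by ring)
    have ea := h.inc_perp_iff hpa hA hBC hBa hCa
    have eb := h.inc_perp_iff hpb hB hCA hCb hAb
    have ec := h.inc_perp_iff hpc hC hAB hAc hBc
    obtain ⟨k, hk, hAk⟩ := h.exists_line_through A (h.ne_iff.1 hBC)
    obtain ⟨k', hk', hBk'⟩ := h.exists_line_through B (h.ne_iff.1 hCA)
    -- Two heights meet since their normals are two sides of the triangle. The equations of the
    -- three heights add up to zero identically, so the third contains the common point.
    obtain ⟨H, hH, hH'⟩ := h.exists_common hk hk' (fun h₁ => hn (by linear_combination h₁))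
    have h₁ := (hk.2 H).1 hH
    have h₂ := (hk'.2 H).1 hH'
    refine ⟨H, ⟨(ea H).2 (by linear_combination h₁), (eb H).2 (by linear_combination h₂),
      (ec H).2 (by linear_combination -h₁ - h₂)⟩, ?_⟩
    rintro H' ⟨h₃, h₄, -⟩
    rw [ea] at h₃
    rw [eb] at h₄
    refine h.ext _ _ (mul_right_cancel₀ hn ?_) (mul_right_cancel₀ hn ?_)
    · linear_combination (y A - y C) * (h₃ - h₁) - (y C - y B) * (h₄ - h₂)
    · linear_combination (x C - x B) * (h₄ - h₂) - (x A - x C) * (h₃ - h₁)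

/-- The axis is a bisector of the two lines. To construct it, their direction vectors are brought to
equal length, for which the square roots of a² + b² and a'² + b'² are needed. -/
theorem isMetricWu (hsq : ∀ a : F, 0 ≤ a → ∃ z, a = z ^ 2) : M.IsMetricWu where
  toIsOrthogonalWu := h.isOrthogonalWu
  symAxis l m := by
    rintro ⟨S, hSl, hSm⟩ hll hmm
    by_cases hlm : l = m
    · subst hlm
      exact ⟨l, hll, fun A hA => ⟨A, hA, .inr ⟨rfl, hA⟩⟩⟩
    obtain ⟨a, b, c, hl⟩ := h.exists_eq l
    obtain ⟨a', b', c', hm⟩ := h.exists_eq m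
    have pos : ∀ {a b : F}, a ≠ 0 ∨ b ≠ 0 → 0 < a ^ 2 + b ^ 2 := by
      rintro a b (ha | hb) <;> positivity
    have root : ∀ {a b : F}, a ≠ 0 ∨ b ≠ 0 → ∃ p, p ≠ 0 ∧ a ^ 2 + b ^ 2 = p ^ 2 := by
      intro a b hab
      obtain ⟨p, hp⟩ := hsq _ (pos hab).le
      refine ⟨p, ?_, hp⟩
      rintro rfl
      have := pos hab
      rw [hp] at this
      simp at this
    obtain ⟨p, hp0, hp⟩ := root hl.1
    obtain ⟨q, hq0, hq⟩ := root hm.1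
    have hd : a * b' - a' * b ≠ 0 := by
      intro h₁
      exact hlm (((h.parEq_iff hl hm).2 (sub_eq_zero.1 h₁)).eq hSl hSm)
    -- The directions (b, -a) and (b', -a') have lengths p and q. Multiplied by q and p they have
    -- equal length, and the reflection that exchanges them has their difference as the normal of
    -- its axis.
    have hk0 : q * b - p * b' ≠ 0 ∨ p * a' - q * a ≠ 0 := by
      by_contra! h₁
      refine mul_ne_zero hq0 hd ?_
      linear_combination -a' * h₁.1 - b' * h₁.2
    obtain ⟨k, hk, hSk⟩ := h.exists_line_through S hk0
    refine ⟨k, ?_, fun A hA => ?_⟩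
    · rw [h.perp_iff hk hk]
      have := pos hk0
      intro h₁
      exact this.ne' (by linear_combination h₁)
    have hSl' := (hl.2 S).1 hSl
    have hSm' := (hm.2 S).1 hSm
    have hA' := (hl.2 A).1 hA
    obtain ⟨t, ht₁, ht₂⟩ : ∃ t, x A = x S + t * b ∧ y A = y S - t * a := by
      rcases hl.1 with ha | hb
      · exact ⟨(y S - y A) / a, by field_simp; linear_combination hA' - hSl', by field_simp; ring⟩
      · exact ⟨(x A - x S) / b, by field_simp; ring, by field_simp; linear_combination hA' - hSl'⟩
    -- The image of S + t(b, -a) is S + τ(b', -a') with the same distance from S, that is |τ|q =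
    -- |t|p up to the signs of the roots.
    obtain ⟨τ, hτ⟩ : ∃ τ, τ * q = t * p := ⟨_, div_mul_cancel₀ _ hq0⟩
    obtain ⟨B, hB₁, hB₂⟩ := h.exists_pt (x S + τ * b') (y S - τ * a')
    refine ⟨B, (hm.2 B).2 (by rw [hB₁, hB₂]; linear_combination hSm'), ?_⟩
    by_cases ht : t = 0
    · obtain rfl : A = S := h.ext _ _ (by simp [ht₁, ht]) (by simp [ht₂, ht])
      have hτ0 : τ = 0 := by simpa [ht, hq0] using hτ
      exact .inr ⟨h.ext _ _ (by simp [hB₁, hτ0]) (by simp [hB₂, hτ0]), hSk⟩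
    left
    rw [h.perpBisector_iff one_ne_zero two_ne_zero]
    constructor
    · rintro rfl
      have h₁ : q * b - p * b' = 0 := by
        refine mul_left_cancel₀ ht ?_
        linear_combination q * (hB₁ - ht₁) + b' * hτ
      have h₂ : p * a' - q * a = 0 := by
        refine mul_left_cancel₀ ht ?_
        linear_combination q * (hB₂ - ht₂) - a' * hτ
      simp [h₁, h₂] at hk0
    · intro P
      rw [hk.2, ht₁, ht₂, hB₁, hB₂]
      constructor
      · intro h₁
        refine mul_left_cancel₀ hq0 ?_
        linear_combination (-2 * t) * h₁ + q * t ^ 2 * hp - q * τ ^ 2 * hq -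
          q * (t * p + τ * q) * hτ + 2 * ((x P - x S) * b' - (y P - y S) * a') * hτ
      · intro h₁
        refine mul_left_cancel₀ (mul_ne_zero two_ne_zero ht) ?_
        linear_combination -q * h₁ + q * t ^ 2 * hp - q * τ ^ 2 * hq -
          q * (t * p + τ * q) * hτ + 2 * ((x P - x S) * b' - (y P - y S) * a') * hτ

/-- A circle meets a line that contains a point of its interior. -/
theorem exists_point_at_distance (hsq : ∀ a : F, 0 ≤ a → ∃ z, a = z ^ 2) {l : M.Ln} {H P : M.Pt}
    (hH : M.Inc H l) {R : F} (hR : (x H - x P) ^ 2 + (y H - y P) ^ 2 ≤ R) :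
    ∃ Q, M.Inc Q l ∧ (x Q - x P) ^ 2 + (y Q - y P) ^ 2 = R := by
  obtain ⟨a, b, c, hl⟩ := h.exists_eq l
  have hN : 0 < a ^ 2 + b ^ 2 := by
    rcases hl.1 with ha | hb <;> positivity
  -- For Q = H + s(b, -a) the distance condition is quadratic in s with leading coefficient a² + b².
  -- The radicand is a quarter of its discriminant, nonnegative because H is inside the circle or on
  -- it.
  obtain ⟨z, hz⟩ := hsq (((x H - x P) * b - (y H - y P) * a) ^ 2 +
    (a ^ 2 + b ^ 2) * (R - ((x H - x P) ^ 2 + (y H - y P) ^ 2)))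
    (add_nonneg (sq_nonneg _) (mul_nonneg hN.le (sub_nonneg.2 hR)))
  obtain ⟨s, hs⟩ : ∃ s, s * (a ^ 2 + b ^ 2) = z - ((x H - x P) * b - (y H - y P) * a) :=
    ⟨_, div_mul_cancel₀ _ hN.ne'⟩
  obtain ⟨Q, hQ, hQ'⟩ := h.exists_pt (x H + s * b) (y H - s * a)
  refine ⟨Q, (hl.2 Q).2 (by rw [hQ, hQ']; linear_combination (hl.2 H).1 hH), ?_⟩
  rw [hQ, hQ']
  refine mul_left_cancel₀ hN.ne' ?_
  linear_combination -hz + (s * (a ^ 2 + b ^ 2) + z + ((x H - x P) * b - (y H - y P) * a)) * hs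

end OrthogonalChart

/-! ### Betweenness, Pasch's axiom and folding in a chart -/

namespace EuclideanChart

variable [LinearOrder F] [IsStrictOrderedRing F] (h : EuclideanChart x y)
  (hlt : ∀ a b : F, SqLt a b ↔ a < b)
include h hlt

theorem be_iff_of_ratio {A B C : M.Pt} {t : F} (hAC : A ≠ C) (ht : IsRatio x y t A B C) :
    M.Be A B C ↔ 0 < t ∧ t < 1 := by
  rw [h.be_iff]
  simp only [hlt]
  constructor
  · rintro ⟨-, s, h₁, h₂, hs⟩
    have hst : s = t := by
      rcases h.ne_iff.1 hAC with h₃ | h₃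
      · exact mul_right_cancel₀ h₃ (add_left_cancel (hs.1.symm.trans ht.1))
      · exact mul_right_cancel₀ h₃ (add_left_cancel (hs.2.symm.trans ht.2))
    exact hst ▸ ⟨h₁, h₂⟩
  · rintro ⟨h₁, h₂⟩
    exact ⟨hAC, t, h₁, h₂, ht⟩

theorem be_trichotomy {A B C : M.Pt} (hAB : A ≠ B) (hAC : A ≠ C) (hBC : B ≠ C)
    (hcol : M.Col A B C) : (M.Be A B C ∨ M.Be B A C ∨ M.Be A C B) ∧
      ¬ (M.Be A B C ∧ M.Be B A C) ∧ ¬ (M.Be A B C ∧ M.Be A C B) ∧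
      ¬ (M.Be B A C ∧ M.Be A C B) := by
  obtain ⟨t, ht⟩ := h.exists_ratio hAC hcol
  have ht0 : t ≠ 0 := by
    rintro rfl
    exact hAB (h.ext _ _ (by simp [ht.1]) (by simp [ht.2]))
  have ht1 : t - 1 ≠ 0 := by
    intro h₁
    obtain rfl := sub_eq_zero.1 h₁
    exact hBC (h.ext _ _ (by simp [ht.1]) (by simp [ht.2]))
  have h₁ := h.be_iff_of_ratio hlt hAC ht
  have h₂ : M.Be B A C ↔ t < 0 := by
    rw [h.be_iff_of_ratio hlt hBC (t := t / (t - 1))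
      ⟨by rw [ht.1]; field_simp; ring, by rw [ht.2]; field_simp; ring⟩]
    constructor
    · rintro ⟨h₃, h₄⟩
      by_contra! h₅
      rcases lt_or_gt_of_ne ht1 with h₆ | h₆
      · exact absurd h₃ (not_lt.2 (div_nonpos_of_nonneg_of_nonpos h₅ h₆.le))
      · rw [div_lt_one h₆] at h₄
        linarith
    · intro h₃
      have h₄ : t - 1 < 0 := by linarith
      exact ⟨div_pos_of_neg_of_neg h₃ h₄, by rw [div_lt_one_of_neg h₄]; linarith⟩
  have h₃ : M.Be A C B ↔ 1 < t := by
    rw [h.be_iff_of_ratio hlt hAB (t := t⁻¹)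
      ⟨by rw [ht.1]; field_simp; ring, by rw [ht.2]; field_simp; ring⟩]
    constructor
    · rintro ⟨h₃, h₄⟩
      exact (inv_lt_one₀ (inv_pos.1 h₃)).1 h₄
    · intro h₃
      have h₄ : 0 < t := by linarith
      exact ⟨inv_pos.2 h₄, (inv_lt_one₀ h₄).2 h₃⟩
  rw [h₁, h₂, h₃]
  refine ⟨?_, fun h₄ => by linarith [h₄.1.1, h₄.2], fun h₄ => by linarith [h₄.1.2, h₄.2],
    fun h₄ => by linarith [h₄.1, h₄.2]⟩
  rcases lt_or_gt_of_ne ht0 with h₄ | h₄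
  · exact .inr (.inl h₄)
  · rcases lt_or_gt_of_ne ht1 with h₅ | h₅
    · exact .inl ⟨h₄, by linarith⟩
    · exact .inr (.inr (by linarith))

theorem exists_be_on_line {l : M.Ln} {a b c : F} (hl : HasEq x y l a b c) {A B : M.Pt}
    (hAB : (a * x A + b * y A + c) * (a * x B + b * y B + c) < 0) :
    ∃ D, M.Inc D l ∧ M.Be A D B := by
  set p := a * x A + b * y A + c with hp
  set q := a * x B + b * y B + c with hq
  have hpq : p - q ≠ 0 := by
    intro h₁
    rw [sub_eq_zero.1 h₁] at hAB
    exact absurd hAB (not_lt.2 (mul_self_nonneg q))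
  have hne : A ≠ B := by
    rintro rfl
    exact hpq (by rw [hp, hq, sub_self])
  -- Along the segment the equation of the line has the values p + t(q - p), which vanish at t =
  -- p/(p - q); this is between 0 and 1 because p and q have opposite signs.
  obtain ⟨t, ht⟩ : ∃ t, t * (p - q) = p := ⟨_, div_mul_cancel₀ _ hpq⟩
  obtain ⟨D, hD⟩ := h.exists_point_ratio t A B
  refine ⟨D, (hl.2 D).2 ?_, (h.be_iff_of_ratio hlt hne hD).2 ?_⟩
  · rw [hD.1, hD.2]
    linear_combination -ht + (1 - t) * hp.symm + t * hq.symm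
  · have h₁ : t = p / (p - q) := (eq_div_iff hpq).2 ht
    rw [h₁]
    rcases mul_neg_iff.1 hAB with ⟨h₂, h₃⟩ | ⟨h₂, h₃⟩
    · have h₄ : 0 < p - q := by linarith
      exact ⟨div_pos h₂ h₄, (div_lt_one h₄).2 (by linarith)⟩
    · have h₄ : p - q < 0 := by linarith
      exact ⟨div_pos_of_neg_of_neg h₂ h₄, (div_lt_one_of_neg h₄).2 (by linarith)⟩

theorem isOrderedMetricWu (hsq : ∀ a : F, 0 ≤ a → ∃ z, a = z ^ 2) : M.IsOrderedMetricWu where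
  toIsMetricWu := h.isMetricWu hsq
  be_distinct_col A B C hbe := by
    obtain ⟨hAC, t, h₀, h₁, ht⟩ := h.be_iff.1 hbe
    rw [hlt] at h₀ h₁
    refine ⟨?_, hAC, ?_, h.col_iff.2 ?_⟩
    · rintro rfl
      have := (h.be_iff_of_ratio hlt hAC (t := 0) ⟨by ring, by ring⟩).1 hbe
      exact lt_irrefl _ this.1
    · rintro rfl
      have := (h.be_iff_of_ratio hlt hAC (t := 1) ⟨by ring, by ring⟩).1 hbe
      exact lt_irrefl _ this.2
    · rw [cross, ht.1, ht.2]
      ring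
  be_symm A B C hbe := by
    obtain ⟨hAC, t, h₀, h₁, ht⟩ := h.be_iff.1 hbe
    rw [hlt] at h₀ h₁
    exact (h.be_iff_of_ratio hlt hAC.symm ht.symm).2 ⟨by linarith, by linarith⟩
  be_exists A C hAC := by
    have half : (0 : F) < 2⁻¹ ∧ (2⁻¹ : F) < 1 := ⟨by norm_num, by norm_num⟩
    constructor
    · obtain ⟨B, hB⟩ := h.exists_point_ratio 2⁻¹ A C
      exact ⟨B, (h.be_iff_of_ratio hlt hAC hB).2 half⟩
    · obtain ⟨D, hD, hD'⟩ := h.exists_pt (2 * x C - x A) (2 * y C - y A)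
      have hAD : A ≠ D := by
        rw [h.ne_iff] at hAC ⊢
        rw [hD, hD']
        rcases hAC with h₁ | h₁
        · exact .inl fun h₂ => h₁ (by linarith)
        · exact .inr fun h₂ => h₁ (by linarith)
      refine ⟨D, (h.be_iff_of_ratio hlt hAD (t := 2⁻¹) ⟨?_, ?_⟩).2 half⟩
      · rw [hD]
        ring
      · rw [hD']
        ring
  be_trichotomy A B C hAB hAC hBC hcol := h.be_trichotomy hlt hAB hAC hBC hcol
  pasch A B C l hn hA hB hC D hD hbe := by
    obtain ⟨a, b, c, hl⟩ := h.exists_eq l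
    obtain ⟨hAB, t, h₀, h₁, ht⟩ := h.be_iff.1 hbe
    rw [hlt] at h₀ h₁
    rw [hl.2] at hA hB hC hD
    rw [ht.1, ht.2] at hD
    set p := a * x A + b * y A + c with hp
    set q := a * x B + b * y B + c with hq
    set r := a * x C + b * y C + c with hr
    have h₂ : (1 - t) * p + t * q = 0 := by linear_combination hD
    have h₁' : 0 < 1 - t := by linarith
    -- The point D on the line shows that p and q have opposite signs, so r differs in sign from one
    -- of them.
    have key : p * r < 0 ∨ q * r < 0 := by
      by_contra! h₃
      have h₄ : 0 < p * r := lt_of_le_of_ne h₃.1 (mul_ne_zero hA hC).symm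
      have h₅ : 0 < q * r := lt_of_le_of_ne h₃.2 (mul_ne_zero hB hC).symm
      have h₆ : 0 < (1 - t) * (p * r) + t * (q * r) :=
        add_pos (mul_pos h₁' h₄) (mul_pos h₀ h₅)
      exact h₆.ne' (by linear_combination r * h₂)
    rcases key with h₃ | h₃
    · obtain ⟨E, hE, hE'⟩ := h.exists_be_on_line hlt hl h₃
      exact ⟨E, hE, .inl hE'⟩
    · obtain ⟨E, hE, hE'⟩ := h.exists_be_on_line hlt hl h₃
      exact ⟨E, hE, .inr hE'⟩

omit [LinearOrder F] [IsStrictOrderedRing F] hlt in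
/-- Every plane with a chart over a Euclidean field is a Euclidean ordered metric Wu plane. -/
theorem isEuclideanOrderedMetricWu (hF : IsEuclideanField F) : M.IsEuclideanOrderedMetricWu := by
  obtain ⟨_, _, hlt, hsq⟩ := hF.exists_order
  refine { toIsOrderedMetricWu := h.isOrderedMetricWu hlt hsq, fold := ?_ }
  -- H has the same distance from P₂ as B, which is at most that of P₁. Hence the circle about P₂
  -- through P₁ meets l in a point Q, and the symmetry axis of P₁ and Q through P₂ is the fold.
  rintro P₁ P₂ l ⟨H, B, m, hH, hm, hs, hB⟩
  have h₁ := h.dist_eq_of_sym one_ne_zero two_ne_zero hs hm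
  have h₂ : (x H - x P₂) ^ 2 + (y H - y P₂) ^ 2 ≤ (x P₁ - x P₂) ^ 2 + (y P₁ - y P₂) ^ 2 := by
    have h₃ : (x H - x P₂) ^ 2 + (y H - y P₂) ^ 2 = (x B - x P₂) ^ 2 + (y B - y P₂) ^ 2 := by
      linear_combination h₁
    rw [h₃]
    rcases hB with hB | rfl
    · obtain ⟨-, t, h₄, h₅, ht⟩ := h.be_iff.1 hB
      rw [hlt] at h₄ h₅
      have h₆ : (x B - x P₂) ^ 2 + (y B - y P₂) ^ 2 =
          t ^ 2 * ((x P₁ - x P₂) ^ 2 + (y P₁ - y P₂) ^ 2) := by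
        rw [ht.1, ht.2]
        ring
      rw [h₆]
      exact mul_le_of_le_one_left (by positivity) (pow_le_one₀ h₄.le h₅.le)
    · exact le_rfl
  obtain ⟨Q, hQ, hQ'⟩ := h.exists_point_at_distance hsq hH h₂
  obtain ⟨k, hk, hk'⟩ := h.exists_sym one_ne_zero two_ne_zero (A := P₁) (B := Q) (P := P₂)
    (by linear_combination -hQ')
  exact ⟨k, hk, Q, hk', hQ⟩

end EuclideanChart

/-! ### Charts and isomorphisms to the Cartesian plane -/

end Str

/-! ### Isomorphisms -/

namespace Str

namespace Iso

variable {L : Signature} {M N N' : Str.{u} L}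

/-- The identity. -/
def refl (M : Str.{u} L) : Iso M M := ⟨fun _ => Equiv.refl _, fun _ _ => Iff.rfl⟩

/-- The inverse isomorphism. -/
def symm (e : Iso M N) : Iso N M :=
  ⟨fun s => (e.toEquiv s).symm, fun r x => by rw [e.map_rel]; simp⟩

/-- The composite isomorphism. -/
def trans (e : Iso M N) (f : Iso N N') : Iso M N' :=
  ⟨fun s => (e.toEquiv s).trans (f.toEquiv s), fun r x => by rw [e.map_rel, f.map_rel]; rfl⟩

end Iso

variable {M N : Str.{u} planeSig}

/-- The relations of a structure take families of arguments indexed by sorts; such a family is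
determined by its entries. This allows formulas and isomorphisms to be treated through the geometric
predicates. -/
theorem rel_inc_iff (x : ∀ s, Fin (planeSig.arity PlaneRel.inc s) → M.carrier s) :
    M.rel PlaneRel.inc x ↔
      M.Inc (x .point (0 : Fin 1)) (x .line (0 : Fin 1)) := by
  refine iff_of_eq (congrArg (M.rel PlaneRel.inc) (funext fun s => ?_))
  cases s <;> exact funext fun i => congrArg (x _) (Subsingleton.elim (α := Fin 1) i 0)

theorem rel_perp_iff (x : ∀ s, Fin (planeSig.arity PlaneRel.perp s) → M.carrier s) :
    M.rel PlaneRel.perp x ↔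
      M.Perp (x .line (0 : Fin 2)) (x .line (1 : Fin 2)) := by
  refine iff_of_eq (congrArg (M.rel PlaneRel.perp) (funext fun s => ?_))
  cases s
  · exact funext fun i => Fin.elim0 (i : Fin 0)
  · exact funext fun i => by
      change Fin 2 at i
      fin_cases i <;> rfl

theorem rel_between_iff (x : ∀ s, Fin (planeSig.arity PlaneRel.between s) → M.carrier s) :
    M.rel PlaneRel.between x ↔ M.Be (x .point (0 : Fin 3))
      (x .point (1 : Fin 3)) (x .point (2 : Fin 3)) := by
  refine iff_of_eq (congrArg (M.rel PlaneRel.between) (funext fun s => ?_))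
  cases s
  · exact funext fun i => by
      change Fin 3 at i
      fin_cases i <;> rfl
  · exact funext fun i => Fin.elim0 (i : Fin 0)

/-- Isomorphisms of planes. -/
def Iso.ofEquiv (f : M.Pt ≃ N.Pt) (g : M.Ln ≃ N.Ln)
    (inc : ∀ A l, M.Inc A l ↔ N.Inc (f A) (g l)) (perp : ∀ l m, M.Perp l m ↔ N.Perp (g l) (g m))
    (be : ∀ A B C, M.Be A B C ↔ N.Be (f A) (f B) (f C)) : Iso M N where
  toEquiv
    | .point => f
    | .line => g
  map_rel r x := by
    cases r
    · rw [rel_inc_iff, rel_inc_iff]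
      exact inc _ _
    · rw [rel_perp_iff, rel_perp_iff]
      exact perp _ _
    · rw [rel_between_iff, rel_between_iff]
      exact be _ _ _

namespace Iso

variable (e : Iso M N)

theorem inc_iff (A : M.Pt) (l : M.Ln) :
    M.Inc A l ↔ N.Inc (e.toEquiv .point A) (e.toEquiv .line l) :=
  (e.map_rel PlaneRel.inc _).trans (rel_inc_iff _)

theorem perp_iff (l m : M.Ln) :
    M.Perp l m ↔ N.Perp (e.toEquiv .line l) (e.toEquiv .line m) :=
  (e.map_rel PlaneRel.perp _).trans (rel_perp_iff _)

theorem be_iff (A B C : M.Pt) :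
    M.Be A B C ↔ N.Be (e.toEquiv .point A) (e.toEquiv .point B) (e.toEquiv .point C) :=
  (e.map_rel PlaneRel.between _).trans (rel_between_iff _)

end Iso

end Str

/-! ### The chart of the Cartesian plane -/

section Cartesian

variable {F : Type u} [Field F]

/-- Incidence is defined by some equation of the line; proportional equations have the same
solutions, so any representative may be used. -/
theorem cartesianPlane_hasEq (e : LineEq F) :
    Str.HasEq (M := cartesianPlane F) Prod.fst Prod.snd (Quotient.mk (lineSetoid F) e)
      e.1.1 e.1.2.1 e.1.2.2 := by
  refine ⟨e.2, fun A => ⟨?_, fun h => ⟨e, rfl, h⟩⟩⟩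
  rintro ⟨f, hf, h⟩
  obtain ⟨k, -, hk⟩ := Quotient.exact hf
  have h₁ := congrArg Prod.fst hk
  have h₂ := congrArg (fun p => p.2.1) hk
  have h₃ := congrArg (fun p => p.2.2) hk
  simp only at h₁ h₂ h₃
  rw [h₁, h₂, h₃]
  linear_combination k * h

theorem cartesianPlane_perp_iff (e f : LineEq F) :
    (cartesianPlane F).Perp (Quotient.mk (lineSetoid F) e) (Quotient.mk (lineSetoid F) f) ↔
      e.1.1 * f.1.1 + e.1.2.1 * f.1.2.1 = 0 := by
  refine ⟨?_, fun h => ⟨e, f, rfl, rfl, h⟩⟩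
  rintro ⟨e', f', he, hf, h⟩
  obtain ⟨k, -, hk⟩ := Quotient.exact he
  obtain ⟨k', -, hk'⟩ := Quotient.exact hf
  have h₁ := congrArg Prod.fst hk
  have h₂ := congrArg (fun p => p.2.1) hk
  have h₃ := congrArg Prod.fst hk'
  have h₄ := congrArg (fun p => p.2.1) hk'
  simp only at h₁ h₂ h₃ h₄
  rw [h₁, h₂, h₃, h₄]
  linear_combination k * k' * h

theorem exists_smul_of_common_point {a b c a' b' c' u v : F} (hab : a ≠ 0 ∨ b ≠ 0)
    (hab' : a' ≠ 0 ∨ b' ≠ 0) (h : a * b' = a' * b) (h₁ : a * u + b * v + c = 0)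
    (h₂ : a' * u + b' * v + c' = 0) : ∃ k, k ≠ 0 ∧ a' = k * a ∧ b' = k * b ∧ c' = k * c := by
  obtain ⟨k, hk, hk'⟩ : ∃ k, a' = k * a ∧ b' = k * b := by
    rcases hab with ha | hb
    · exact ⟨a' / a, by field_simp, by field_simp; linear_combination h⟩
    · exact ⟨b' / b, by field_simp; linear_combination -h, by field_simp⟩
  rw [hk, hk'] at h₂
  refine ⟨k, ?_, hk, hk', by linear_combination h₂ - k * h₁⟩
  rintro rfl
  simp [hk, hk'] at hab'

/-- Equations of the same line are proportional. -/
theorem Str.AffineChart.eq_smul {M : Str.{u} planeSig} {x y : M.Pt → F}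
    (h : Str.AffineChart x y) {l : M.Ln} {a b c a' b' c' : F} (h₁ : Str.HasEq x y l a b c)
    (h₂ : Str.HasEq x y l a' b' c') : ∃ k, k ≠ 0 ∧ a' = k * a ∧ b' = k * b ∧ c' = k * c := by
  obtain ⟨A, hA⟩ := h.exists_point_on h₁
  exact exists_smul_of_common_point h₁.1 h₂.1 ((h.parEq_iff h₁ h₂).1 (.inr rfl))
    ((h₁.2 A).1 hA) ((h₂.2 A).1 hA)

theorem cartesianPlane_affineChart :
    Str.AffineChart (M := cartesianPlane F) (Prod.fst : F × F → F) Prod.snd where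
  ext A B h₁ h₂ := Prod.ext h₁ h₂
  exists_pt a b := ⟨(a, b), rfl, rfl⟩
  exists_eq l := by
    obtain ⟨e, rfl⟩ := Quotient.exists_rep l
    exact ⟨_, _, _, cartesianPlane_hasEq e⟩
  exists_line a b c hab := ⟨_, cartesianPlane_hasEq ⟨(a, b, c), hab⟩⟩
  line_ext l m h := by
    obtain ⟨⟨⟨a, b, c⟩, hab⟩, rfl⟩ := Quotient.exists_rep l
    obtain ⟨⟨⟨a', b', c'⟩, hab'⟩, rfl⟩ := Quotient.exists_rep m
    have h' : ∀ u v : F, a * u + b * v + c = 0 → a' * u + b' * v + c' = 0 := fun u v h₁ =>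
      ((cartesianPlane_hasEq ⟨(a', b', c'), hab'⟩).2 (u, v)).1
        ((h (u, v)).1 (((cartesianPlane_hasEq ⟨(a, b, c), hab⟩).2 (u, v)).2 h₁))
    obtain ⟨u, v, huv⟩ : ∃ u v, a * u + b * v + c = 0 := by
      rcases hab with ha | hb
      · simp only at ha
        exact ⟨-c / a, 0, by field_simp; ring⟩
      · simp only at hb
        exact ⟨0, -c / b, by field_simp; ring⟩
    have h₁ := h' u v huv
    -- A second point of the line, displaced by its direction vector; containing both points makes
    -- the other equation proportional.
    have h₂ := h' (u + b) (v - a) (by linear_combination huv)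
    obtain ⟨k, hk, h₃, h₄, h₅⟩ := exists_smul_of_common_point hab hab'
      (by linear_combination h₁ - h₂) huv h₁
    exact Quotient.sound ⟨k, hk, Prod.ext h₃ (Prod.ext h₄ h₅)⟩

theorem cartesianPlane_chart :
    Str.EuclideanChart (M := cartesianPlane F) (Prod.fst : F × F → F) Prod.snd where
  toAffineChart := cartesianPlane_affineChart
  perp_iff {l m a b c a' b' c'} h₁ h₂ := by
    obtain ⟨e, rfl⟩ := Quotient.exists_rep l
    obtain ⟨f, rfl⟩ := Quotient.exists_rep m
    obtain ⟨k, hk, h₃, h₄, -⟩ := cartesianPlane_affineChart.eq_smul (cartesianPlane_hasEq e) h₁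
    obtain ⟨k', hk', h₅, h₆, -⟩ := cartesianPlane_affineChart.eq_smul (cartesianPlane_hasEq f) h₂
    refine (cartesianPlane_perp_iff e f).trans ?_
    rw [h₃, h₄, h₅, h₆]
    constructor
    · intro h₇
      linear_combination k * k' * h₇
    · intro h₇
      refine mul_left_cancel₀ (mul_ne_zero hk hk') ?_
      linear_combination h₇
  be_iff {A B C} := by
    refine and_congr_right fun _ => exists_congr fun t =>
      and_congr_right fun _ => and_congr_right fun _ => ?_
    exact Prod.ext_iff

/-- A chart identifies the plane with the Cartesian plane. -/
theorem Str.EuclideanChart.exists_iso {M : Str.{u} planeSig} {x y : M.Pt → F}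
    (h : Str.EuclideanChart x y) : ∃ e : Str.Iso M (cartesianPlane F),
      (∀ A, e.toEquiv .point A = ((x A, y A) : F × F)) ∧ ∀ l (c : LineEq F),
        Str.HasEq x y l c.1.1 c.1.2.1 c.1.2.2 →
          e.toEquiv .line l = (Quotient.mk (lineSetoid F) c : CartesianLine F) := by
  have hl : ∀ l : M.Ln, ∃ c : LineEq F, Str.HasEq x y l c.1.1 c.1.2.1 c.1.2.2 := by
    intro l
    obtain ⟨a, b, c, hl⟩ := h.exists_eq l
    exact ⟨⟨(a, b, c), hl.1⟩, hl⟩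
  choose q hq using hl
  let g : M.Ln → CartesianLine F := fun l => Quotient.mk (lineSetoid F) (q l)
  have hg : ∀ l (c : LineEq F), Str.HasEq x y l c.1.1 c.1.2.1 c.1.2.2 →
      g l = Quotient.mk (lineSetoid F) c := by
    intro l c hc
    obtain ⟨k, hk, h₁, h₂, h₃⟩ := h.eq_smul (hq l) hc
    exact Quotient.sound ⟨k, hk, Prod.ext h₁ (Prod.ext h₂ h₃)⟩
  have hgb : Function.Bijective g := by
    constructor
    · intro l m hlm
      obtain ⟨k, -, hk⟩ := Quotient.exact hlm
      have hm := hq m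
      rw [hk] at hm
      exact h.line_eq (hq l) hm
    · intro c
      obtain ⟨c, rfl⟩ := Quotient.exists_rep c
      obtain ⟨l, hl⟩ := h.exists_line _ _ c.1.2.2 c.2
      exact ⟨l, hg l c hl⟩
  let f : M.Pt → F × F := fun A => (x A, y A)
  have hf : Function.Bijective f := by
    constructor
    · intro A B hAB
      exact h.ext A B (congrArg Prod.fst hAB) (congrArg Prod.snd hAB)
    · rintro ⟨a, b⟩
      obtain ⟨A, hA, hA'⟩ := h.exists_pt a b
      exact ⟨A, Prod.ext hA hA'⟩
  refine ⟨Str.Iso.ofEquiv (N := cartesianPlane F) (Equiv.ofBijective f hf)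
    (Equiv.ofBijective g hgb) ?_ ?_ ?_, fun A => rfl, hg⟩
  · intro A l
    rw [(hq l).2]
    exact ((cartesianPlane_hasEq (q l)).2 (x A, y A)).symm
  · intro l m
    rw [h.perp_iff (hq l) (hq m), one_mul]
    exact (cartesianPlane_perp_iff (q l) (q m)).symm
  · intro A B C
    rw [h.be_iff]
    refine Iff.trans ?_ (cartesianPlane_chart (F := F)).be_iff.symm
    exact and_congr (hf.injective.ne_iff (x := A) (y := C)).symm Iff.rfl

/-- Charts are transported by isomorphisms. -/
theorem Str.EuclideanChart.comp_iso {M N : Str.{u} planeSig} {x y : N.Pt → F}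
    (h : Str.EuclideanChart x y) (e : Str.Iso M N) :
    Str.EuclideanChart (fun A => x (e.toEquiv .point A)) (fun A => y (e.toEquiv .point A)) := by
  have conv : ∀ {l a b c}, Str.HasEq (fun A => x (e.toEquiv .point A))
      (fun A => y (e.toEquiv .point A)) l a b c ↔ Str.HasEq x y (e.toEquiv .line l) a b c := by
    intro l a b c
    refine and_congr_right fun _ => ?_
    rw [← (e.toEquiv .point).forall_congr_right]
    exact forall_congr' fun A => by rw [e.inc_iff]
  refine ⟨⟨⟨?_, ?_, ?_, ?_, ?_⟩, ?_⟩, ?_⟩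
  · exact fun A B h₁ h₂ => (e.toEquiv .point).injective (h.ext _ _ h₁ h₂)
  · intro a b
    obtain ⟨A, hA⟩ := h.exists_pt a b
    exact ⟨(e.toEquiv .point).symm A, by simpa using hA⟩
  · intro l
    obtain ⟨a, b, c, hl⟩ := h.exists_eq (e.toEquiv .line l)
    exact ⟨a, b, c, conv.2 hl⟩
  · intro a b c hab
    obtain ⟨l, hl⟩ := h.exists_line a b c hab
    exact ⟨(e.toEquiv .line).symm l, conv.2 (by simpa using hl)⟩
  · intro l m hlm
    refine (e.toEquiv .line).injective (h.line_ext _ _ fun A => ?_)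
    obtain ⟨B, rfl⟩ := (e.toEquiv .point).surjective A
    rw [← e.inc_iff, ← e.inc_iff]
    exact hlm B
  · intro l m a b c a' b' c' h₁ h₂
    rw [e.perp_iff]
    exact h.perp_iff (conv.1 h₁) (conv.1 h₂)
  · intro A B C
    rw [e.be_iff, h.be_iff]
    exact and_congr ((e.toEquiv .point).injective.ne_iff) Iff.rfl

theorem isEuclideanOrderedMetricWu_of_iso (hF : IsEuclideanField F) {M : Str.{u} planeSig}
    (e : Str.Iso M (cartesianPlane F)) : M.IsEuclideanOrderedMetricWu :=
  (cartesianPlane_chart.comp_iso e).isEuclideanOrderedMetricWu hF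

end Cartesian

/-! ### Coordinatization -/

namespace Str

/-! ### Affine changes of coordinates -/

section AffineChange

variable {M : Str.{u} planeSig} {F : Type u} [Field F] {x y x' y' : M.Pt → F}
  {p q r p' q' r' : F}

theorem hasEq_affine_change (hd : p * q' - p' * q ≠ 0) (hx : ∀ A, x' A = p * x A + q * y A + r)
    (hy : ∀ A, y' A = p' * x A + q' * y A + r') {l : M.Ln} {a b c : F} :
    HasEq x' y' l a b c ↔
      HasEq x y l (a * p + b * p') (a * q + b * q') (a * r + b * r' + c) := by
  refine and_congr ?_ (forall_congr' fun A => ?_)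
  · rw [← not_iff_not, not_or, not_or, not_not, not_not, not_not, not_not]
    constructor
    · rintro ⟨rfl, rfl⟩
      simp
    · rintro ⟨h₁, h₂⟩
      exact ⟨mul_right_cancel₀ hd (by linear_combination q' * h₁ - p' * h₂),
        mul_right_cancel₀ hd (by linear_combination p * h₂ - q * h₁)⟩
  · have : a * x' A + b * y' A + c =
        (a * p + b * p') * x A + (a * q + b * q') * y A + (a * r + b * r' + c) := by
      rw [hx, hy]
      ring
    rw [this]

theorem isRatio_affine_change (hd : p * q' - p' * q ≠ 0)
    (hx : ∀ A, x' A = p * x A + q * y A + r) (hy : ∀ A, y' A = p' * x A + q' * y A + r')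
    {t : F} {A B C : M.Pt} : IsRatio x' y' t A B C ↔ IsRatio x y t A B C := by
  unfold IsRatio
  simp only [hx, hy]
  constructor
  · rintro ⟨h₁, h₂⟩
    exact ⟨mul_right_cancel₀ hd (by linear_combination q' * h₁ - q * h₂),
      mul_right_cancel₀ hd (by linear_combination p * h₂ - p' * h₁)⟩
  · rintro ⟨h₁, h₂⟩
    exact ⟨by linear_combination p * h₁ + q * h₂, by linear_combination p' * h₁ + q' * h₂⟩

theorem AffineChart.affine_change (h : AffineChart x y) (hd : p * q' - p' * q ≠ 0)
    (hx : ∀ A, x' A = p * x A + q * y A + r) (hy : ∀ A, y' A = p' * x A + q' * y A + r') :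
    AffineChart x' y' where
  ext A B h₁ h₂ := by
    rw [hx, hx] at h₁
    rw [hy, hy] at h₂
    exact h.ext A B (mul_right_cancel₀ hd (by linear_combination q' * h₁ - q * h₂))
      (mul_right_cancel₀ hd (by linear_combination p * h₂ - p' * h₁))
  exists_pt a b := by
    obtain ⟨d, hdef⟩ : ∃ d, d = p * q' - p' * q := ⟨_, rfl⟩
    rw [← hdef] at hd
    obtain ⟨A, h₁, h₂⟩ := h.exists_pt ((q' * (a - r) - q * (b - r')) / d)
      ((p * (b - r') - p' * (a - r)) / d)
    refine ⟨A, ?_, ?_⟩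
    · rw [hx, h₁, h₂]
      field_simp
      linear_combination (r - a) * hdef
    · rw [hy, h₁, h₂]
      field_simp
      linear_combination (r' - b) * hdef
  exists_eq l := by
    obtain ⟨a, b, c, hl⟩ := h.exists_eq l
    obtain ⟨d, hdef⟩ : ∃ d, d = p * q' - p' * q := ⟨_, rfl⟩
    have hd' : d ≠ 0 := hdef ▸ hd
    refine ⟨(a * q' - b * p') / d, (b * p - a * q) / d,
      c - (a * q' - b * p') / d * r - (b * p - a * q) / d * r',
      (hasEq_affine_change hd hx hy).2 ?_⟩
    convert hl using 1
    · field_simp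
      linear_combination -a * hdef
    · field_simp
      linear_combination -b * hdef
    · ring
  exists_line a b c hab := by
    have : a * p + b * p' ≠ 0 ∨ a * q + b * q' ≠ 0 := by
      contrapose! hab
      exact ⟨mul_right_cancel₀ hd (by linear_combination q' * hab.1 - p' * hab.2),
        mul_right_cancel₀ hd (by linear_combination p * hab.2 - q * hab.1)⟩
    obtain ⟨l, hl⟩ := h.exists_line _ _ (a * r + b * r' + c) this
    exact ⟨l, (hasEq_affine_change hd hx hy).2 hl⟩
  line_ext := h.line_ext

end AffineChange

variable {M : Str.{u} planeSig} {F : Type u} [Field F] {x y : M.Pt → F}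

/-- Coordinates `u`, `v` with axes `l₀`, `m₀` and unit point `Z₀`, in a plane with coordinates
`x`, `y`. -/
structure AxisChart (x y : M.Pt → F) (l₀ m₀ : M.Ln) (Z₀ : M.Pt) (u v : M.Pt → F) : Prop
    extends AffineChart u v where
  inc_left : ∀ {A}, M.Inc A l₀ ↔ v A = 0
  inc_right : ∀ {A}, M.Inc A m₀ ↔ u A = 0
  fst_unit : u Z₀ = 1
  snd_unit : v Z₀ = 1
  ratio : ∀ {t A B C}, IsRatio u v t A B C ↔ IsRatio x y t A B C

/-- Parallel axes with a common point would be one line, which has more than one point, contrary to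
the uniqueness of the origin. -/
theorem AffineChart.det_ne_zero (h : AffineChart x y) {l m : M.Ln} {Z : M.Pt}
    (hadm : M.AdmissibleAxes l m Z) {a b c a' b' c' : F} (hl : HasEq x y l a b c)
    (hm : HasEq x y m a' b' c') : a * b' ≠ a' * b := by
  intro hd
  obtain ⟨O, ⟨hO, hO'⟩, huniq⟩ := hadm.1
  obtain ⟨k, hk, rfl, rfl, rfl⟩ :=
    exists_smul_of_common_point hl.1 hm.1 hd ((hl.2 O).1 hO) ((hm.2 O).1 hO')
  obtain rfl := h.line_eq hl hm
  obtain ⟨A, hA, hA'⟩ := h.exists_pt (x O + b) (y O - a)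
  have h₁ := (hl.2 O).1 hO
  have h₂ : M.Inc A l := (hl.2 A).2 (by rw [hA, hA']; linear_combination h₁)
  obtain rfl := huniq A ⟨h₂, h₂⟩
  have h₃ := hl.1
  simp only [left_eq_add] at hA
  simp only [eq_comm (a := y A), sub_eq_self] at hA'
  simp [hA, hA'] at h₃

/-- The equations of `m₀` and `l₀` vanish on the axes and, divided by their values at Z₀, become 1
at the unit point; as functions of a point they are the coordinates sought. -/
theorem AffineChart.axisChart (h : AffineChart x y) {l₀ m₀ : M.Ln} {Z₀ : M.Pt}
    (hadm : M.AdmissibleAxes l₀ m₀ Z₀) {a b c a' b' c' : F} (hl : HasEq x y l₀ a b c)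
    (hm : HasEq x y m₀ a' b' c') :
    AxisChart x y l₀ m₀ Z₀ (fun A => (a' * x A + b' * y A + c') / (a' * x Z₀ + b' * y Z₀ + c'))
      (fun A => (a * x A + b * y A + c) / (a * x Z₀ + b * y Z₀ + c)) := by
  have hd := sub_ne_zero.2 (h.det_ne_zero hadm hl hm)
  have hs : a * x Z₀ + b * y Z₀ + c ≠ 0 := fun h₁ => hadm.2.1 ((hl.2 _).2 h₁)
  have hs' : a' * x Z₀ + b' * y Z₀ + c' ≠ 0 := fun h₁ => hadm.2.2 ((hm.2 _).2 h₁)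
  set s := a * x Z₀ + b * y Z₀ + c
  set s' := a' * x Z₀ + b' * y Z₀ + c'
  have hd' : a' / s' * (b / s) - a / s * (b' / s') ≠ 0 := by
    have : a' / s' * (b / s) - a / s * (b' / s') = -(a * b' - a' * b) / (s * s') := by
      field_simp
      ring
    rw [this]
    exact div_ne_zero (neg_ne_zero.2 hd) (mul_ne_zero hs hs')
  have hx : ∀ A, (a' * x A + b' * y A + c') / s' = a' / s' * x A + b' / s' * y A + c' / s' :=
    fun A => by ring
  have hy : ∀ A, (a * x A + b * y A + c) / s = a / s * x A + b / s * y A + c / s :=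
    fun A => by ring
  exact
    { h.affine_change hd' hx hy with
      inc_left := fun {A} => by rw [hl.2, div_eq_zero_iff, or_iff_left hs]
      inc_right := fun {A} => by rw [hm.2, div_eq_zero_iff, or_iff_left hs']
      fst_unit := div_self hs'
      snd_unit := div_self hs
      ratio := isRatio_affine_change hd' hx hy }

theorem AffineChart.exists_axisChart (h : AffineChart x y) {l₀ m₀ : M.Ln} {Z₀ : M.Pt}
    (hadm : M.AdmissibleAxes l₀ m₀ Z₀) : ∃ u v, AxisChart x y l₀ m₀ Z₀ u v := by
  obtain ⟨a, b, c, hl⟩ := h.exists_eq l₀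
  obtain ⟨a', b', c', hm⟩ := h.exists_eq m₀
  exact ⟨_, _, h.axisChart hadm hl hm⟩

/-! ### The geometric operations in coordinates adapted to the axes -/

namespace AxisChart

variable {l₀ m₀ : M.Ln} {Z₀ : M.Pt} {u v : M.Pt → F} (h : AxisChart x y l₀ m₀ Z₀ u v)
include h

theorem hasEq_left : HasEq u v l₀ 0 1 0 :=
  ⟨.inr one_ne_zero, fun A => by rw [h.inc_left]; simp⟩

theorem hasEq_right : HasEq u v m₀ 1 0 0 :=
  ⟨.inl one_ne_zero, fun A => by rw [h.inc_right]; simp⟩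

theorem along_left {A B : M.Pt} : M.Along l₀ A B ↔ v A = v B := by
  rw [h.along_iff h.hasEq_left, zero_mul, zero_add, one_mul, sub_eq_zero, eq_comm]

theorem along_right {A B : M.Pt} : M.Along m₀ A B ↔ u A = u B := by
  rw [h.along_iff h.hasEq_right, zero_mul, add_zero, one_mul, sub_eq_zero, eq_comm]

theorem isOrigin_iff {A : M.Pt} : M.IsOrigin l₀ m₀ A ↔ v A = 0 ∧ u A = 0 :=
  and_congr h.inc_left h.inc_right

theorem isUnitPt_iff {A : M.Pt} : M.IsUnitPt l₀ m₀ Z₀ A ↔ v A = 0 ∧ u A = 1 := by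
  rw [IsUnitPt, h.inc_left, h.along_right, h.fst_unit, eq_comm (a := (1 : F))]

theorem axisBij_iff {X Y : M.Pt} : M.AxisBij l₀ m₀ Z₀ X Y ↔ v X = 0 ∧ u Y = 0 ∧ u X = v Y := by
  unfold AxisBij
  rw [h.inc_left, h.inc_right]
  refine and_congr_right fun hX => and_congr_right fun hY => ?_
  simp only [h.isOrigin_iff, h.along_left, h.along_right]
  constructor
  · rintro ⟨O, d, H, ⟨hO, hO'⟩, hOd, hZd, hHd, h₁, h₂⟩
    have hne : O ≠ Z₀ := by
      rintro rfl
      exact one_ne_zero (h.fst_unit.symm.trans hO')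
    have h₃ := ((h.hasEq_of_inc hne hOd hZd).2 H).1 hHd
    rw [hO, hO', h.fst_unit, h.snd_unit] at h₃
    rw [h₁, ← h₂]
    linear_combination h₃
  · intro hXY
    obtain ⟨d, hd⟩ := h.exists_line 1 (-1) 0 (.inl one_ne_zero)
    obtain ⟨O, hO, hO'⟩ := h.exists_pt 0 0
    obtain ⟨H, hH, hH'⟩ := h.exists_pt (u X) (v Y)
    refine ⟨O, d, H, ⟨hO', hO⟩, (hd.2 O).2 ?_, (hd.2 Z₀).2 ?_, (hd.2 H).2 ?_, hH.symm, hH'⟩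
    · rw [hO, hO']; ring
    · rw [h.fst_unit, h.snd_unit]; ring
    · rw [hH, hH', hXY]; ring

theorem coord_iff {P X Y : M.Pt} :
    M.Coord l₀ m₀ Z₀ P X Y ↔ (v X = 0 ∧ u X = u P) ∧ v Y = 0 ∧ u Y = v P := by
  unfold Coord
  rw [h.inc_left, h.along_right, and_assoc, eq_comm (a := u P)]
  refine and_congr_right fun _ => and_congr_right fun _ => ?_
  simp only [h.inc_right, h.along_left, h.axisBij_iff]
  constructor
  · rintro ⟨W, hW, h₁, h₂, -, h₃⟩
    exact ⟨h₂, h₃.trans h₁.symm⟩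
  · rintro ⟨h₁, h₂⟩
    obtain ⟨W, hW, hW'⟩ := h.exists_pt 0 (v P)
    exact ⟨W, hW, hW'.symm, h₁, hW, h₂.trans hW'.symm⟩

theorem slope_iff {l : M.Ln} {A : M.Pt} :
    M.Slope l₀ m₀ Z₀ l A ↔ v A = 0 ∧ ∃ c, HasEq u v l (u A) (-1) c := by
  obtain ⟨a, b, c, hl⟩ := h.exists_eq l
  have hp : M.Par l m₀ ∨ l = m₀ ↔ b = 0 := by
    refine (h.parEq_iff hl h.hasEq_right).trans ?_
    rw [mul_zero, one_mul, eq_comm]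
  unfold Slope
  rw [hp]
  simp only [h.isOrigin_iff, h.isUnitPt_iff, h.coord_iff]
  constructor
  · rintro ⟨hb, O, I, k, Q, ⟨hO, hO'⟩, ⟨hI, hI'⟩, hOk, hkl, hQk, ⟨-, h₁⟩, h₂, h₃⟩
    refine ⟨h₂, -(c / b), ?_⟩
    obtain ⟨a', b', c', hk⟩ := h.exists_eq k
    have h₄ := (h.parEq_iff hk hl).1 hkl
    have h₅ := (hk.2 O).1 hOk
    have h₆ := (hk.2 Q).1 hQk
    rw [hO, hO'] at h₅
    rw [← h₁, hI'] at h₆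
    have hb' : b' ≠ 0 := by
      rintro rfl
      have h₇ := hk.1
      have h₈ : a' ≠ 0 := by simpa using h₇
      exact (mul_ne_zero h₈ hb) (by linear_combination h₄)
    have h₇ : a + b * u A = 0 := mul_left_cancel₀ hb' (by
      rw [h₃]; linear_combination b * h₆ - b * h₅ - h₄)
    refine ⟨.inr (neg_ne_zero.2 one_ne_zero), fun B => (hl.2 B).trans ?_⟩
    have h₈ : a * u B + b * v B + c = -b * (u A * u B + -1 * v B + -(c / b)) := by
      field_simp
      linear_combination u B * h₇
    rw [h₈, mul_eq_zero, or_iff_right (neg_ne_zero.2 hb)]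
  · rintro ⟨hA, c', hl'⟩
    obtain ⟨s, hs, h₁, h₂, -⟩ := h.eq_smul hl' hl
    obtain ⟨O, hO, hO'⟩ := h.exists_pt 0 0
    obtain ⟨I, hI, hI'⟩ := h.exists_pt 1 0
    obtain ⟨Q, hQ, hQ'⟩ := h.exists_pt 1 (u A)
    obtain ⟨k, hk⟩ := h.exists_line (u A) (-1) 0 (.inr (neg_ne_zero.2 one_ne_zero))
    refine ⟨?_, O, I, k, Q, ⟨hO', hO⟩, ⟨hI', hI⟩, (hk.2 O).2 ?_, (h.parEq_iff hk hl').2 rfl,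
      (hk.2 Q).2 ?_, ⟨hI', hI.trans hQ.symm⟩, hA, hQ'.symm⟩
    · rw [h₂]
      simpa using hs
    · rw [hO, hO']; ring
    · rw [hQ, hQ']; ring

/-- In these coordinates the line of slope a through (0, b) is v = au + b, and the bijection of the
axes is the diagonal u = v. The ternary operation therefore is ax + b. -/
theorem ter_iff {A X B Y : M.Pt} : M.Ter l₀ m₀ Z₀ A X B Y ↔
    (v A = 0 ∧ v X = 0 ∧ v B = 0 ∧ v Y = 0) ∧ u Y = u A * u X + u B := by
  unfold Ter
  simp only [h.slope_iff, h.isOrigin_iff, h.coord_iff]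
  constructor
  · rintro ⟨l, O, P, Q, ⟨hA, c, hl⟩, ⟨hO, hO'⟩, hP, ⟨⟨-, hP'⟩, hB, hB'⟩, hQ, ⟨hX, hX'⟩,
      hY, hY'⟩
    have h₁ := (hl.2 P).1 hP
    have h₂ := (hl.2 Q).1 hQ
    rw [← hP', ← hB', hO'] at h₁
    rw [← hX', ← hY'] at h₂
    exact ⟨⟨hA, hX, hB, hY⟩, by linear_combination h₁ - h₂⟩
  · rintro ⟨⟨hA, hX, hB, hY⟩, hXY⟩
    obtain ⟨l, hl⟩ := h.exists_line (u A) (-1) (u B) (.inr (neg_ne_zero.2 one_ne_zero))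
    obtain ⟨O, hO, hO'⟩ := h.exists_pt 0 0
    obtain ⟨P, hP, hP'⟩ := h.exists_pt 0 (u B)
    obtain ⟨Q, hQ, hQ'⟩ := h.exists_pt (u X) (u Y)
    refine ⟨l, O, P, Q, ⟨hA, _, hl⟩, ⟨hO', hO⟩, (hl.2 P).2 ?_,
      ⟨⟨hO', hO.trans hP.symm⟩, hB, hP'.symm⟩, (hl.2 Q).2 ?_, ⟨hX, hQ.symm⟩, hY, hQ'.symm⟩
    · rw [hP, hP']; ring
    · rw [hQ, hQ', hXY]; ring

/-- The first coordinate on the axis `l₀`. -/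
noncomputable def equiv : M.PointsOn l₀ ≃ F :=
  Equiv.ofBijective (fun A => u A.1)
    ⟨fun A B hAB => Subtype.ext (h.ext _ _ hAB
      ((h.inc_left.1 A.2).trans (h.inc_left.1 B.2).symm)), fun a => by
        obtain ⟨A, hA, hA'⟩ := h.exists_pt a 0
        exact ⟨⟨A, h.inc_left.2 hA'⟩, hA⟩⟩

theorem add_iff (A B C : M.PointsOn l₀) :
    (∃ I, M.IsUnitPt l₀ m₀ Z₀ I ∧ M.Ter l₀ m₀ Z₀ A.1 I B.1 C.1) ↔ u A.1 + u B.1 = u C.1 := by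
  simp only [h.isUnitPt_iff, h.ter_iff]
  constructor
  · rintro ⟨I, ⟨-, hI⟩, -, h₁⟩
    rw [h₁, hI, mul_one]
  · intro h₁
    obtain ⟨I, hI, hI'⟩ := h.exists_pt 1 0
    exact ⟨I, ⟨hI', hI⟩, ⟨h.inc_left.1 A.2, hI', h.inc_left.1 B.2, h.inc_left.1 C.2⟩,
      by rw [hI, mul_one, h₁]⟩

theorem mul_iff (A B C : M.PointsOn l₀) :
    (∃ O, M.IsOrigin l₀ m₀ O ∧ M.Ter l₀ m₀ Z₀ A.1 B.1 O C.1) ↔ u A.1 * u B.1 = u C.1 := by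
  simp only [h.isOrigin_iff, h.ter_iff]
  constructor
  · rintro ⟨O, ⟨-, hO⟩, -, h₁⟩
    rw [h₁, hO, add_zero]
  · intro h₁
    obtain ⟨O, hO, hO'⟩ := h.exists_pt 0 0
    exact ⟨O, ⟨hO', hO⟩, ⟨h.inc_left.1 A.2, h.inc_left.1 B.2, hO', h.inc_left.1 C.2⟩,
      by rw [hO, add_zero, h₁]⟩

theorem zero_iff (A : M.PointsOn l₀) : M.IsOrigin l₀ m₀ A.1 ↔ u A.1 = 0 := by
  rw [h.isOrigin_iff, and_iff_right (h.inc_left.1 A.2)]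

theorem one_iff (A : M.PointsOn l₀) : M.IsUnitPt l₀ m₀ Z₀ A.1 ↔ u A.1 = 1 := by
  rw [h.isUnitPt_iff, and_iff_right (h.inc_left.1 A.2)]

end AxisChart

end Str

/-! ### Isomorphisms of fields -/

/-- Isomorphisms of structures of signature `fieldSig`. -/
def Str.Iso.ofFieldEquiv {F F' : Type u} {add mul : F → F → F → Prop} {zero one : F → Prop}
    {add' mul' : F' → F' → F' → Prop} {zero' one' : F' → Prop} (f : F ≃ F')
    (hadd : ∀ a b c, add a b c ↔ add' (f a) (f b) (f c))
    (hmul : ∀ a b c, mul a b c ↔ mul' (f a) (f b) (f c))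
    (hzero : ∀ a, zero a ↔ zero' (f a)) (hone : ∀ a, one a ↔ one' (f a)) :
    Str.Iso (mkFieldStr F add mul zero one) (mkFieldStr F' add' mul' zero' one') where
  toEquiv _ := f
  map_rel r x := by
    cases r
    · exact hadd _ _ _
    · exact hmul _ _ _
    · exact hzero _
    · exact hone _

/-- The coordinate structure is isomorphic to the field of coordinates. -/
noncomputable def Str.AxisChart.iso {M : Str.{u} planeSig} {F : Type u} [Field F] {x y : M.Pt → F}
    {l₀ m₀ : M.Ln} {Z₀ : M.Pt} {u v : M.Pt → F} (h : Str.AxisChart x y l₀ m₀ Z₀ u v) :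
    Str.Iso (M.coordField l₀ m₀ Z₀) (fieldStr F) :=
  Str.Iso.ofFieldEquiv h.equiv h.add_iff h.mul_iff h.zero_iff h.one_iff

/-! ### Euclidean fields under ring isomorphisms -/

section RingEquiv

variable {F K : Type u} [Field F] [Field K]

theorem isSumSq_map (e : K →+* F) {a : K} (ha : IsSumSq a) : IsSumSq (e a) := by
  induction ha with
  | zero => simp
  | sq_add a _ ih =>
    rw [map_add, map_mul]
    exact .sq_add _ ih

theorem IsEuclideanField.of_ringEquiv (e : K ≃+* F) (hF : IsEuclideanField F) :
    IsEuclideanField K where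
  formallyReal hs := by
    refine hF.formallyReal ?_
    have := isSumSq_map (e : K →+* F) hs
    simpa using this
  pythagorean a b := by
    obtain ⟨z, hz⟩ := hF.pythagorean (e a) (e b)
    exact ⟨e.symm z, e.injective (by simpa using hz)⟩
  square_or_neg_square a := by
    obtain ⟨z, hz⟩ := hF.square_or_neg_square (e a)
    exact ⟨e.symm z, hz.imp (fun h => e.injective (by simpa using h))
      (fun h => e.injective (by simpa using h))⟩

theorem sqLt_map (e : K ≃+* F) {a b : K} : SqLt (e a) (e b) ↔ SqLt a b := by
  refine and_congr e.injective.ne_iff ?_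
  rw [e.surjective.exists]
  exact exists_congr fun z => by rw [← e.injective.eq_iff, map_add, map_pow]

end RingEquiv

namespace Str

variable {M : Str.{u} planeSig} {F : Type u} [Field F] {x y : M.Pt → F}

/-! ### The coordinate field -/

theorem AxisChart.positive_iff {l₀ m₀ : M.Ln} {Z₀ : M.Pt} {u v : M.Pt → F}
    (h : AxisChart x y l₀ m₀ Z₀ u v) (hE : EuclideanChart x y) [LinearOrder F]
    [IsStrictOrderedRing F] (hlt : ∀ a b : F, SqLt a b ↔ a < b) {A : M.Pt} (hA : v A = 0) :
    M.Positive l₀ m₀ Z₀ A ↔ 0 < u A := by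
  unfold Positive
  simp only [h.isOrigin_iff, h.isUnitPt_iff, hA, true_and]
  constructor
  · rintro ⟨h₁, h₂⟩
    by_contra h₃
    have h₄ : u A < 0 := lt_of_le_of_ne (not_lt.1 h₃) h₁
    obtain ⟨O, hO, hO'⟩ := h.exists_pt 0 0
    obtain ⟨I, hI, hI'⟩ := h.exists_pt 1 0
    have h₅ : u A - 1 < 0 := by linarith
    -- On the axis, 0 = a + t(1 - a) holds for t = a/(a - 1), which is between 0 and 1 when a is
    -- negative.
    refine h₂ O I ⟨hO', hO⟩ ⟨hI', hI⟩ (hE.be_iff.2 ⟨h.ne_iff.2 (.inl ?_), u A / (u A - 1), ?_, ?_,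
      h.ratio.1 ⟨?_, ?_⟩⟩)
    · rw [hI]
      linarith
    · exact (hlt _ _).2 (div_pos_of_neg_of_neg h₄ h₅)
    · rw [hlt, div_lt_one_of_neg h₅]
      linarith
    · have := h₅.ne
      rw [hO, hI]
      field_simp
      ring
    · rw [hO', hI', hA]
      ring
  · intro h₁
    refine ⟨h₁.ne', fun O I hO hI hb => ?_⟩
    obtain ⟨-, t, ht, ht', hr⟩ := hE.be_iff.1 hb
    rw [hlt] at ht ht'
    have h₂ := (h.ratio.2 hr).1
    rw [hO.2, hI.2] at h₂
    have h₃ : 0 < u A * (1 - t) := mul_pos h₁ (by linarith)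
    linarith

/-- The coordinate structure is a Euclidean field, ordered by the geometric positivity. -/
theorem EuclideanChart.exists_coordField (hE : EuclideanChart x y) (hF : IsEuclideanField F)
    {l₀ m₀ : M.Ln} {Z₀ : M.Pt} (hadm : M.AdmissibleAxes l₀ m₀ Z₀) :
    ∃ _ : Field (M.PointsOn l₀), M.coordField l₀ m₀ Z₀ = fieldStr (M.PointsOn l₀) ∧
      IsEuclideanField (M.PointsOn l₀) ∧
        ∀ a b : M.PointsOn l₀, SqLt a b ↔ M.Positive l₀ m₀ Z₀ (b - a).1 := by
  obtain ⟨u, v, h⟩ := hE.exists_axisChart hadm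
  -- The field structure is pulled back along the coordinate u; its operations have the geometric
  -- graphs.
  let _ : Field (M.PointsOn l₀) := h.equiv.field
  let e : M.PointsOn l₀ ≃+* F := h.equiv.ringEquiv
  have he : ∀ A, e A = u A.1 := fun _ => rfl
  refine ⟨inferInstance, ?_, hF.of_ringEquiv e, fun a b => ?_⟩
  · have h₁ : ∀ A B C : M.PointsOn l₀, u A.1 + u B.1 = u C.1 ↔ A + B = C := fun A B C => by
      rw [← e.injective.eq_iff, map_add, he, he, he]
    have h₂ : ∀ A B C : M.PointsOn l₀, u A.1 * u B.1 = u C.1 ↔ A * B = C := fun A B C => by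
      rw [← e.injective.eq_iff, map_mul, he, he, he]
    have h₃ : ∀ A : M.PointsOn l₀, u A.1 = 0 ↔ A = 0 := fun A => by
      rw [← e.injective.eq_iff, map_zero, he]
    have h₄ : ∀ A : M.PointsOn l₀, u A.1 = 1 ↔ A = 1 := fun A => by
      rw [← e.injective.eq_iff, map_one, he]
    unfold coordField fieldStr
    congr 1
    · exact funext fun A => funext fun B => funext fun C =>
        propext ((h.add_iff A B C).trans (h₁ A B C))
    · exact funext fun A => funext fun B => funext fun C =>
        propext ((h.mul_iff A B C).trans (h₂ A B C))
    · exact funext fun A => propext ((h.zero_iff A).trans (h₃ A))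
    · exact funext fun A => propext ((h.one_iff A).trans (h₄ A))
  · obtain ⟨_, _, hlt, -⟩ := hF.exists_order
    rw [h.positive_iff hE hlt (h.inc_left.1 (b - a).2), ← he, map_sub, sub_pos, ← hlt, sqLt_map]

/-- The axioms of a chart use only the field structure and its squares. A chart can thus be
rewritten with values in the coordinate field itself. -/
theorem EuclideanChart.map {K : Type u} [Field K] (h : EuclideanChart x y) (e : F ≃+* K) :
    EuclideanChart (fun A => e (x A)) (fun A => e (y A)) := by
  have conv : ∀ {l a b c}, HasEq (fun A => e (x A)) (fun A => e (y A)) l (e a) (e b) (e c) ↔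
      HasEq x y l a b c := by
    intro l a b c
    simp only [HasEq, ne_eq, map_eq_zero, ← map_mul, ← map_add]
  have conv' : ∀ {l a b c}, HasEq (fun A => e (x A)) (fun A => e (y A)) l a b c ↔
      HasEq x y l (e.symm a) (e.symm b) (e.symm c) := by
    intro l a b c
    rw [← conv]
    simp only [RingEquiv.apply_symm_apply]
  refine ⟨⟨⟨fun A B h₁ h₂ => h.ext A B (e.injective h₁) (e.injective h₂), fun a b => ?_, fun l => ?_,
    fun a b c hab => ?_, h.line_ext⟩, fun {l m a b c a' b' c'} hl hm => ?_⟩, fun {A B C} => ?_⟩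
  · obtain ⟨A, hA, hA'⟩ := h.exists_pt (e.symm a) (e.symm b)
    exact ⟨A, by simp [hA], by simp [hA']⟩
  · obtain ⟨a, b, c, hl⟩ := h.exists_eq l
    exact ⟨_, _, _, conv.2 hl⟩
  · obtain ⟨l, hl⟩ := h.exists_line (e.symm a) (e.symm b) (e.symm c) (by simpa using hab)
    exact ⟨l, conv'.2 hl⟩
  · rw [h.perp_iff (conv'.1 hl) (conv'.1 hm), ← e.injective.eq_iff]
    simp
  · rw [h.be_iff]
    refine and_congr_right fun _ => ?_
    rw [e.surjective.exists]
    refine exists_congr fun t => ?_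
    have h₀ : SqLt 0 (e t) ↔ SqLt 0 t := by rw [← map_zero e, sqLt_map]
    have h₁ : SqLt (e t) 1 ↔ SqLt t 1 := by rw [← map_one e, sqLt_map]
    rw [h₀, h₁]
    simp only [IsRatio, ← map_sub, ← map_mul, ← map_add, e.injective.eq_iff]

/-! ### Orthonormal frames -/

/-- The conditions on the matrix say that it is a similarity: its rows are orthogonal and of equal
nonzero length, so dot products of normals change by one nonzero factor. -/
theorem EuclideanChart.affine_change (h : EuclideanChart x y) {u v : M.Pt → F}
    {p q r p' q' r' : F} (hx : ∀ A, u A = p * x A + q * y A + r)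
    (hy : ∀ A, v A = p' * x A + q' * y A + r') (hd : p * q' - p' * q ≠ 0)
    (h₁ : p * p' + q * q' = 0) (h₂ : p ^ 2 + q ^ 2 = p' ^ 2 + q' ^ 2) (h₃ : p ^ 2 + q ^ 2 ≠ 0) :
    EuclideanChart u v where
  toAffineChart := h.toAffineChart.affine_change hd hx hy
  perp_iff {l m a b c a' b' c'} hl hm := by
    rw [h.perp_iff ((hasEq_affine_change hd hx hy).1 hl) ((hasEq_affine_change hd hx hy).1 hm)]
    constructor
    · intro h₄
      refine mul_right_cancel₀ h₃ ?_
      linear_combination h₄ - (a * b' + a' * b) * h₁ + b * b' * h₂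
    · intro h₄
      linear_combination (p ^ 2 + q ^ 2) * h₄ + (a * b' + a' * b) * h₁ - b * b' * h₂
  be_iff {A B C} := by
    rw [h.be_iff]
    simp only [isRatio_affine_change hd hx hy]

/-- The line `m` and the point `Z` determine an orthonormal frame with the same origin and unit
point on `l₀`, such that `Z` lies on the same side of `l₀` as `Z₀`. -/
def OrthoFrame (M : Str.{u} planeSig) (l₀ m₀ : M.Ln) (Z₀ : M.Pt) (m : M.Ln) (Z : M.Pt) : Prop :=
  M.Perp l₀ m ∧ ∃ O I V d d', M.IsOrigin l₀ m₀ O ∧ M.IsUnitPt l₀ m₀ Z₀ I ∧ M.Inc O m ∧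
    M.Along m Z I ∧ M.Inc V m ∧ M.Along l₀ V Z ∧ M.Inc I d ∧ M.Inc V d ∧ M.Inc O d' ∧
    M.Inc Z d' ∧ M.Perp d d' ∧ ∃ X Y, M.Coord l₀ m₀ Z₀ Z X Y ∧ M.Positive l₀ m₀ Z₀ Y

section Frame

variable {l₀ m₀ : M.Ln} {Z₀ : M.Pt} {u v : M.Pt → F}

/-- The origin and the unit point of `l₀` fix u' as the orthogonal projection to `l₀` in units of
OI, and they fix v' up to sign. The sign is settled by the side of `l₀`, so that the frame becomes
definable from the parameters. -/
theorem EuclideanChart.exists_orthonormal (hE : EuclideanChart x y) [LinearOrder F]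
    [IsStrictOrderedRing F] (h : AxisChart x y l₀ m₀ Z₀ u v) :
    ∃ u' v' : M.Pt → F, EuclideanChart u' v' ∧
      (∀ t A B C, IsRatio u' v' t A B C ↔ IsRatio x y t A B C) ∧
      (∀ A, M.Inc A l₀ ↔ v' A = 0) ∧ (∀ A, M.Inc A l₀ → u' A = u A) ∧
      ∀ Z, u' Z = 1 → v' Z = 1 → 0 < v Z := by
  obtain ⟨O, hO, hO'⟩ := h.exists_pt 0 0
  obtain ⟨I, hI, hI'⟩ := h.exists_pt 1 0
  have hOI : O ≠ I := h.ne_iff.2 (.inl (by simp [hO, hI]))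
  obtain ⟨p, hp⟩ : ∃ p, p = x I - x O := ⟨_, rfl⟩
  obtain ⟨q, hq⟩ : ∃ q, q = y I - y O := ⟨_, rfl⟩
  obtain ⟨N, hN⟩ : ∃ N, N = p ^ 2 + q ^ 2 := ⟨_, rfl⟩
  have hN0 : N ≠ 0 := by
    have := hE.ne_iff.1 hOI
    rw [← hp, ← hq] at this
    intro h₀
    rw [hN] at h₀
    have h₁ : p = 0 := by nlinarith [sq_nonneg p, sq_nonneg q]
    have h₂ : q = 0 := by nlinarith [sq_nonneg p, sq_nonneg q]
    simp [h₁, h₂] at this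
  have key : ∀ s : F, s ^ 2 = 1 → ∃ u' v' : M.Pt → F, EuclideanChart u' v' ∧
      (∀ t A B C, IsRatio u' v' t A B C ↔ IsRatio x y t A B C) ∧
      (∀ A, M.Inc A l₀ ↔ v' A = 0) ∧ (∀ A, M.Inc A l₀ → u' A = u A) ∧
      ∀ A, v' A = s * ((-q * (x A - x O) + p * (y A - y O)) / N) ∧
        u' A = (p * (x A - x O) + q * (y A - y O)) / N := by
    intro s hs
    have hs0 : s ≠ 0 := by
      rintro rfl
      simp at hs
    have hd : p / N * (s * p / N) - -(s * q / N) * (q / N) ≠ 0 := by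
      have : p / N * (s * p / N) - -(s * q / N) * (q / N) = s / N := by
        field_simp
        linear_combination -hN
      rw [this]
      exact div_ne_zero hs0 hN0
    have hx : ∀ A, (p * (x A - x O) + q * (y A - y O)) / N =
      p / N * x A + q / N * y A + -(p * x O + q * y O) / N := fun A => by ring
    have hy : ∀ A, s * ((-q * (x A - x O) + p * (y A - y O)) / N) =
      -(s * q / N) * x A + s * p / N * y A + -(s * (-q * x O + p * y O)) / N := fun A => by ring
    refine ⟨_, _, hE.affine_change hx hy hd (by ring) ?_ ?_,
      fun t A B C => isRatio_affine_change hd hx hy, fun A => ?_, fun A hA => ?_,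
      fun A => ⟨rfl, rfl⟩⟩
    · field_simp
      linear_combination -(p ^ 2 + q ^ 2) * hs
    · have : (p / N) ^ 2 + (q / N) ^ 2 = 1 / N := by
        field_simp
        linear_combination -hN
      rw [this]
      exact one_div_ne_zero hN0
    · rw [(hE.hasEq_of_inc hOI (h.inc_left.2 hO') (h.inc_left.2 hI')).2, mul_eq_zero,
        or_iff_right hs0, div_eq_zero_iff, or_iff_left hN0]
      rw [← hp, ← hq]
      constructor
      · intro h₁
        linear_combination -h₁ + x O * hq - y O * hp
      · intro h₁
        linear_combination -h₁ + x O * hq - y O * hp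
    · obtain ⟨h₁, h₂⟩ := h.ratio.1 (show IsRatio u v (u A) O A I from
        ⟨by rw [hO, hI]; ring, by rw [hO', hI', h.inc_left.1 hA]; ring⟩)
      rw [h₁, h₂, ← hp, ← hq]
      field_simp
      linear_combination -u A * hN
  obtain ⟨u₁, v₁, hE₁, hr₁, hl₁, hu₁, hf₁⟩ := key 1 (by ring)
  obtain ⟨u₂, v₂, hE₂, hr₂, hl₂, hu₂, hf₂⟩ := key (-1) (by ring)
  obtain ⟨Z₁, hZ₁, hZ₁'⟩ := hE₁.exists_pt 1 1
  have hZ : v Z₁ ≠ 0 := by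
    intro h₀
    rw [← h.inc_left, hl₁, hZ₁'] at h₀
    exact one_ne_zero h₀
  rcases lt_or_gt_of_ne hZ with hZ | hZ
  · refine ⟨u₂, v₂, hE₂, hr₂, hl₂, hu₂, fun Z h₁ h₂ => ?_⟩
    -- The points (1, 1) of the two candidate frames are symmetric with respect to I, which lies on
    -- `l₀`, so exactly one of them has positive v.
    have h₃ : IsRatio u₁ v₁ (1 / 2) Z₁ I Z := by
      have hIl := h.inc_left.2 hI'
      rw [IsRatio, (hl₁ I).1 hIl, hu₁ I hIl, hI, hZ₁, hZ₁']
      have h₄ : u₁ Z = 1 := (hf₁ Z).2.trans ((hf₂ Z).2.symm.trans h₁)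
      have h₅ : v₁ Z = -1 := by
        linear_combination (hf₁ Z).1 + (hf₂ Z).1 - h₂
      rw [h₄, h₅]
      exact ⟨by ring, by ring⟩
    have h₄ := (h.ratio.2 ((hr₁ _ _ _ _).1 h₃)).2
    rw [hI'] at h₄
    linarith
  · refine ⟨u₁, v₁, hE₁, hr₁, hl₁, hu₁, fun Z h₁ h₂ => ?_⟩
    rwa [hE₁.ext Z Z₁ (h₁.trans hZ₁.symm) (h₂.trans hZ₁'.symm)]

/-- There is exactly one orthonormal frame, and its coordinates form a chart. -/
theorem EuclideanChart.exists_orthoFrame (hE : EuclideanChart x y) (hF : IsEuclideanField F)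
    (h : AxisChart x y l₀ m₀ Z₀ u v) :
    ∃ (u' v' : M.Pt → F) (m₁ : M.Ln) (Z₁ : M.Pt), EuclideanChart u' v' ∧
      (∀ A, M.Inc A l₀ → u' A = u A) ∧ AxisChart x y l₀ m₁ Z₁ u' v' ∧
      ∀ m Z, M.OrthoFrame l₀ m₀ Z₀ m Z ↔ m = m₁ ∧ Z = Z₁ := by
  obtain ⟨_, _, hlt, -⟩ := hF.exists_order
  obtain ⟨u', v', hE', hr, hl, hu, hpos⟩ := hE.exists_orthonormal h
  obtain ⟨Z₁, hZ₁, hZ₁'⟩ := hE'.exists_pt 1 1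
  obtain ⟨m₁, hm₁⟩ := hE'.exists_line 1 0 0 (.inl one_ne_zero)
  have h' : AxisChart x y l₀ m₁ Z₁ u' v' :=
    { hE'.toAffineChart with
      inc_left := hl _
      inc_right := fun {A} => by rw [hm₁.2]; simp
      fst_unit := hZ₁
      snd_unit := hZ₁'
      ratio := hr _ _ _ _ }
  have hO : ∀ {A}, M.IsOrigin l₀ m₀ A ↔ v' A = 0 ∧ u' A = 0 := fun {A} => by
    rw [h.isOrigin_iff, ← hl, ← h.inc_left]
    exact and_congr_right fun hA => by rw [hu A hA]
  have hI : ∀ {A}, M.IsUnitPt l₀ m₀ Z₀ A ↔ v' A = 0 ∧ u' A = 1 := fun {A} => by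
    rw [h.isUnitPt_iff, ← hl, ← h.inc_left]
    exact and_congr_right fun hA => by rw [hu A hA]
  have hside : ∀ {Z}, (∃ X Y, M.Coord l₀ m₀ Z₀ Z X Y ∧ M.Positive l₀ m₀ Z₀ Y) ↔ 0 < v Z := by
    intro Z
    simp only [h.coord_iff]
    constructor
    · rintro ⟨X, Y, ⟨-, hY, hY'⟩, hp⟩
      rwa [← hY', ← h.positive_iff hE hlt hY]
    · intro hZ
      obtain ⟨X, hX, hX'⟩ := h.exists_pt (u Z) 0
      obtain ⟨Y, hY, hY'⟩ := h.exists_pt (v Z) 0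
      exact ⟨X, Y, ⟨⟨hX', hX⟩, hY', hY⟩, (h.positive_iff hE hlt hY').2 (hY ▸ hZ)⟩
  refine ⟨u', v', m₁, Z₁, hE', hu, h', fun m Z => ?_⟩
  unfold OrthoFrame
  simp only [hO, hI, hside]
  constructor
  · rintro ⟨hp, O, I, V, d, d', ⟨hO₁, hO₂⟩, ⟨hI₁, hI₂⟩, hOm, hZI, hVm, hVZ, hId, hVd, hOd, hZd, hdd,
      hZ⟩
    obtain ⟨a, b, c, hm⟩ := hE'.exists_eq m
    have h₁ := (hE'.perp_iff h'.hasEq_left hm).1 hp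
    have hb : b = 0 := by linear_combination h₁
    have h₂ := (hm.2 O).1 hOm
    rw [hO₁, hO₂] at h₂
    obtain rfl : m = m₁ := (hE'.line_eq (k := a) hm₁ (by
      convert hm using 1
      · ring
      · rw [hb]; ring
      · linear_combination -h₂)).symm
    refine ⟨rfl, ?_⟩
    rw [h'.along_right] at hZI
    rw [h'.along_left] at hVZ
    rw [h'.inc_right] at hVm
    have hIV : I ≠ V := hE'.ne_iff.2 (.inl (by rw [hI₂, hVm]; simp))
    have hOZ : O ≠ Z := hE'.ne_iff.2 (.inl (by rw [hZI, hI₂, hO₂]; simp))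
    have h₃ := (hE'.perp_iff (hE'.hasEq_of_inc hIV hId hVd) (hE'.hasEq_of_inc hOZ hOd hZd)).1 hdd
    rw [hI₁, hI₂, hVm, hVZ, hO₁, hO₂, hZI, hI₂] at h₃
    -- The rectangle O, I, Z, V has perpendicular diagonals, hence is a square, which leaves two
    -- positions of Z.
    have h₄ : (v' Z - 1) * (v' Z + 1) = 0 := by linear_combination h₃
    rcases mul_eq_zero.1 h₄ with h₅ | h₅
    · exact hE'.ext _ _ (hZI.trans (hI₂.trans hZ₁.symm)) (by rw [hZ₁']; linear_combination h₅)
    -- In the other position I is the midpoint of Z and Z₁, so v would be positive at both ends and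
    -- zero in the middle.
    · exfalso
      have h₆ : IsRatio u' v' (1 / 2) Z I Z₁ := by
        rw [IsRatio, hI₁, hI₂, hZ₁, hZ₁', hZI, hI₂]
        exact ⟨by ring, by linear_combination -1 / 2 * h₅⟩
      have h₇ := (h.ratio.2 ((hr _ _ _ _).1 h₆)).2
      have h₈ := hpos Z₁ hZ₁ hZ₁'
      rw [h.inc_left.1 ((hl I).2 hI₁)] at h₇
      linarith
  · rintro ⟨rfl, rfl⟩
    obtain ⟨O, hO₁, hO₂⟩ := hE'.exists_pt 0 0
    obtain ⟨I, hI₁, hI₂⟩ := hE'.exists_pt 1 0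
    obtain ⟨V, hV₁, hV₂⟩ := hE'.exists_pt 0 1
    obtain ⟨d, hd⟩ := hE'.exists_line 1 1 (-1) (.inl one_ne_zero)
    obtain ⟨d', hd'⟩ := hE'.exists_line 1 (-1) 0 (.inl one_ne_zero)
    refine ⟨(hE'.perp_iff h'.hasEq_left hm₁).2 (by ring), O, I, V, d, d', ⟨hO₂, hO₁⟩, ⟨hI₂, hI₁⟩,
      h'.inc_right.2 hO₁, h'.along_right.2 (hZ₁.trans hI₁.symm), h'.inc_right.2 hV₁,
      h'.along_left.2 (hV₂.trans hZ₁'.symm), (hd.2 _).2 ?_, (hd.2 _).2 ?_, (hd'.2 _).2 ?_,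
      (hd'.2 _).2 ?_, (hE'.perp_iff hd hd').2 (by ring), hpos _ hZ₁ hZ₁'⟩
    · rw [hI₁, hI₂]; ring
    · rw [hV₁, hV₂]; ring
    · rw [hO₁, hO₂]; ring
    · rw [hZ₁, hZ₁']; ring

end Frame

end Str

/-- Isomorphisms of fields, as structures, are ring isomorphisms. -/
noncomputable def ringEquivOfIso {F K : Type u} [Field F] [Field K]
    (e : Str.Iso (fieldStr F) (fieldStr K)) : F ≃+* K where
  toEquiv := e.toEquiv ()
  map_add' a b := ((e.map_rel FieldRel.add (fun _ => (![a, b, a + b] : Fin 3 → F))).1 rfl).symm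
  map_mul' a b := ((e.map_rel FieldRel.mul (fun _ => (![a, b, a * b] : Fin 3 → F))).1 rfl).symm

/-! ### Connectives and quantifiers -/

namespace Val

variable {L : Signature} {M : Str.{u} L} {V W : L.Srt → Type}

/-- The image of an assignment under an isomorphism. -/
def map {N : Str.{u} L} (e : Str.Iso M N) (v : Val M V) : Val N V :=
  fun s x => e.toEquiv s (v s x)

theorem map_extend {N : Str.{u} L} (e : Str.Iso M N) (v : Val M V) {s : L.Srt}
    (a : M.carrier s) : (v.extend a).map e = (v.map e).extend (e.toEquiv s a) := by
  funext t x
  cases x <;> rfl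

theorem map_join {N : Str.{u} L} (e : Str.Iso M N) (v : Val M V) (w : Val M W) :
    (v.join w).map e = (v.map e).join (w.map e) := by
  funext t x
  cases x <;> rfl

end Val

namespace Fml

variable {L : Signature} {V : L.Srt → Type} {M : Str.{u} L}

/-- Negation. -/
def neg (φ : Fml L V) : Fml L V := φ.imp .falsum

/-- Conjunction. -/
def conj (φ ψ : Fml L V) : Fml L V := (φ.imp ψ.neg).neg

/-- Disjunction. -/
def disj (φ ψ : Fml L V) : Fml L V := φ.neg.imp ψ

/-- Equivalence. -/
def biimp (φ ψ : Fml L V) : Fml L V := (φ.imp ψ).conj (ψ.imp φ)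

/-- Existential quantification. -/
def ex (s : L.Srt) (φ : Fml L (Ext V s)) : Fml L V := (all s φ.neg).neg

@[simp]
theorem realize_imp (φ ψ : Fml L V) (v : Val M V) :
    (φ.imp ψ).Realize M v ↔ (φ.Realize M v → ψ.Realize M v) := Iff.rfl

@[simp]
theorem realize_all (s : L.Srt) (φ : Fml L (Ext V s)) (v : Val M V) :
    (all s φ).Realize M v ↔ ∀ a, φ.Realize M (v.extend a) := Iff.rfl

@[simp]
theorem realize_neg (φ : Fml L V) (v : Val M V) : φ.neg.Realize M v ↔ ¬ φ.Realize M v := Iff.rfl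

@[simp]
theorem realize_conj (φ ψ : Fml L V) (v : Val M V) :
    (φ.conj ψ).Realize M v ↔ φ.Realize M v ∧ ψ.Realize M v := by
  simp [conj]

@[simp]
theorem realize_disj (φ ψ : Fml L V) (v : Val M V) :
    (φ.disj ψ).Realize M v ↔ φ.Realize M v ∨ ψ.Realize M v := by
  simp [disj, or_iff_not_imp_left]

@[simp]
theorem realize_biimp (φ ψ : Fml L V) (v : Val M V) :
    (φ.biimp ψ).Realize M v ↔ (φ.Realize M v ↔ ψ.Realize M v) := by
  simp [biimp, iff_def]

/-- Truth is invariant under isomorphisms. -/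
theorem realize_map {N : Str.{u} L} (e : Str.Iso M N) (φ : Fml L V) (v : Val M V) :
    φ.Realize N (v.map e) ↔ φ.Realize M v := by
  induction φ with
  | equal s x y => exact (e.toEquiv s).injective.eq_iff
  | rel r x => exact (e.map_rel r _).symm
  | falsum => exact Iff.rfl
  | imp φ ψ h₁ h₂ => exact imp_congr (h₁ v) (h₂ v)
  | all s φ h =>
    rw [realize_all, realize_all, ← (e.toEquiv s).forall_congr_right]
    exact forall_congr' fun a => by rw [← Val.map_extend, h]

end Fml

/-! ### Presentations of internal structures -/

/-- The scheme `t` defines the structure `N` in `M`, and `nm` relates the tuples and the elements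
of `N` that they name. -/
structure Translation.Presents {L K : Signature} {D : Shape L K} (t : Translation D)
    (M : Str.{u} K) (p : Val M (Vars D.par)) (N : Str.{u} L)
    (nm : ∀ s, Val M (Vars (D.dim s)) → N.carrier s → Prop) : Prop where
  dom : ∀ s x, (t.dom s).Realize M (x.join p) ↔ ∃ b, nm s x b
  unique : ∀ s x b c, nm s x b → nm s x c → b = c
  exists_name : ∀ s b, ∃ x, nm s x b
  nonempty : ∀ s, Nonempty (N.carrier s)
  eqv : ∀ s x y b c, nm s x b → nm s y c →
    ((t.eqv s).Realize M ((Val.join x y).join p) ↔ b = c)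
  rel : ∀ (r : L.Rel) (x : ∀ s, Fin (L.arity r s) → Val M (Vars (D.dim s)))
    (z : ∀ s, Fin (L.arity r s) → N.carrier s), (∀ s i, nm s (x s i) (z s i)) →
      ((t.rel r).Realize M ((Val.blocks x).join p) ↔ N.rel r z)

namespace Translation.Presents

variable {L K : Signature} {D : Shape L K} {t : Translation D} {M : Str.{u} K}
  {p : Val M (Vars D.par)} {N : Str.{u} L} {nm : ∀ s, Val M (Vars (D.dim s)) → N.carrier s → Prop}

theorem exists_value (h : t.Presents M p N nm) : ∃ f : ∀ s, t.Dom M p s → N.carrier s,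
    (∀ s x, nm s x.1 (f s x)) ∧ (∀ s x y, t.Eqv M p s x y ↔ f s x = f s y) ∧
      ∀ r x, t.Holds M p r x ↔ N.rel r fun s i => f s (x s i) := by
  choose f hf using fun s (x : t.Dom M p s) => (h.dom s x.1).1 x.2
  exact ⟨f, hf, fun s x y => h.eqv s _ _ _ _ (hf s x) (hf s y),
    fun r x => h.rel r _ _ fun s i => hf s (x s i)⟩

theorem wellDefined (h : t.Presents M p N nm) : t.WellDefined M p := by
  obtain ⟨f, -, h₁, h₂⟩ := h.exists_value
  refine ⟨fun s => ?_, fun s => ⟨fun x => (h₁ s x x).2 rfl, fun {x y} hxy => ?_,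
    fun {x y z} hxy hyz => ?_⟩, fun r x y hxy hx => ?_⟩
  · obtain ⟨b⟩ := h.nonempty s
    obtain ⟨x, hx⟩ := h.exists_name s b
    exact ⟨x, (h.dom s x).2 ⟨b, hx⟩⟩
  · exact (h₁ s y x).2 ((h₁ s x y).1 hxy).symm
  · exact (h₁ s x z).2 (((h₁ s x y).1 hxy).trans ((h₁ s y z).1 hyz))
  · rw [h₂] at hx ⊢
    have : (fun s i => f s (y s i)) = fun s i => f s (x s i) :=
      funext fun s => funext fun i => ((h₁ s _ _).1 (hxy s i)).symm
    rwa [this]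

/-- The map from tuples to named elements identifies exactly the tuples that are equal in the
interpretation, so it descends to the quotient bijectively. -/
theorem exists_iso (h : t.Presents M p N nm) : ∃ e : Str.Iso (t.induced M p) N,
    ∀ s x b, t.Names M p s x b ↔ nm s x (e.toEquiv s b) := by
  obtain ⟨f, hf, h₁, h₂⟩ := h.exists_value
  let g : ∀ s, (t.induced M p).carrier s → N.carrier s := fun s =>
    Quot.lift (f s) fun x y hxy => (h₁ s x y).1 hxy
  have hg : ∀ s, Function.Bijective (g s) := by
    intro s
    constructor
    · intro a b hab
      obtain ⟨x, rfl⟩ := Quot.exists_rep a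
      obtain ⟨y, rfl⟩ := Quot.exists_rep b
      exact Quot.sound ((h₁ s x y).2 hab)
    · intro b
      obtain ⟨x, hx⟩ := h.exists_name s b
      refine ⟨Quot.mk _ ⟨x, (h.dom s x).2 ⟨b, hx⟩⟩, ?_⟩
      exact h.unique s x _ _ (hf s ⟨x, _⟩) hx
  refine ⟨⟨fun s => Equiv.ofBijective (g s) (hg s), fun r x => ?_⟩, fun s x b => ?_⟩
  · constructor
    · rintro ⟨y, hy, hr⟩
      rw [h₂] at hr
      have : x = fun s i => Quot.mk _ (y s i) := funext fun s => funext fun i => (hy s i).symm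
      subst this
      exact hr
    · intro hr
      choose y hy using fun s i => Quot.exists_rep (x s i)
      have : x = fun s i => Quot.mk _ (y s i) := funext fun s => funext fun i => (hy s i).symm
      subst this
      exact ⟨y, fun _ _ => rfl, (h₂ r y).2 hr⟩
  · constructor
    · rintro ⟨hx, rfl⟩
      exact hf s ⟨x, hx⟩
    · intro hx
      have hd := (h.dom s x).2 ⟨_, hx⟩
      exact ⟨hd, (hg s).1 (h.unique s x _ _ (hf s ⟨x, hd⟩) hx)⟩

/-- Presentations are transported by isomorphisms. -/
theorem of_iso {M' : Str.{u} K} (e : Str.Iso M M')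
    {nm : ∀ s, Val M' (Vars (D.dim s)) → N.carrier s → Prop}
    (h : t.Presents M' (p.map e) N nm) :
    t.Presents M p N fun s x b => nm s (x.map e) b where
  dom s x := by rw [← h.dom, ← Val.map_join, Fml.realize_map]
  unique s x b c := h.unique s _ b c
  exists_name s b := by
    obtain ⟨x, hx⟩ := h.exists_name s b
    refine ⟨x.map e.symm, ?_⟩
    convert hx
    funext k i
    exact (e.toEquiv k).apply_symm_apply _
  nonempty := h.nonempty
  eqv s x y b c hb hc := by
    rw [← h.eqv s _ _ b c hb hc, ← Val.map_join, ← Val.map_join, Fml.realize_map]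
  rel r x z hx := by
    rw [← h.rel r _ z hx, ← Fml.realize_map e, Val.map_join]
    exact Iff.rfl

end Translation.Presents

/-! ### Formulas of plane geometry -/

namespace Fml

section Plane

/-- A variable, in an extended context. -/
local notation:max x:max "⇡" => Ext.old (S := planeSig.Srt) x

variable {V : planeSig.Srt → Type} {M : Str.{u} planeSig} (v : Val M V)
  (A B C X Y Z P O : V PlaneSort.point) (l m k : V PlaneSort.line)

/-- Incidence. -/
def inc : Fml planeSig V :=
  .rel PlaneRel.inc fun s => match s with
    | .point => (fun _ => A : Fin 1 → V PlaneSort.point)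
    | .line => (fun _ => l : Fin 1 → V PlaneSort.line)

/-- Orthogonality. -/
def perp : Fml planeSig V :=
  .rel PlaneRel.perp fun s => match s with
    | .point => (Fin.elim0 : Fin 0 → V PlaneSort.point)
    | .line => (![l, m] : Fin 2 → V PlaneSort.line)

/-- Betweenness. -/
def be : Fml planeSig V :=
  .rel PlaneRel.between fun s => match s with
    | .point => (![A, B, C] : Fin 3 → V PlaneSort.point)
    | .line => (Fin.elim0 : Fin 0 → V PlaneSort.line)

@[simp]
theorem realize_inc : (inc A l).Realize M v ↔ M.Inc (v _ A) (v _ l) :=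
  Str.rel_inc_iff _

@[simp]
theorem realize_perp : (perp l m).Realize M v ↔ M.Perp (v _ l) (v _ m) :=
  Str.rel_perp_iff _

@[simp]
theorem realize_be : (be A B C).Realize M v ↔ M.Be (v _ A) (v _ B) (v _ C) :=
  Str.rel_between_iff _

/-- Quantification over a point. -/
def exPt (φ : Fml planeSig (Ext V PlaneSort.point)) : Fml planeSig V := ex PlaneSort.point φ

/-- Quantification over a line. -/
def exLn (φ : Fml planeSig (Ext V PlaneSort.line)) : Fml planeSig V := ex PlaneSort.line φ

/-- Universal quantification over a point. -/
def allPt (φ : Fml planeSig (Ext V PlaneSort.point)) : Fml planeSig V := all PlaneSort.point φ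

/-- Equality of points. -/
def eqPt : Fml planeSig V := equal PlaneSort.point A B

/-- Equality of lines. -/
def eqLn : Fml planeSig V := equal PlaneSort.line l m

@[simp]
theorem realize_exPt (φ : Fml planeSig (Ext V PlaneSort.point)) :
    (exPt φ).Realize M v ↔ ∃ a : M.Pt, φ.Realize M (v.extend (s := PlaneSort.point) a) :=
  not_forall_not

@[simp]
theorem realize_exLn (φ : Fml planeSig (Ext V PlaneSort.line)) :
    (exLn φ).Realize M v ↔ ∃ a : M.Ln, φ.Realize M (v.extend (s := PlaneSort.line) a) :=
  not_forall_not

@[simp]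
theorem realize_allPt (φ : Fml planeSig (Ext V PlaneSort.point)) :
    (allPt φ).Realize M v ↔ ∀ a : M.Pt, φ.Realize M (v.extend (s := PlaneSort.point) a) := Iff.rfl

@[simp]
theorem realize_eqPt : (eqPt A B).Realize M v ↔ v _ A = v _ B := Iff.rfl

@[simp]
theorem realize_eqLn : (eqLn l m).Realize M v ↔ v _ l = v _ m := Iff.rfl

/-- The lines are parallel or equal. -/
def parEq : Fml planeSig V :=
  (exPt ((inc .new l⇡).conj (inc .new m⇡))).neg.disj (eqLn l m)

@[simp]
theorem realize_parEq :
    (parEq l m).Realize M v ↔ (M.Par (v _ l) (v _ m) ∨ v _ l = v _ m) := by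
  simp only [parEq, realize_exPt, realize_eqLn, realize_conj, realize_disj, realize_neg,
    realize_inc]
  -- Evaluation of lifted variables in an extended assignment is by computation, so both sides now
  -- agree definitionally; the same holds for the later formulas.
  rfl

/-- The relation `Str.Along`. -/
def along : Fml planeSig V :=
  exLn ((inc A⇡ .new).conj ((inc B⇡ .new).conj (parEq .new l⇡)))

@[simp]
theorem realize_along :
    (along A B l).Realize M v ↔ M.Along (v _ l) (v _ A) (v _ B) := by
  simp only [along, realize_exLn, realize_conj, realize_inc, realize_parEq]
  rfl

/-- The relation `Str.AdmissibleAxes`. -/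
def admissibleAxes : Fml planeSig V :=
  (exPt (((inc .new l⇡).conj (inc .new m⇡)).conj (allPt (((inc .new l⇡⇡).conj (inc .new m⇡⇡)).imp
    (eqPt .new .new⇡))))).conj ((inc Z l).neg.conj (inc Z m).neg)

@[simp]
theorem realize_admissibleAxes :
    (admissibleAxes Z l m).Realize M v ↔ M.AdmissibleAxes (v _ l) (v _ m) (v _ Z) := by
  simp only [admissibleAxes, realize_exPt, realize_allPt, realize_eqPt, realize_conj, realize_neg,
    realize_imp, realize_inc]
  rfl

/-- The relation `Str.IsOrigin`. -/
def isOrigin : Fml planeSig V :=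
  (inc O l).conj (inc O m)

@[simp]
theorem realize_isOrigin :
    (isOrigin O l m).Realize M v ↔ M.IsOrigin (v _ l) (v _ m) (v _ O) := by
  simp only [isOrigin, realize_conj, realize_inc]
  rfl

/-- The relation `Str.IsUnitPt`. -/
def isUnitPt : Fml planeSig V :=
  (inc A l).conj (along Z A m)

@[simp]
theorem realize_isUnitPt :
    (isUnitPt A Z l m).Realize M v ↔ M.IsUnitPt (v _ l) (v _ m) (v _ Z) (v _ A) := by
  simp only [isUnitPt, realize_conj, realize_inc, realize_along]
  rfl

/-- The relation `Str.AxisBij`. -/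
def axisBij : Fml planeSig V :=
  (inc X l).conj ((inc Y m).conj (exPt (exLn (exPt ((isOrigin .new⇡⇡ l⇡⇡⇡ m⇡⇡⇡).conj ((inc .new⇡⇡
    .new⇡).conj ((inc Z⇡⇡⇡ .new⇡).conj ((inc .new .new⇡).conj ((along X⇡⇡⇡ .new m⇡⇡⇡).conj (along
    .new Y⇡⇡⇡ l⇡⇡⇡))))))))))

@[simp]
theorem realize_axisBij :
    (axisBij X Y Z l m).Realize M v ↔ M.AxisBij (v _ l) (v _ m) (v _ Z) (v _ X) (v _ Y) := by
  simp only [axisBij, realize_exPt, realize_exLn, realize_conj, realize_inc, realize_along,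
    realize_isOrigin]
  rfl

/-- The relation `Str.Coord`. -/
def coord : Fml planeSig V :=
  (inc X l).conj ((along P X m).conj (exPt ((inc .new m⇡).conj ((along P⇡ .new l⇡).conj (axisBij
    Y⇡ .new Z⇡ l⇡ m⇡)))))

@[simp]
theorem realize_coord :
    (coord X Y Z P l m).Realize M v ↔
      M.Coord (v _ l) (v _ m) (v _ Z) (v _ P) (v _ X) (v _ Y) := by
  simp only [coord, realize_exPt, realize_conj, realize_inc, realize_along, realize_axisBij]
  rfl

/-- The relation `Str.Slope`. -/
def slope : Fml planeSig V :=
  (parEq k m).neg.conj (exPt (exPt (exLn (exPt ((isOrigin .new⇡⇡⇡ l⇡⇡⇡⇡ m⇡⇡⇡⇡).conj ((isUnitPt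
    .new⇡⇡ Z⇡⇡⇡⇡ l⇡⇡⇡⇡ m⇡⇡⇡⇡).conj ((inc .new⇡⇡⇡ .new⇡).conj ((parEq .new⇡ k⇡⇡⇡⇡).conj ((inc .new
    .new⇡).conj (coord .new⇡⇡ A⇡⇡⇡⇡ Z⇡⇡⇡⇡ .new l⇡⇡⇡⇡ m⇡⇡⇡⇡))))))))))

@[simp]
theorem realize_slope :
    (slope A Z l m k).Realize M v ↔ M.Slope (v _ l) (v _ m) (v _ Z) (v _ k) (v _ A) := by
  simp only [slope, realize_exPt, realize_exLn, realize_conj, realize_neg, realize_inc,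
    realize_parEq, realize_isOrigin, realize_isUnitPt, realize_coord]
  rfl

/-- The relation `Str.Ter`. -/
def ter : Fml planeSig V :=
  exLn (exPt (exPt (exPt ((slope A⇡⇡⇡⇡ Z⇡⇡⇡⇡ l⇡⇡⇡⇡ m⇡⇡⇡⇡ .new⇡⇡⇡).conj ((isOrigin .new⇡⇡ l⇡⇡⇡⇡
    m⇡⇡⇡⇡).conj ((inc .new⇡ .new⇡⇡⇡).conj ((coord .new⇡⇡ B⇡⇡⇡⇡ Z⇡⇡⇡⇡ .new⇡ l⇡⇡⇡⇡ m⇡⇡⇡⇡).conj ((inc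
    .new .new⇡⇡⇡).conj (coord X⇡⇡⇡⇡ Y⇡⇡⇡⇡ Z⇡⇡⇡⇡ .new l⇡⇡⇡⇡ m⇡⇡⇡⇡)))))))))

@[simp]
theorem realize_ter :
    (ter A B X Y Z l m).Realize M v ↔
      M.Ter (v _ l) (v _ m) (v _ Z) (v _ A) (v _ X) (v _ B) (v _ Y) := by
  simp only [ter, realize_exPt, realize_exLn, realize_conj, realize_inc, realize_slope,
    realize_isOrigin, realize_coord]
  rfl

/-- The relation `Str.Positive`. -/
def positive : Fml planeSig V :=
  (isOrigin A l m).neg.conj (allPt (allPt ((isOrigin .new⇡ l⇡⇡ m⇡⇡).imp ((isUnitPt .new Z⇡⇡ l⇡⇡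
    m⇡⇡).imp (be A⇡⇡ .new⇡ .new).neg))))

@[simp]
theorem realize_positive :
    (positive A Z l m).Realize M v ↔ M.Positive (v _ l) (v _ m) (v _ Z) (v _ A) := by
  simp only [positive, realize_allPt, realize_conj, realize_neg, realize_imp, realize_be,
    realize_isOrigin, realize_isUnitPt]
  rfl

end Plane

end Fml

namespace Fml

/-! ### Orthonormal frames and coordinates as formulas -/

section Plane

/-- A variable, in an extended context. -/
local notation:max x:max "⇡" => Ext.old (S := planeSig.Srt) x

variable {V : planeSig.Srt → Type} {M : Str.{u} planeSig} (v : Val M V)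
  (A B C X Y Z P : V PlaneSort.point) (l m k : V PlaneSort.line)

/-- The relation `Str.OrthoFrame`. -/
def orthoFrame : Fml planeSig V :=
  (perp l m).conj (exPt (exPt (exPt (exLn (exLn ((isOrigin .new⇡⇡⇡⇡ l⇡⇡⇡⇡⇡ k⇡⇡⇡⇡⇡).conj
    ((isUnitPt .new⇡⇡⇡ Z⇡⇡⇡⇡⇡ l⇡⇡⇡⇡⇡ k⇡⇡⇡⇡⇡).conj ((inc .new⇡⇡⇡⇡ m⇡⇡⇡⇡⇡).conj ((along Y⇡⇡⇡⇡⇡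
    .new⇡⇡⇡ m⇡⇡⇡⇡⇡).conj ((inc .new⇡⇡ m⇡⇡⇡⇡⇡).conj ((along .new⇡⇡ Y⇡⇡⇡⇡⇡ l⇡⇡⇡⇡⇡).conj ((inc
    .new⇡⇡⇡ .new⇡).conj ((inc .new⇡⇡ .new⇡).conj ((inc .new⇡⇡⇡⇡ .new).conj ((inc Y⇡⇡⇡⇡⇡
    .new).conj ((perp .new⇡ .new).conj (exPt (exPt ((coord .new⇡ .new Z⇡⇡⇡⇡⇡⇡⇡ Y⇡⇡⇡⇡⇡⇡⇡ l⇡⇡⇡⇡⇡⇡⇡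
    k⇡⇡⇡⇡⇡⇡⇡).conj (positive .new Z⇡⇡⇡⇡⇡⇡⇡ l⇡⇡⇡⇡⇡⇡⇡ k⇡⇡⇡⇡⇡⇡⇡))))))))))))))))))))

theorem realize_orthoFrame : (orthoFrame Y Z l m k).Realize M v ↔
    M.OrthoFrame (v _ l) (v _ k) (v _ Z) (v _ m) (v _ Y) := by
  simp only [orthoFrame, realize_exPt, realize_exLn, realize_conj, realize_inc, realize_perp,
    realize_along, realize_isOrigin, realize_isUnitPt, realize_coord, realize_positive]
  rfl

/-- The linear equation `A X + B Y + C = 0` in the coordinate field. -/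
def lineEquation : Fml planeSig V :=
  exPt (exPt (exPt (exPt ((isOrigin .new⇡⇡⇡ l⇡⇡⇡⇡ m⇡⇡⇡⇡).conj ((isUnitPt .new⇡⇡ Z⇡⇡⇡⇡ l⇡⇡⇡⇡
    m⇡⇡⇡⇡).conj ((ter A⇡⇡⇡⇡ .new⇡⇡⇡ X⇡⇡⇡⇡ .new⇡ Z⇡⇡⇡⇡ l⇡⇡⇡⇡ m⇡⇡⇡⇡).conj ((ter B⇡⇡⇡⇡ .new⇡ Y⇡⇡⇡⇡
    .new Z⇡⇡⇡⇡ l⇡⇡⇡⇡ m⇡⇡⇡⇡).conj (ter .new⇡⇡ C⇡⇡⇡⇡ .new .new⇡⇡⇡ Z⇡⇡⇡⇡ l⇡⇡⇡⇡ m⇡⇡⇡⇡))))))))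

theorem realize_lineEquation : (lineEquation A B C X Y Z l m).Realize M v ↔
    ∃ O I R S, M.IsOrigin (v _ l) (v _ m) O ∧ M.IsUnitPt (v _ l) (v _ m) (v _ Z) I ∧
      M.Ter (v _ l) (v _ m) (v _ Z) (v _ A) (v _ X) O R ∧
      M.Ter (v _ l) (v _ m) (v _ Z) (v _ B) (v _ Y) R S ∧
      M.Ter (v _ l) (v _ m) (v _ Z) I S (v _ C) O := by
  simp only [lineEquation, realize_exPt, realize_conj, realize_isOrigin, realize_isUnitPt,
    realize_ter]
  rfl

/-- The point `P` has orthonormal coordinates `(X, Y)`. -/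
def pointCoords : Fml planeSig V :=
  exLn (exPt ((orthoFrame .new Z⇡⇡ l⇡⇡ .new⇡ m⇡⇡).conj (coord X⇡⇡ Y⇡⇡ .new P⇡⇡ l⇡⇡ .new⇡)))

theorem realize_pointCoords : (pointCoords X Y Z P l m).Realize M v ↔
    ∃ n W, M.OrthoFrame (v _ l) (v _ m) (v _ Z) n W ∧
      M.Coord (v _ l) n W (v _ P) (v _ X) (v _ Y) := by
  simp only [pointCoords, realize_exPt, realize_exLn, realize_conj, realize_orthoFrame,
    realize_coord]
  rfl

/-- The line `k` has the equation with coefficients `A`, `B`, `C` in orthonormal coordinates. -/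
def lineCoords : Fml planeSig V :=
  (inc A l).conj ((inc B l).conj ((inc C l).conj ((((isOrigin A l m).conj (isOrigin B l
    m)).neg).conj (exLn (exPt ((orthoFrame .new Z⇡⇡ l⇡⇡ .new⇡ m⇡⇡).conj (allPt (allPt (allPt
    ((coord .new⇡ .new .new⇡⇡⇡ .new⇡⇡ l⇡⇡⇡⇡⇡ .new⇡⇡⇡⇡).imp ((inc .new⇡⇡ k⇡⇡⇡⇡⇡).biimp
    (lineEquation A⇡⇡⇡⇡⇡ B⇡⇡⇡⇡⇡ C⇡⇡⇡⇡⇡ .new⇡ .new Z⇡⇡⇡⇡⇡ l⇡⇡⇡⇡⇡ m⇡⇡⇡⇡⇡))))))))))))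

theorem realize_lineCoords : (lineCoords A B C Z l m k).Realize M v ↔
    M.Inc (v _ A) (v _ l) ∧ M.Inc (v _ B) (v _ l) ∧ M.Inc (v _ C) (v _ l) ∧
    ¬ (M.IsOrigin (v _ l) (v _ m) (v _ A) ∧ M.IsOrigin (v _ l) (v _ m) (v _ B)) ∧
    ∃ n W, M.OrthoFrame (v _ l) (v _ m) (v _ Z) n W ∧ ∀ P X Y, M.Coord (v _ l) n W P X Y →
      (M.Inc P (v _ k) ↔ ∃ O I R S, M.IsOrigin (v _ l) (v _ m) O ∧
        M.IsUnitPt (v _ l) (v _ m) (v _ Z) I ∧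
        M.Ter (v _ l) (v _ m) (v _ Z) (v _ A) X O R ∧ M.Ter (v _ l) (v _ m) (v _ Z) (v _ B) Y R S ∧
        M.Ter (v _ l) (v _ m) (v _ Z) I S (v _ C) O) := by
  simp only [lineCoords, realize_exPt, realize_exLn, realize_allPt, realize_conj, realize_neg,
    realize_imp, realize_biimp, realize_inc, realize_isOrigin, realize_orthoFrame, realize_coord,
    realize_lineEquation]
  rfl

end Plane

/-! ### Formulas of field theory -/

section Field

/-- A variable, in an extended context. -/
local notation:max x:max "⇡" => Ext.old (S := fieldSig.Srt) x

variable {V : fieldSig.Srt → Type} {F : Type u} [Field F] (v : Val (fieldStr F) V)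
  (a b c a' b' c' t w x y z : V ())

/-- The graph of addition. -/
def add : Fml fieldSig V := .rel FieldRel.add fun _ => (![a, b, c] : Fin 3 → V ())

/-- The graph of multiplication. -/
def mul : Fml fieldSig V := .rel FieldRel.mul fun _ => (![a, b, c] : Fin 3 → V ())

/-- The element is zero. -/
def zero : Fml fieldSig V := .rel FieldRel.zero fun _ => (fun _ => a : Fin 1 → V ())

/-- The element is one. -/
def one : Fml fieldSig V := .rel FieldRel.one fun _ => (fun _ => a : Fin 1 → V ())

/-- Equality. -/
def eqF : Fml fieldSig V := equal () a b

/-- Existential quantification. -/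
def exF (φ : Fml fieldSig (Ext V ())) : Fml fieldSig V := ex () φ

/-- The value of a variable in a field. -/
abbrev value (v : Val (fieldStr F) V) (a : V ()) : F := v () a

theorem realize_add :
    (add a b c).Realize (fieldStr F) v ↔ value v a + value v b = value v c := Iff.rfl

theorem realize_mul :
    (mul a b c).Realize (fieldStr F) v ↔ value v a * value v b = value v c := Iff.rfl

theorem realize_zero : (zero a).Realize (fieldStr F) v ↔ value v a = 0 := Iff.rfl

theorem realize_one : (one a).Realize (fieldStr F) v ↔ value v a = 1 := Iff.rfl

theorem realize_eqF : (eqF a b).Realize (fieldStr F) v ↔ value v a = value v b := Iff.rfl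

theorem realize_exF (φ : Fml fieldSig (Ext V ())) : (exF φ).Realize (fieldStr F) v ↔
    ∃ a : F, φ.Realize (fieldStr F) (v.extend (s := ()) a) := not_forall_not

/-- The value of `a x + b y` is `w`. -/
def dot : Fml fieldSig V :=
  exF (exF ((mul a⇡⇡ x⇡⇡ .new⇡).conj ((mul b⇡⇡ y⇡⇡ .new).conj (add .new⇡ .new w⇡⇡))))

theorem realize_dot : (dot a b w x y).Realize (fieldStr F) v ↔
    value v a * value v x + value v b * value v y = value v w := by
  -- The signature has only graphs of the operations, so intermediate values are bound by
  -- quantifiers and eliminated here.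
  refine Iff.trans (b := ∃ p q : F, value v a * value v x = p ∧ value v b * value v y = q ∧
    p + q = value v w) ?_ (by simp)
  simp only [dot, realize_exF, realize_conj, realize_mul, realize_add]
  rfl

/-- The point `(x, y)` is on the line `a x + b y + c = 0`. -/
def onLine : Fml fieldSig V :=
  exF (exF ((dot a⇡⇡ b⇡⇡ .new⇡ x⇡⇡ y⇡⇡).conj ((zero .new).conj (add .new⇡ c⇡⇡ .new))))

theorem realize_onLine : (onLine a b c x y).Realize (fieldStr F) v ↔
    value v a * value v x + value v b * value v y + value v c = 0 := by
  refine Iff.trans (b := ∃ p q : F, value v a * value v x + value v b * value v y = p ∧ q = 0 ∧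
    p + value v c = q) ?_ (by simp)
  simp only [onLine, realize_exF, realize_conj, realize_dot, realize_zero, realize_add]
  rfl

/-- The equation `a x + b y = 0`. -/
def orth : Fml fieldSig V :=
  exF ((dot a⇡ b⇡ .new x⇡ y⇡).conj (zero .new))

theorem realize_orth : (orth a b x y).Realize (fieldStr F) v ↔
    value v a * value v x + value v b * value v y = 0 := by
  refine Iff.trans (b := ∃ p : F, value v a * value v x + value v b * value v y = p ∧ p = 0) ?_
    (by simp)
  simp only [orth, realize_exF, realize_conj, realize_dot, realize_zero]
  rfl

/-- The strict ordering. -/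
def sqLt : Fml fieldSig V :=
  ((eqF a b).neg).conj (exF (exF ((mul .new⇡ .new⇡ .new).conj (add a⇡⇡ .new b⇡⇡))))

theorem realize_sqLt : (sqLt a b).Realize (fieldStr F) v ↔ SqLt (value v a) (value v b) := by
  refine Iff.trans (b := value v a ≠ value v b ∧ ∃ z w : F, z * z = w ∧
    value v a + w = value v b) ?_ (by simp [SqLt, sq])
  simp only [sqLt, realize_exF, realize_conj, realize_neg, realize_eqF, realize_mul, realize_add]
  rfl

/-- The value of `a + t (c - a)` is `b`. -/
def affine : Fml fieldSig V :=
  exF (exF ((add a⇡⇡ .new⇡ c⇡⇡).conj ((mul t⇡⇡ .new⇡ .new).conj (add a⇡⇡ .new b⇡⇡))))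

theorem realize_affine : (affine a b c t).Realize (fieldStr F) v ↔
    value v b = value v a + value v t * (value v c - value v a) := by
  refine Iff.trans (b := ∃ d w : F, value v a + d = value v c ∧ value v t * d = w ∧
    value v a + w = value v b) ?_ ?_
  · simp only [affine, realize_exF, realize_conj, realize_mul, realize_add]
    rfl
  · constructor
    · rintro ⟨d, w, h₁, rfl, h₂⟩
      rw [← h₁, ← h₂]
      ring
    · intro h
      exact ⟨value v c - value v a, _, by ring, rfl, h.symm⟩

/-- The point `(b, y)` divides the segment from `(a, x)` to `(c, z)` in a ratio between `0` and
`1`. -/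
def inner : Fml fieldSig V :=
  exF (exF (exF ((zero .new⇡).conj ((one .new).conj ((sqLt .new⇡ .new⇡⇡).conj ((sqLt .new⇡⇡
    .new).conj ((affine a⇡⇡⇡ b⇡⇡⇡ c⇡⇡⇡ .new⇡⇡).conj (affine x⇡⇡⇡ y⇡⇡⇡ z⇡⇡⇡ .new⇡⇡))))))))

theorem realize_inner : (inner a b c x y z).Realize (fieldStr F) v ↔
    ∃ t : F, SqLt 0 t ∧ SqLt t 1 ∧ value v b = value v a + t * (value v c - value v a) ∧
      value v y = value v x + t * (value v z - value v x) := by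
  refine Iff.trans (b := ∃ t o e : F, o = 0 ∧ e = 1 ∧ SqLt o t ∧ SqLt t e ∧
    value v b = value v a + t * (value v c - value v a) ∧
      value v y = value v x + t * (value v z - value v x)) ?_ (by simp)
  simp only [inner, realize_exF, realize_conj, realize_zero, realize_one, realize_sqLt,
    realize_affine]
  rfl

/-- The triples `(a, b, c)` and `(x, y, z)` are proportional. -/
def proportional : Fml fieldSig V :=
  exF (((zero .new).neg).conj ((mul .new a⇡ x⇡).conj ((mul .new b⇡ y⇡).conj (mul .new c⇡ z⇡))))

theorem realize_proportional : (proportional a b c x y z).Realize (fieldStr F) v ↔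
    ∃ k : F, k ≠ 0 ∧ k * value v a = value v x ∧ k * value v b = value v y ∧
      k * value v c = value v z := by
  simp only [proportional, realize_exF, realize_conj, realize_neg, realize_zero, realize_mul]
  rfl

/-- The point `(x, y)` is `O + t (U - O)`, where `O` is the common point of the lines `a, b, c` and
`a', b', c'`, and `U` is the projection of `(z, w)` to the first line along the second. -/
def unitMultiple : Fml fieldSig V :=
  exF (exF (exF (exF ((onLine a⇡⇡⇡⇡ b⇡⇡⇡⇡ c⇡⇡⇡⇡ .new⇡⇡⇡ .new⇡⇡).conj ((onLine a'⇡⇡⇡⇡ b'⇡⇡⇡⇡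
    c'⇡⇡⇡⇡ .new⇡⇡⇡ .new⇡⇡).conj ((onLine a⇡⇡⇡⇡ b⇡⇡⇡⇡ c⇡⇡⇡⇡ .new⇡ .new).conj ((exF ((dot a'⇡⇡⇡⇡⇡
    b'⇡⇡⇡⇡⇡ .new .new⇡⇡ .new⇡).conj (dot a'⇡⇡⇡⇡⇡ b'⇡⇡⇡⇡⇡ .new z⇡⇡⇡⇡⇡ w⇡⇡⇡⇡⇡))).conj ((affine
    .new⇡⇡⇡ x⇡⇡⇡⇡ .new⇡ t⇡⇡⇡⇡).conj (affine .new⇡⇡ y⇡⇡⇡⇡ .new t⇡⇡⇡⇡)))))))))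

theorem realize_unitMultiple :
    (unitMultiple a b c a' b' c' t w x y z).Realize (fieldStr F) v ↔ ∃ o o' e e' : F,
      value v a * o + value v b * o' + value v c = 0 ∧
      value v a' * o + value v b' * o' + value v c' = 0 ∧
      value v a * e + value v b * e' + value v c = 0 ∧
      (∃ s, value v a' * e + value v b' * e' = s ∧
        value v a' * value v z + value v b' * value v w = s) ∧
      value v x = o + value v t * (e - o) ∧ value v y = o' + value v t * (e' - o') := by
  simp only [unitMultiple, realize_exF, realize_conj, realize_onLine, realize_dot, realize_affine]
  rfl

end Field

end Fml

/-! ### The coordinate field as an interpretation -/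

/-- The axes among the parameters of the coordinate scheme. -/
abbrev axisVar (i : Fin 2) : Vars coordShape.par PlaneSort.line := i

/-- The unit point among the parameters of the coordinate scheme. -/
abbrev unitVar : Vars coordShape.par PlaneSort.point := (0 : Fin 1)

/-- The coordinate field, as a translation scheme. -/
def coordScheme : Translation coordShape where
  adm := Fml.admissibleAxes unitVar (axisVar 0) (axisVar 1)
  dom _ := Fml.inc (V := Join (Vars (coordShape.dim ())) (Vars coordShape.par))
    (.inl (0 : Fin 1)) (.inr (axisVar 0))
  eqv _ := Fml.eqPt
    (V := Join (Join (Vars (coordShape.dim ())) (Vars (coordShape.dim ()))) (Vars coordShape.par))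
    (.inl (.inl (0 : Fin 1))) (.inl (.inr (0 : Fin 1)))
  rel
    | .add => Fml.exPt (.conj
        (Fml.isUnitPt .new (.old (.inr unitVar)) (.old (.inr (axisVar 0))) (.old (.inr (axisVar 1))))
        (Fml.ter (.old (.inl ⟨(), (0 : Fin 3), (0 : Fin 1)⟩))
          (.old (.inl ⟨(), (1 : Fin 3), (0 : Fin 1)⟩)) .new
          (.old (.inl ⟨(), (2 : Fin 3), (0 : Fin 1)⟩))
          (.old (.inr unitVar)) (.old (.inr (axisVar 0))) (.old (.inr (axisVar 1)))))
    | .mul => Fml.exPt (.conj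
        (Fml.isOrigin .new (.old (.inr (axisVar 0))) (.old (.inr (axisVar 1))))
        (Fml.ter (.old (.inl ⟨(), (0 : Fin 3), (0 : Fin 1)⟩)) .new
          (.old (.inl ⟨(), (1 : Fin 3), (0 : Fin 1)⟩))
          (.old (.inl ⟨(), (2 : Fin 3), (0 : Fin 1)⟩))
          (.old (.inr unitVar)) (.old (.inr (axisVar 0))) (.old (.inr (axisVar 1)))))
    | .zero => Fml.isOrigin (.inl ⟨(), (0 : Fin 1), (0 : Fin 1)⟩) (.inr (axisVar 0))
        (.inr (axisVar 1))
    | .one => Fml.isUnitPt (.inl ⟨(), (0 : Fin 1), (0 : Fin 1)⟩) (.inr unitVar) (.inr (axisVar 0))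
        (.inr (axisVar 1))

theorem coordScheme_adm (M : Str.{u} planeSig) (p : Val M (Vars coordShape.par)) :
    coordScheme.Adm M p ↔ M.AdmissibleAxes (p _ (axisVar 0)) (p _ (axisVar 1)) (p _ unitVar) :=
  Fml.realize_admissibleAxes _ _ _ _

/-- Each point of the axis names itself. -/
theorem coordScheme_presents (M : Str.{u} planeSig) (p : Val M (Vars coordShape.par))
    (hne : ∃ A, M.Inc A (p _ (axisVar 0))) :
    coordScheme.Presents M p (M.coordField (p _ (axisVar 0)) (p _ (axisVar 1)) (p _ unitVar))
      fun _ x (b : M.PointsOn (p _ (axisVar 0))) => x PlaneSort.point (0 : Fin 1) = b.1 where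
  dom _ x := (Fml.realize_inc _ _ _).trans
    ⟨fun h => ⟨⟨_, h⟩, rfl⟩, fun ⟨b, hb⟩ => by
      change M.Inc (x PlaneSort.point (0 : Fin 1)) _
      rw [hb]
      exact b.2⟩
  unique _ x b c hb hc := Subtype.ext (hb.symm.trans hc)
  exists_name _ b := ⟨fun k => match k with
    | .point => (fun _ => b.1 : Fin 1 → M.Pt)
    | .line => (Fin.elim0 : Fin 0 → M.Ln), rfl⟩
  nonempty _ := by
    obtain ⟨A, hA⟩ := hne
    exact ⟨⟨A, hA⟩⟩
  eqv _ x y b c hb hc := by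
    refine (Fml.realize_eqPt _ _ _).trans ?_
    change x PlaneSort.point (0 : Fin 1) = y PlaneSort.point (0 : Fin 1) ↔ _
    rw [hb, hc]
    exact Subtype.ext_iff.symm
  rel r x z hz := by
    cases r
    · have h₀ := hz () (0 : Fin 3)
      have h₁ := hz () (1 : Fin 3)
      have h₂ := hz () (2 : Fin 3)
      simp only [coordScheme, Fml.realize_exPt, Fml.realize_conj, Fml.realize_isUnitPt,
        Fml.realize_ter]
      change (∃ I, M.IsUnitPt (p _ (axisVar 0)) (p _ (axisVar 1)) (p _ unitVar) I ∧
        M.Ter (p _ (axisVar 0)) (p _ (axisVar 1)) (p _ unitVar)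
          (x () (0 : Fin 3) PlaneSort.point (0 : Fin 1)) I
          (x () (1 : Fin 3) PlaneSort.point (0 : Fin 1))
          (x () (2 : Fin 3) PlaneSort.point (0 : Fin 1))) ↔ _
      rw [h₀, h₁, h₂]
      exact Iff.rfl
    · have h₀ := hz () (0 : Fin 3)
      have h₁ := hz () (1 : Fin 3)
      have h₂ := hz () (2 : Fin 3)
      simp only [coordScheme, Fml.realize_exPt, Fml.realize_conj, Fml.realize_isOrigin,
        Fml.realize_ter]
      change (∃ O, M.IsOrigin (p _ (axisVar 0)) (p _ (axisVar 1)) O ∧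
        M.Ter (p _ (axisVar 0)) (p _ (axisVar 1)) (p _ unitVar)
          (x () (0 : Fin 3) PlaneSort.point (0 : Fin 1))
          (x () (1 : Fin 3) PlaneSort.point (0 : Fin 1)) O
          (x () (2 : Fin 3) PlaneSort.point (0 : Fin 1))) ↔ _
      rw [h₀, h₁, h₂]
      exact Iff.rfl
    · have h₀ := hz () (0 : Fin 1)
      refine (Fml.realize_isOrigin _ _ _ _).trans ?_
      change M.IsOrigin _ _ (x () (0 : Fin 1) PlaneSort.point (0 : Fin 1)) ↔ _
      rw [h₀]
      exact Iff.rfl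
    · have h₀ := hz () (0 : Fin 1)
      refine (Fml.realize_isUnitPt _ _ _ _ _).trans ?_
      change M.IsUnitPt _ _ _ (x () (0 : Fin 1) PlaneSort.point (0 : Fin 1)) ↔ _
      rw [h₀]
      exact Iff.rfl

theorem coordScheme_exists_iso (M : Str.{u} planeSig) (p : Val M (Vars coordShape.par))
    (hp : M.AdmissibleAxes (p _ (axisVar 0)) (p _ (axisVar 1)) (p _ unitVar)) :
    coordScheme.WellDefined M p ∧ ∃ e : Str.Iso (coordScheme.induced M p)
      (M.coordField (p _ (axisVar 0)) (p _ (axisVar 1)) (p _ unitVar)), ∀ s x b,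
        coordScheme.Names M p s x b ↔ x PlaneSort.point (0 : Fin 1) =
          (e.toEquiv s b : M.PointsOn (p _ (axisVar 0))).1 := by
  obtain ⟨A, ⟨hA, -⟩, -⟩ := hp.1
  exact ⟨(coordScheme_presents M p ⟨A, hA⟩).wellDefined,
    (coordScheme_presents M p ⟨A, hA⟩).exists_iso⟩

theorem definesCoordField_coordScheme : DefinesCoordField.{u} coordScheme := by
  intro M _ l₀ m₀ Z₀
  refine ⟨coordScheme_adm M (axesVal M l₀ m₀ Z₀), fun hp => ?_⟩
  obtain ⟨-, e, he⟩ := coordScheme_exists_iso M (axesVal M l₀ m₀ Z₀) hp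
  exact ⟨e, fun A => ⟨(e.toEquiv ()).symm A, (he _ _ _).2
    (congrArg Subtype.val (Equiv.apply_symm_apply (e.toEquiv ()) A)).symm, Equiv.apply_symm_apply _ _⟩⟩

/-! ### The Cartesian plane as an interpretation -/

/-- The Cartesian plane, as a translation scheme. -/
def cartesianScheme : Translation cartesianShape where
  adm := Fml.neg .falsum
  dom
    | .point => Fml.neg .falsum
    | .line => (Fml.zero (.inl (0 : Fin 3))).neg.disj (Fml.zero (.inl (1 : Fin 3))).neg
  eqv
    | .point => (Fml.eqF (.inl (.inl (0 : Fin 2))) (.inl (.inr (0 : Fin 2)))).conj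
        (Fml.eqF (.inl (.inl (1 : Fin 2))) (.inl (.inr (1 : Fin 2))))
    | .line => Fml.proportional (.inl (.inl (0 : Fin 3))) (.inl (.inl (1 : Fin 3)))
        (.inl (.inl (2 : Fin 3))) (.inl (.inr (0 : Fin 3))) (.inl (.inr (1 : Fin 3)))
        (.inl (.inr (2 : Fin 3)))
  rel
    | .inc => Fml.onLine (.inl ⟨PlaneSort.line, (0 : Fin 1), (0 : Fin 3)⟩)
        (.inl ⟨PlaneSort.line, (0 : Fin 1), (1 : Fin 3)⟩)
        (.inl ⟨PlaneSort.line, (0 : Fin 1), (2 : Fin 3)⟩)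
        (.inl ⟨PlaneSort.point, (0 : Fin 1), (0 : Fin 2)⟩)
        (.inl ⟨PlaneSort.point, (0 : Fin 1), (1 : Fin 2)⟩)
    | .perp => Fml.orth (.inl ⟨PlaneSort.line, (0 : Fin 2), (0 : Fin 3)⟩)
        (.inl ⟨PlaneSort.line, (0 : Fin 2), (1 : Fin 3)⟩)
        (.inl ⟨PlaneSort.line, (1 : Fin 2), (0 : Fin 3)⟩)
        (.inl ⟨PlaneSort.line, (1 : Fin 2), (1 : Fin 3)⟩)
    | .between => ((Fml.eqF (.inl ⟨PlaneSort.point, (0 : Fin 3), (0 : Fin 2)⟩)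
        (.inl ⟨PlaneSort.point, (2 : Fin 3), (0 : Fin 2)⟩)).conj
        (Fml.eqF (.inl ⟨PlaneSort.point, (0 : Fin 3), (1 : Fin 2)⟩)
        (.inl ⟨PlaneSort.point, (2 : Fin 3), (1 : Fin 2)⟩))).neg.conj
        (Fml.inner (.inl ⟨PlaneSort.point, (0 : Fin 3), (0 : Fin 2)⟩)
          (.inl ⟨PlaneSort.point, (1 : Fin 3), (0 : Fin 2)⟩)
          (.inl ⟨PlaneSort.point, (2 : Fin 3), (0 : Fin 2)⟩)
          (.inl ⟨PlaneSort.point, (0 : Fin 3), (1 : Fin 2)⟩)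
          (.inl ⟨PlaneSort.point, (1 : Fin 3), (1 : Fin 2)⟩)
          (.inl ⟨PlaneSort.point, (2 : Fin 3), (1 : Fin 2)⟩))

section

variable {F : Type u} [Field F]

/-- The entries of a tuple of elements of a field. -/
abbrev pairEntry (x : Val (fieldStr F) (Vars (cartesianShape.dim .point))) (i : Fin 2) : F := x () i

/-- The entries of a tuple of elements of a field. -/
abbrev tripleEntry (x : Val (fieldStr F) (Vars (cartesianShape.dim .line))) (i : Fin 3) : F :=
  x () i

/-- The pair `(x, y)` names a point, the triple `(a, b, c)` names a line. -/
def CartesianName (F : Type u) [Field F] : ∀ s, Val (fieldStr F) (Vars (cartesianShape.dim s)) →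
    (cartesianPlane F).carrier s → Prop
  | .point, x, b => (b : F × F) = (pairEntry x 0, pairEntry x 1)
  | .line, x, b => ∃ h : tripleEntry x 0 ≠ 0 ∨ tripleEntry x 1 ≠ 0, (b : CartesianLine F) =
      Quotient.mk (lineSetoid F) ⟨(tripleEntry x 0, tripleEntry x 1, tripleEntry x 2), h⟩

theorem cartesianScheme_presents (p : Val (fieldStr F) (Vars cartesianShape.par)) :
    cartesianScheme.Presents (fieldStr F) p (cartesianPlane F) (CartesianName F) where
  dom s x := by
    cases s
    · exact iff_of_true (fun h => h) ⟨_, rfl⟩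
    · refine (Fml.realize_disj _ _ _).trans ?_
      change tripleEntry x 0 ≠ 0 ∨ tripleEntry x 1 ≠ 0 ↔ _
      exact ⟨fun h => ⟨_, h, rfl⟩, fun ⟨_, h, _⟩ => h⟩
  unique s x b c hb hc := by
    cases s
    · exact Eq.trans (α := F × F) hb (Eq.symm (α := F × F) hc)
    · obtain ⟨_, hb⟩ := hb
      obtain ⟨_, hc⟩ := hc
      exact hb.trans hc.symm
  exists_name s b := by
    cases s
    · exact ⟨fun _ => (![Prod.fst (α := F) (β := F) b, Prod.snd (α := F) (β := F) b] : Fin 2 → F),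
        rfl⟩
    · obtain ⟨c, rfl⟩ := Quotient.exists_rep (s := lineSetoid F) b
      exact ⟨fun _ => (![c.1.1, c.1.2.1, c.1.2.2] : Fin 3 → F), c.2, rfl⟩
  nonempty s := by
    cases s
    · exact ⟨((0, 0) : F × F)⟩
    · exact ⟨(Quotient.mk (lineSetoid F) ⟨(1, 0, 0), .inl one_ne_zero⟩ : CartesianLine F)⟩
  eqv s x y b c hb hc := by
    cases s
    · refine (Fml.realize_conj _ _ _).trans ?_
      change pairEntry x 0 = pairEntry y 0 ∧ pairEntry x 1 = pairEntry y 1 ↔ _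
      change (b : F × F) = _ at hb
      change (c : F × F) = _ at hc
      rw [hb, hc]
      exact (Prod.ext_iff (α := F) (β := F) (x := (_, _)) (y := (_, _))).symm
    · obtain ⟨h, rfl⟩ := hb
      obtain ⟨h', rfl⟩ := hc
      refine (Fml.realize_proportional _ _ _ _ _ _ _).trans ?_
      change (∃ k : F, k ≠ 0 ∧ k * tripleEntry x 0 = tripleEntry y 0 ∧
        k * tripleEntry x 1 = tripleEntry y 1 ∧ k * tripleEntry x 2 = tripleEntry y 2) ↔ _
      refine Iff.trans ?_ (Quotient.eq (r := lineSetoid F)).symm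
      refine exists_congr fun k => and_congr_right fun _ => ?_
      constructor
      · rintro ⟨h₁, h₂, h₃⟩
        exact Prod.ext h₁.symm (Prod.ext h₂.symm h₃.symm)
      · intro h₁
        exact ⟨(congrArg Prod.fst h₁).symm, (congrArg (fun q => q.2.1) h₁).symm,
          (congrArg (fun q => q.2.2) h₁).symm⟩
  rel r x z hz := by
    cases r
    · rw [Str.rel_inc_iff]
      have h₀ := hz PlaneSort.point (0 : Fin 1)
      obtain ⟨h, h₁⟩ := hz PlaneSort.line (0 : Fin 1)
      change (z PlaneSort.point (0 : Fin 1) : F × F) = _ at h₀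
      rw [h₀, h₁]
      refine Iff.trans ?_ ((cartesianPlane_hasEq ⟨_, h⟩).2 _).symm
      exact Fml.realize_onLine _ _ _ _ _ _
    · rw [Str.rel_perp_iff]
      obtain ⟨h, h₁⟩ := hz PlaneSort.line (0 : Fin 2)
      obtain ⟨h', h₂⟩ := hz PlaneSort.line (1 : Fin 2)
      rw [h₁, h₂]
      refine Iff.trans ?_ (cartesianPlane_perp_iff ⟨_, h⟩ ⟨_, h'⟩).symm
      exact Fml.realize_orth _ _ _ _ _
    · rw [Str.rel_between_iff, cartesianPlane_chart.be_iff]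
      have h₀ := hz PlaneSort.point (0 : Fin 3)
      have h₁ := hz PlaneSort.point (1 : Fin 3)
      have h₂ := hz PlaneSort.point (2 : Fin 3)
      change (z PlaneSort.point (0 : Fin 3) : F × F) = _ at h₀
      change (z PlaneSort.point (1 : Fin 3) : F × F) = _ at h₁
      change (z PlaneSort.point (2 : Fin 3) : F × F) = _ at h₂
      rw [h₀, h₁, h₂]
      refine (Fml.realize_conj _ _ _).trans (and_congr ?_ (Fml.realize_inner _ _ _ _ _ _ _))
      exact not_congr ((Fml.realize_conj _ _ _).trans
        (Prod.ext_iff (α := F) (β := F) (x := (_, _)) (y := (_, _))).symm)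

end

theorem definesCartesianPlane_cartesianScheme : DefinesCartesianPlane.{u} cartesianScheme := by
  intro F _ _ p
  obtain ⟨e, he⟩ := (cartesianScheme_presents p).exists_iso
  refine ⟨fun h => h, e, fun x y => ⟨(e.toEquiv .point).symm ((x, y) : F × F), ?_,
    Equiv.apply_symm_apply _ _⟩, fun c => ⟨(e.toEquiv .line).symm
      (Quotient.mk (lineSetoid F) c : CartesianLine F), ?_, Equiv.apply_symm_apply _ _⟩⟩
  · exact (he PlaneSort.point _ _).2 (Equiv.apply_symm_apply (e.toEquiv PlaneSort.point) _)
  · exact (he PlaneSort.line _ _).2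
      (Exists.intro c.2 (Equiv.apply_symm_apply (e.toEquiv PlaneSort.line) _))

/-- The internal plane of a structure that is isomorphic to a field. -/
theorem cartesianScheme_exists_iso {F : Type u} [Field F] {N : Str.{u} fieldSig}
    (e : Str.Iso N (fieldStr F)) (p : Val N (Vars cartesianShape.par)) :
    cartesianScheme.WellDefined N p ∧ ∃ E : Str.Iso (cartesianScheme.induced N p)
      (cartesianPlane F), ∀ s x b, cartesianScheme.Names N p s x b ↔
        CartesianName F s (x.map e) (E.toEquiv s b) := by
  have h := (cartesianScheme_presents (p.map e)).of_iso e
  exact ⟨h.wellDefined, h.exists_iso⟩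

/-! ### The bi-interpretation -/

namespace Str

variable {M : Str.{u} planeSig} {F : Type u} [Field F] {x y : M.Pt → F}

/-! ### Geometric content of the isomorphism formulas -/

namespace AxisChart

variable {l₀ m₀ : M.Ln} {Z₀ : M.Pt} {u v : M.Pt → F} (h : AxisChart x y l₀ m₀ Z₀ u v)
include h

/-- A point A of `l₀` is O + u(A)(I - O), a statement about ratios and thus independent of the
chart. The origin and the unit point solve linear equations in the names of the parameters. -/
theorem unitMultiple_iff (hc : AffineChart x y) {a b c a' b' c' : F} (hl : HasEq x y l₀ a b c)
    (hm : HasEq x y m₀ a' b' c') {A : M.Pt} (hA : M.Inc A l₀) {r s : F} :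
    (∃ o o' e e' : F, a * o + b * o' + c = 0 ∧ a' * o + b' * o' + c' = 0 ∧
      a * e + b * e' + c = 0 ∧ (∃ w, a' * e + b' * e' = w ∧ a' * x Z₀ + b' * y Z₀ = w) ∧
      r = o + u A * (e - o) ∧ s = o' + u A * (e' - o')) ↔ x A = r ∧ y A = s := by
  have ratio : ∀ {O I}, v O = 0 → u O = 0 → v I = 0 → u I = 1 → IsRatio x y (u A) O A I :=
    fun h₁ h₂ h₃ h₄ => h.ratio.1 ⟨by rw [h₂, h₄]; ring, by rw [h₁, h₃, h.inc_left.1 hA]; ring⟩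
  constructor
  · rintro ⟨o, o', e, e', h₁, h₂, h₃, ⟨w, h₄, h₅⟩, h₆, h₇⟩
    obtain ⟨O, rfl, rfl⟩ := hc.exists_pt o o'
    obtain ⟨I, rfl, rfl⟩ := hc.exists_pt e e'
    have h₈ : M.Along m₀ Z₀ I := (hc.along_iff hm).2 (by linear_combination h₄ - h₅)
    rw [h.along_right, h.fst_unit] at h₈
    have h₉ := ratio (h.inc_left.1 ((hl.2 O).2 h₁)) (h.inc_right.1 ((hm.2 O).2 h₂))
      (h.inc_left.1 ((hl.2 I).2 h₃)) h₈.symm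
    exact ⟨h₉.1.trans h₆.symm, h₉.2.trans h₇.symm⟩
  · rintro ⟨rfl, rfl⟩
    obtain ⟨O, hO, hO'⟩ := h.exists_pt 0 0
    obtain ⟨I, hI, hI'⟩ := h.exists_pt 1 0
    have h₁ := (hc.along_iff hm).1 (h.along_right.2 (h.fst_unit.trans hI.symm))
    have h₂ := ratio hO' hO hI' hI
    exact ⟨x O, y O, x I, y I, (hl.2 O).1 (h.inc_left.2 hO'), (hm.2 O).1 (h.inc_right.2 hO),
      (hl.2 I).1 (h.inc_left.2 hI'), ⟨_, rfl, by linear_combination -h₁⟩, h₂.1, h₂.2⟩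

/-- The left side is computed by the ternary operation as T(1, T(b, y, T(a, x, 0)), c) = 0. -/
theorem lineEquation_iff {A B C X Y : M.Pt} (hA : v A = 0) (hB : v B = 0) (hC : v C = 0)
    (hX : v X = 0) (hY : v Y = 0) :
    (∃ O I R S, M.IsOrigin l₀ m₀ O ∧ M.IsUnitPt l₀ m₀ Z₀ I ∧ M.Ter l₀ m₀ Z₀ A X O R ∧
      M.Ter l₀ m₀ Z₀ B Y R S ∧ M.Ter l₀ m₀ Z₀ I S C O) ↔ u A * u X + u B * u Y + u C = 0 := by
  simp only [h.isOrigin_iff, h.isUnitPt_iff, h.ter_iff]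
  constructor
  · rintro ⟨O, I, R, S, ⟨-, hO⟩, ⟨-, hI⟩, ⟨-, h₁⟩, ⟨-, h₂⟩, -, h₃⟩
    rw [hO, hI, h₂, h₁, hO] at h₃
    linear_combination -h₃
  · intro h₁
    obtain ⟨O, hO, hO'⟩ := h.exists_pt 0 0
    obtain ⟨I, hI, hI'⟩ := h.exists_pt 1 0
    obtain ⟨R, hR, hR'⟩ := h.exists_pt (u A * u X) 0
    obtain ⟨S, hS, hS'⟩ := h.exists_pt (u A * u X + u B * u Y) 0
    exact ⟨O, I, R, S, ⟨hO', hO⟩, ⟨hI', hI⟩, ⟨⟨hA, hX, hO', hR'⟩, by rw [hR, hO, add_zero]⟩,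
      ⟨⟨hB, hY, hR', hS'⟩, by rw [hS, hR, add_comm]⟩, ⟨hI', hS', hC, hO'⟩,
      by rw [hO, hI, hS, one_mul, h₁]⟩

/-- A line has the equation `A X + B Y + C = 0`, with respect to the axes `l₀` and `m₁`. -/
theorem hasEq_iff {m₁ : M.Ln} {Z₁ : M.Pt} {u' v' : M.Pt → F}
    (h' : AxisChart x y l₀ m₁ Z₁ u' v') (hu : ∀ A, M.Inc A l₀ → u' A = u A) {A B C : M.Pt}
    (hA : M.Inc A l₀) (hB : M.Inc B l₀) (hC : M.Inc C l₀) {k : M.Ln} :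
    (¬ (M.IsOrigin l₀ m₀ A ∧ M.IsOrigin l₀ m₀ B) ∧ ∀ P X Y, M.Coord l₀ m₁ Z₁ P X Y →
      (M.Inc P k ↔ ∃ O I R S, M.IsOrigin l₀ m₀ O ∧ M.IsUnitPt l₀ m₀ Z₀ I ∧
        M.Ter l₀ m₀ Z₀ A X O R ∧ M.Ter l₀ m₀ Z₀ B Y R S ∧ M.Ter l₀ m₀ Z₀ I S C O)) ↔
      HasEq u' v' k (u A) (u B) (u C) := by
  rw [h.inc_left] at hA hB hC
  rw [HasEq, h.isOrigin_iff, h.isOrigin_iff, and_iff_right hA, and_iff_right hB, not_and_or]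
  refine and_congr_right fun _ => ⟨fun h₁ P => ?_, fun h₁ P X Y hP => ?_⟩
  · obtain ⟨X, hX, hX'⟩ := h'.exists_pt (u' P) 0
    obtain ⟨Y, hY, hY'⟩ := h'.exists_pt (v' P) 0
    have hXl := h'.inc_left.2 hX'
    have hYl := h'.inc_left.2 hY'
    rw [h₁ P X Y (h'.coord_iff.2 ⟨⟨hX', hX⟩, hY', hY⟩),
      h.lineEquation_iff hA hB hC (h.inc_left.1 hXl) (h.inc_left.1 hYl), ← hu X hXl, ← hu Y hYl,
      hX, hY]
  · obtain ⟨⟨hX', hX⟩, hY', hY⟩ := h'.coord_iff.1 hP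
    have hXl := h'.inc_left.2 hX'
    have hYl := h'.inc_left.2 hY'
    rw [h₁ P, h.lineEquation_iff hA hB hC (h.inc_left.1 hXl) (h.inc_left.1 hYl), ← hu X hXl,
      ← hu Y hYl, hX, hY]

end AxisChart

theorem AffineChart.exists_admissibleAxes (h : AffineChart x y) :
    ∃ (l₀ m₀ : M.Ln) (Z₀ : M.Pt), M.AdmissibleAxes l₀ m₀ Z₀ := by
  obtain ⟨l, hl⟩ := h.exists_line 0 1 0 (.inr one_ne_zero)
  obtain ⟨m, hm⟩ := h.exists_line 1 0 0 (.inl one_ne_zero)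
  obtain ⟨O, hO, hO'⟩ := h.exists_pt 0 0
  obtain ⟨Z, hZ, hZ'⟩ := h.exists_pt 1 1
  have hl' : ∀ A, M.Inc A l ↔ y A = 0 := fun A => by rw [hl.2]; simp
  have hm' : ∀ A, M.Inc A m ↔ x A = 0 := fun A => by rw [hm.2]; simp
  refine ⟨l, m, Z, ⟨O, ⟨(hl' O).2 hO', (hm' O).2 hO⟩, fun A hA => ?_⟩, ?_, ?_⟩
  · exact h.ext A O (((hm' A).1 hA.2).trans hO.symm) (((hl' A).1 hA.1).trans hO'.symm)
  · rw [hl', hZ']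
    exact one_ne_zero
  · rw [hm', hZ]
    exact one_ne_zero

end Str

/-- The isomorphism from a field to the coordinate field of its Cartesian plane. -/
def fieldIsoFormula : IsoFormula cartesianShape coordShape := fun _ =>
  Fml.unitMultiple
    (.inr ⟨PlaneSort.line, axisVar 0, (0 : Fin 3)⟩) (.inr ⟨PlaneSort.line, axisVar 0, (1 : Fin 3)⟩)
    (.inr ⟨PlaneSort.line, axisVar 0, (2 : Fin 3)⟩) (.inr ⟨PlaneSort.line, axisVar 1, (0 : Fin 3)⟩)
    (.inr ⟨PlaneSort.line, axisVar 1, (1 : Fin 3)⟩) (.inr ⟨PlaneSort.line, axisVar 1, (2 : Fin 3)⟩)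
    (.inl (.inl (.inl .var)))
    (.inr ⟨PlaneSort.point, unitVar, (1 : Fin 2)⟩)
    (.inl (.inl (.inr ⟨PlaneSort.point, (0 : Fin 1), (0 : Fin 2)⟩)))
    (.inl (.inl (.inr ⟨PlaneSort.point, (0 : Fin 1), (1 : Fin 2)⟩)))
    (.inr ⟨PlaneSort.point, unitVar, (0 : Fin 2)⟩)

/-- The isomorphism from a plane to the Cartesian plane over its coordinate field. -/
def planeIsoFormula : IsoFormula coordShape cartesianShape
  | .point => Fml.pointCoords (.inl (.inl (.inr ⟨(), (0 : Fin 2), (0 : Fin 1)⟩)))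
      (.inl (.inl (.inr ⟨(), (1 : Fin 2), (0 : Fin 1)⟩))) (.inl (.inr unitVar))
      (.inl (.inl (.inl .var))) (.inl (.inr (axisVar 0))) (.inl (.inr (axisVar 1)))
  | .line => Fml.lineCoords (.inl (.inl (.inr ⟨(), (0 : Fin 3), (0 : Fin 1)⟩)))
      (.inl (.inl (.inr ⟨(), (1 : Fin 3), (0 : Fin 1)⟩)))
      (.inl (.inl (.inr ⟨(), (2 : Fin 3), (0 : Fin 1)⟩))) (.inl (.inr unitVar))
      (.inl (.inr (axisVar 0))) (.inl (.inr (axisVar 1))) (.inl (.inl (.inl .var)))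

theorem isInterpretation_cartesianScheme :
    cartesianScheme.IsInterpretation EuclideanFieldStr.{u} Str.IsEuclideanOrderedMetricWu.{u} := by
  rintro N ⟨F, _, hF, ⟨e⟩⟩
  refine ⟨⟨fun _ => Fin.elim0, fun h => h⟩, fun p _ => ?_⟩
  obtain ⟨h, E, -⟩ := cartesianScheme_exists_iso e p
  exact ⟨h, isEuclideanOrderedMetricWu_of_iso hF E⟩

theorem isInterpretation_coordScheme :
    coordScheme.IsInterpretation Str.IsEuclideanOrderedMetricWu.{u} EuclideanFieldStr.{u} := by
  intro M hM
  obtain ⟨F, _, x, y, hF, hE⟩ := hM.exists_euclideanChart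
  constructor
  · obtain ⟨l₀, m₀, Z₀, h⟩ := hE.exists_admissibleAxes
    exact ⟨axesVal M l₀ m₀ Z₀, (coordScheme_adm M (axesVal M l₀ m₀ Z₀)).2 h⟩
  · intro p hp
    have hp' := (coordScheme_adm M p).1 hp
    obtain ⟨h, e, -⟩ := coordScheme_exists_iso M p hp'
    obtain ⟨u, v, hA⟩ := hE.exists_axisChart hp'
    exact ⟨h, F, inferInstance, hF, ⟨e.trans hA.iso⟩⟩

/-- The isomorphism is the inverse of the coordinate u on `l₀`. In terms of pairs it is t ↦ O + t(I
- O), which the formula expresses through the triples and the pair that name the axes and the unit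
point. -/
theorem definesIso_fieldIsoFormula :
    DefinesIso cartesianScheme coordScheme fieldIsoFormula EuclideanFieldStr.{u} := by
  rintro N ⟨F, _, hF, ⟨e₀⟩⟩ p - q q' hq hadm
  obtain ⟨-, E, hE⟩ := cartesianScheme_exists_iso e₀ p
  have hc := cartesianPlane_chart.comp_iso E
  have hadm' := (coordScheme_adm _ q).1 hadm
  obtain ⟨u, v, h⟩ := hc.exists_axisChart hadm'
  obtain ⟨-, E₂, hE₂⟩ := coordScheme_exists_iso _ q hadm'
  have hline : ∀ i : Fin 2, Str.HasEq (M := cartesianScheme.induced N p)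
      (fun A => Prod.fst (E.toEquiv PlaneSort.point A : F × F))
      (fun A => Prod.snd (E.toEquiv PlaneSort.point A : F × F)) (q PlaneSort.line (axisVar i))
      (tripleEntry ((q' PlaneSort.line (axisVar i)).map e₀) 0)
      (tripleEntry ((q' PlaneSort.line (axisVar i)).map e₀) 1)
      (tripleEntry ((q' PlaneSort.line (axisVar i)).map e₀) 2) := by
    intro i
    obtain ⟨h₁, h₂⟩ := (hE PlaneSort.line _ _).1 (hq PlaneSort.line (axisVar i))
    refine ⟨h₁, fun A => ?_⟩
    rw [E.inc_iff, h₂]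
    exact (cartesianPlane_hasEq ⟨(_, _, _), h₁⟩).2 _
  have hZ : (E.toEquiv PlaneSort.point (q PlaneSort.point unitVar) : F × F) =
      (pairEntry ((q' PlaneSort.point unitVar).map e₀) 0,
        pairEntry ((q' PlaneSort.point unitVar).map e₀) 1) :=
    (hE PlaneSort.point _ _).1 (hq PlaneSort.point unitVar)
  refine ⟨e₀.trans (E₂.trans h.iso).symm, fun s a y => ?_⟩
  obtain ⟨A, hA⟩ : ∃ A : (cartesianScheme.induced N p).PointsOn (q PlaneSort.line (axisVar 0)),
      A = E₂.toEquiv s ((e₀.trans (E₂.trans h.iso).symm).toEquiv s a) := ⟨_, rfl⟩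
  have hu : u A.1 = (e₀.toEquiv s a : F) := by
    have : A = h.equiv.symm (e₀.toEquiv s a : F) := hA.trans (Equiv.apply_symm_apply _ _)
    rw [this]
    exact h.equiv.apply_symm_apply _
  have hyA : (∃ z : Val (cartesianScheme.induced N p) (Vars (coordShape.dim s)),
      (∀ l i, cartesianScheme.Names N p l (y l i) (z l i)) ∧
        coordScheme.Names (cartesianScheme.induced N p) q s z
          ((e₀.trans (E₂.trans h.iso).symm).toEquiv s a)) ↔
      (E.toEquiv PlaneSort.point A.1 : F × F) =
        (pairEntry ((y PlaneSort.point (0 : Fin 1)).map e₀) 0,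
          pairEntry ((y PlaneSort.point (0 : Fin 1)).map e₀) 1) := by
    constructor
    · rintro ⟨z, hz, hz'⟩
      have h₁ : z PlaneSort.point (0 : Fin 1) = A.1 :=
        ((hE₂ s z _).1 hz').trans (congrArg Subtype.val hA.symm)
      rw [← h₁]
      exact (hE PlaneSort.point _ _).1 (hz PlaneSort.point (0 : Fin 1))
    · intro h₁
      refine ⟨fun l => match l with
        | .point => (fun _ => A.1 : Fin 1 → (cartesianScheme.induced N p).Pt)
        | .line => (Fin.elim0 : Fin 0 → (cartesianScheme.induced N p).Ln), fun l i => ?_,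
        (hE₂ s _ _).2 (congrArg Subtype.val hA)⟩
      cases l
      · obtain rfl : i = (0 : Fin 1) := Subsingleton.elim (α := Fin 1) _ _
        exact (hE PlaneSort.point _ _).2 h₁
      · exact Fin.elim0 (i : Fin 0)
  refine Iff.trans ?_ hyA.symm
  -- N is only isomorphic to a field; the truth of the formula is transported to the field, where it
  -- can be evaluated.
  refine (Fml.realize_map e₀ _ _).symm.trans ((Fml.realize_unitMultiple _ _ _ _ _ _ _ _ _ _ _
    _).trans ?_)
  refine Iff.trans ?_ (Prod.ext_iff (α := F) (β := F) (y := (_, _))).symm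
  have key := h.unitMultiple_iff hc.toAffineChart (hline 0) (hline 1) A.2
    (r := pairEntry ((y PlaneSort.point (0 : Fin 1)).map e₀) 0)
    (s := pairEntry ((y PlaneSort.point (0 : Fin 1)).map e₀) 1)
  rw [hu, hZ] at key
  exact key

/-- A point goes to its coordinates in the orthonormal frame and a line to its equation there. As u'
agrees with u on `l₀`, values in the field of the chart can be read as points of `l₀`. Uniqueness of
the frame makes the existential quantifier over frames harmless. -/
theorem definesIso_planeIsoFormula :
    DefinesIso coordScheme cartesianScheme planeIsoFormula Str.IsEuclideanOrderedMetricWu.{u} := by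
  intro M hM p hp q q' _ _
  obtain ⟨F, _, x, y, hF, hE⟩ := hM.exists_euclideanChart
  have hp' := (coordScheme_adm M p).1 hp
  obtain ⟨u, v, h⟩ := hE.exists_axisChart hp'
  obtain ⟨u', v', m₁, Z₁, hE', hu, h', huniq⟩ := hE.exists_orthoFrame hF h
  obtain ⟨-, E₁, hE₁⟩ := coordScheme_exists_iso M p hp'
  obtain ⟨-, E₂, hE₂⟩ := cartesianScheme_exists_iso (E₁.trans h.iso) q
  obtain ⟨e₃, hpt, hln⟩ := hE'.exists_iso
  refine ⟨e₃.trans E₂.symm, fun s a z => ?_⟩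
  have hE₃ : E₂.toEquiv s ((e₃.trans E₂.symm).toEquiv s a) = e₃.toEquiv s a :=
    Equiv.apply_symm_apply _ _
  have hval : ∀ b : (coordScheme.induced M p).carrier (),
      ((E₁.trans h.iso).toEquiv () b : F) =
        u (E₁.toEquiv () b : M.PointsOn (p PlaneSort.line (axisVar 0))).1 := fun _ => rfl
  have mem : ∀ b : (coordScheme.induced M p).carrier (),
      M.Inc (E₁.toEquiv () b : M.PointsOn (p PlaneSort.line (axisVar 0))).1
        (p PlaneSort.line (axisVar 0)) :=
    fun b => (E₁.toEquiv () b : M.PointsOn (p PlaneSort.line (axisVar 0))).2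
  have exists_elem : ∀ {A : M.Pt}, M.Inc A (p PlaneSort.line (axisVar 0)) →
      ∃ b : (coordScheme.induced M p).carrier (),
        A = (E₁.toEquiv () b : M.PointsOn (p PlaneSort.line (axisVar 0))).1 := fun {A} hA =>
    ⟨(E₁.toEquiv ()).symm ⟨A, hA⟩,
      (congrArg Subtype.val ((E₁.toEquiv ()).apply_symm_apply ⟨A, hA⟩)).symm⟩
  cases s
  · change M.Pt at a
    refine (Fml.realize_pointCoords _ _ _ _ _ _ _).trans ?_
    change (∃ n W, M.OrthoFrame (p PlaneSort.line (axisVar 0)) (p PlaneSort.line (axisVar 1))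
      (p PlaneSort.point unitVar) n W ∧ M.Coord (p PlaneSort.line (axisVar 0)) n W a
        (z () (0 : Fin 2) PlaneSort.point (0 : Fin 1))
        (z () (1 : Fin 2) PlaneSort.point (0 : Fin 1))) ↔ _
    constructor
    · rintro ⟨n, W, hnW, hco⟩
      obtain ⟨rfl, rfl⟩ := (huniq n W).1 hnW
      obtain ⟨⟨hX', hX⟩, hY', hY⟩ := h'.coord_iff.1 hco
      have hXl := h'.inc_left.2 hX'
      have hYl := h'.inc_left.2 hY'
      obtain ⟨b, hb⟩ := exists_elem hXl
      obtain ⟨c, hc⟩ := exists_elem hYl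
      refine ⟨fun _ => (![b, c] : Fin 2 → (coordScheme.induced M p).carrier ()), fun _ i => ?_,
        (hE₂ PlaneSort.point _ _).2 (hE₃.trans ((hpt a).trans (Prod.ext ?_ ?_)))⟩
      · change Fin 2 at i
        fin_cases i
        · exact (hE₁ _ _ _).2 hb
        · exact (hE₁ _ _ _).2 hc
      · change u' a = _
        rw [← hX, hu _ hXl, hb]
        exact (hval b).symm
      · change v' a = _
        rw [← hY, hu _ hYl, hc]
        exact (hval c).symm
    · rintro ⟨w, hw, hw'⟩
      have h₁ : ((u' a, v' a) : F × F) = _ :=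
        ((hpt a).symm.trans hE₃.symm).trans ((hE₂ PlaneSort.point _ _).1 hw')
      have h₂ := (hE₁ _ _ _).1 (hw () (0 : Fin 2))
      have h₃ := (hE₁ _ _ _).1 (hw () (1 : Fin 2))
      have hXl : M.Inc (z () (0 : Fin 2) PlaneSort.point (0 : Fin 1))
        (p PlaneSort.line (axisVar 0)) := h₂ ▸ mem _
      have hYl : M.Inc (z () (1 : Fin 2) PlaneSort.point (0 : Fin 1))
        (p PlaneSort.line (axisVar 0)) := h₃ ▸ mem _
      refine ⟨m₁, Z₁, (huniq _ _).2 ⟨rfl, rfl⟩, h'.coord_iff.2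
        ⟨⟨h'.inc_left.1 hXl, ?_⟩, h'.inc_left.1 hYl, ?_⟩⟩
      · rw [hu _ hXl, h₂]
        exact (congrArg Prod.fst h₁).symm
      · rw [hu _ hYl, h₃]
        exact (congrArg Prod.snd h₁).symm
  · change M.Ln at a
    refine (Fml.realize_lineCoords _ _ _ _ _ _ _ _).trans ?_
    obtain ⟨A, hA⟩ : ∃ A : M.Pt, A = z () (0 : Fin 3) PlaneSort.point (0 : Fin 1) := ⟨_, rfl⟩
    obtain ⟨B, hB⟩ : ∃ B : M.Pt, B = z () (1 : Fin 3) PlaneSort.point (0 : Fin 1) := ⟨_, rfl⟩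
    obtain ⟨C, hC⟩ : ∃ C : M.Pt, C = z () (2 : Fin 3) PlaneSort.point (0 : Fin 1) := ⟨_, rfl⟩
    refine Iff.trans (b := M.Inc A (p PlaneSort.line (axisVar 0)) ∧
      M.Inc B (p PlaneSort.line (axisVar 0)) ∧ M.Inc C (p PlaneSort.line (axisVar 0)) ∧
        Str.HasEq u' v' a (u A) (u B) (u C)) ?_ ?_
    · rw [hA, hB, hC]
      refine and_congr_right fun hA => and_congr_right fun hB => and_congr_right fun hC => ?_
      refine Iff.trans ?_ (h.hasEq_iff h' hu hA hB hC)
      refine and_congr_right fun _ => ?_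
      constructor
      · rintro ⟨n, W, hnW, hco⟩
        obtain ⟨rfl, rfl⟩ := (huniq n W).1 hnW
        exact hco
      · exact fun hco => ⟨m₁, Z₁, (huniq _ _).2 ⟨rfl, rfl⟩, hco⟩
    · constructor
      · rintro ⟨hAl, hBl, hCl, heq⟩
        obtain ⟨b, hb⟩ := exists_elem hAl
        obtain ⟨c, hc⟩ := exists_elem hBl
        obtain ⟨d, hd⟩ := exists_elem hCl
        refine ⟨fun _ => (![b, c, d] : Fin 3 → (coordScheme.induced M p).carrier ()), fun _ i => ?_,
          (hE₂ PlaneSort.line _ _).2 ?_⟩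
        · change Fin 3 at i
          fin_cases i
          · exact (hE₁ _ _ _).2 (hA.symm.trans hb)
          · exact (hE₁ _ _ _).2 (hB.symm.trans hc)
          · exact (hE₁ _ _ _).2 (hC.symm.trans hd)
        · rw [hb, hc, hd] at heq
          exact Exists.intro heq.1 (hE₃.trans (hln a ⟨(_, _, _), heq.1⟩ heq))
      · rintro ⟨w, hw, hw'⟩
        obtain ⟨h₁, h₂⟩ := (hE₂ PlaneSort.line _ _).1 hw'
        have h₃ := hA.trans ((hE₁ _ _ _).1 (hw () (0 : Fin 3)))
        have h₄ := hB.trans ((hE₁ _ _ _).1 (hw () (1 : Fin 3)))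
        have h₅ := hC.trans ((hE₁ _ _ _).1 (hw () (2 : Fin 3)))
        refine ⟨h₃ ▸ mem _, h₄ ▸ mem _, h₅ ▸ mem _, ?_⟩
        rw [h₃, h₄, h₅]
        refine ⟨h₁, fun P => ?_⟩
        rw [e₃.inc_iff, hpt, ← hE₃, h₂]
        exact (cartesianPlane_hasEq ⟨(_, _, _), h₁⟩).2 (u' P, v' P)

theorem isBiInterpretation_schemes :
    IsBiInterpretation EuclideanFieldStr.{u} Str.IsEuclideanOrderedMetricWu.{u} cartesianScheme
      coordScheme fieldIsoFormula planeIsoFormula :=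
  ⟨isInterpretation_cartesianScheme, isInterpretation_coordScheme, definesIso_fieldIsoFormula,
    definesIso_planeIsoFormula⟩

end OrigamiGeometry

/-! ### The five statements assembled from charts -/

theorem mainTheorem3 :
    -- (i) the plane over a Euclidean field is a Euclidean ordered metric Wu plane
    (∀ (F : Type u) [Field F], IsEuclideanField F →
      (cartesianPlane F).IsEuclideanOrderedMetricWu) ∧
    -- (ii) the coordinate structure of such a plane is a Euclidean field, and its geometric
    -- ordering is the ordering of that field
    (∀ M : Str.{u} planeSig, M.IsEuclideanOrderedMetricWu →
      ∀ (l₀ m₀ : M.Ln) (Z₀ : M.Pt), M.AdmissibleAxes l₀ m₀ Z₀ →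
        ∃ _ : Field (M.PointsOn l₀), M.coordField l₀ m₀ Z₀ = fieldStr (M.PointsOn l₀) ∧
          IsEuclideanField (M.PointsOn l₀) ∧
          ∀ a b : M.PointsOn l₀, SqLt a b ↔ M.Positive l₀ m₀ Z₀ (b - a).1) ∧
    -- (iii)
    (∀ (F : Type u) [Field F], IsEuclideanField F →
      ∀ (l₀ m₀ : (cartesianPlane F).Ln) (Z₀ : (cartesianPlane F).Pt),
        (cartesianPlane F).AdmissibleAxes l₀ m₀ Z₀ →
        Nonempty (Str.Iso ((cartesianPlane F).coordField l₀ m₀ Z₀) (fieldStr F))) ∧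
    -- (iv)
    (∀ M : Str.{u} planeSig, M.IsEuclideanOrderedMetricWu →
      ∀ (l₀ m₀ : M.Ln) (Z₀ : M.Pt), M.AdmissibleAxes l₀ m₀ Z₀ →
        ∀ _ : Field (M.PointsOn l₀), M.coordField l₀ m₀ Z₀ = fieldStr (M.PointsOn l₀) →
          Nonempty (Str.Iso (cartesianPlane (M.PointsOn l₀)) M)) ∧
    -- (v) the two constructions form a bi-interpretation
    ∃ (σ : Translation cartesianShape) (ξ : Translation coordShape)
      (α : IsoFormula cartesianShape coordShape) (β : IsoFormula coordShape cartesianShape),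
      DefinesCartesianPlane.{u} σ ∧ DefinesCoordField.{u} ξ ∧
      IsBiInterpretation EuclideanFieldStr.{u} Str.IsEuclideanOrderedMetricWu.{u} σ ξ α β := by
  refine ⟨fun F _ hF => isEuclideanOrderedMetricWu_of_iso hF (Str.Iso.refl _), ?_, ?_, ?_,
    cartesianScheme, coordScheme, fieldIsoFormula, planeIsoFormula,
    definesCartesianPlane_cartesianScheme, definesCoordField_coordScheme,
    isBiInterpretation_schemes⟩
  · intro M hM l₀ m₀ Z₀ hadm
    obtain ⟨F, _, x, y, hF, hE⟩ := hM.exists_euclideanChart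
    exact hE.exists_coordField hF hadm
  · intro F _ _ l₀ m₀ Z₀ hadm
    obtain ⟨u, v, h⟩ := cartesianPlane_chart.exists_axisChart hadm
    exact ⟨h.iso⟩
  · intro M hM l₀ m₀ Z₀ hadm _ hK
    obtain ⟨F, _, x, y, -, hE⟩ := hM.exists_euclideanChart
    obtain ⟨u, v, h⟩ := hE.exists_axisChart hadm
    have e := h.iso.symm
    -- The given field has the coordinate structure as its graph, so the chart can be rewritten with
    -- values in that field.
    rw [hK] at e
    obtain ⟨e', -⟩ := (hE.map (ringEquivOfIso e)).exists_iso
    exact ⟨e'.symm⟩
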